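/- An odd Durfee symbol of a positive integer $n$ is a two-rowed array with a subscript $$\begin{pmatrix} a_1 & a_2 & \cdots & a_s \\ b_1 & b_2 & \cdots & b_t \end{pmatrix}_{D},$$ where $D\ge 0$ is an integer, $s,t\ge 0$, all entries are odd positive integers, $2D+1\ge a_1\ge a_2\ge\cdots\ge a_s>0$, $2D+1\ge b_1\ge b_2\ge\cdots\ge b_t>0$, and $n=\sum_{i=1}^{s}a_i+\sum_{j=1}^{t}b_j+2D^2+2D+1$. Its odd rank is $s-t$. Let $N^{0}(a,M;n)$ denote the number of odd Durfee symbols of $n$ whose odd rank is congruent to $a$ modulo $M$. Theorem. For every integer $n\ge 0$ we have $$N^{0}(0,8;8n+r)>N^{0}(4,8;8n+r)\qquad\text{for } r\in\{1,3\},$$ and $$N^{0}(1,8;8n+r)>N^{0}(3,8;8n+r)\qquad\text{for } r\in\{0,2\},$$ where in the case $r=0$ it is assumed that $n\ge 1$. -/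

import Mathlib

/-- An odd Durfee symbol of `n`: a two-rowed array of odd positive integers with a subscript
`D ≥ 0`. Each row is a non-increasing sequence (possibly empty), that is, a finite multiset, of odd
numbers which are at most `2 * D + 1`, and `n` is the sum of all the entries plus
`2 * D ^ 2 + 2 * D + 1`. -/
@[ext]
structure OddDurfeeSymbol (n : ℕ) where
  /-- the subscript -/
  D : ℕ
  /-- the entries of the top row -/
  top : Multiset ℕ
  /-- the entries of the bottom row -/
  bottom : Multiset ℕ
  odd_top : ∀ a ∈ top, Odd a
  odd_bottom : ∀ b ∈ bottom, Odd b
  top_le : ∀ a ∈ top, a ≤ 2 * D + 1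
  bottom_le : ∀ b ∈ bottom, b ≤ 2 * D + 1
  weight_eq : n = top.sum + bottom.sum + 2 * D ^ 2 + 2 * D + 1

namespace OddDurfeeSymbol

/-- The odd rank: the number of entries in the top row minus the number in the bottom row. -/
def oddRank {n : ℕ} (s : OddDurfeeSymbol n) : ℤ :=
  (s.top.card : ℤ) - (s.bottom.card : ℤ)

/-- A row of odd numbers with sum at most `n` is a sub-multiset of a fixed finite multiset. -/
theorem row_le {n : ℕ} (m : Multiset ℕ) (hm : ∀ a ∈ m, Odd a) (h : m.sum ≤ n) :
    m ≤ n • (Multiset.range (n + 1)) := by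
  rw [Multiset.le_iff_count]
  intro a
  by_cases ha : a ∈ m
  · have hcard : m.card ≤ m.sum := by
      have := Multiset.card_nsmul_le_sum (s := m) (a := 1) (fun x hx => (hm x hx).pos)
      simpa using this
    have hle : a ≤ m.sum := Multiset.single_le_sum (fun _ _ => Nat.zero_le _) a ha
    have hc : Multiset.count a (Multiset.range (n + 1)) = 1 :=
      Multiset.count_eq_one_of_mem (Multiset.nodup_range _) (Multiset.mem_range.2 (by omega))
    rw [Multiset.count_nsmul, hc]
    have := Multiset.count_le_card a m
    omega
  · rw [Multiset.count_eq_zero_of_notMem ha]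
    exact Nat.zero_le _

/-- There are finitely many odd Durfee symbols of `n`, so counting them by `Nat.card` is
meaningful. -/
instance finite (n : ℕ) : Finite (OddDurfeeSymbol n) := by
  let T : Type := Set.Iic (n • (Multiset.range (n + 1)))
  haveI : Finite T := (Set.finite_Iic (n • (Multiset.range (n + 1)))).to_subtype
  let f : OddDurfeeSymbol n → Fin (n + 1) × T × T := fun s =>
    (⟨s.D, by have := s.weight_eq; omega⟩,
      ⟨s.top, row_le _ s.odd_top (by have := s.weight_eq; omega)⟩,
      ⟨s.bottom, row_le _ s.odd_bottom (by have := s.weight_eq; omega)⟩)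
  refine Finite.of_injective f ?_
  intro s t h
  simp only [f, Prod.mk.injEq, Fin.mk.injEq] at h
  exact OddDurfeeSymbol.ext h.1 (congrArg Subtype.val h.2.1) (congrArg Subtype.val h.2.2)

end OddDurfeeSymbol

/-- `oddRankCount a M n` is $N^0(a, M; n)$, the number of odd Durfee symbols of `n` whose odd rank
is congruent to `a` modulo `M`. -/
noncomputable def oddRankCount (a M : ℤ) (n : ℕ) : ℕ :=
  Nat.card {s : OddDurfeeSymbol n // s.oddRank ≡ a [ZMOD M]}

/-! Let ζ = exp(πi/4). Weighting each symbol of n by ζ^rank and using the symmetry rank ↦ -rank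
gives N⁰(0,8;n) - N⁰(4,8;n) + √2 (N⁰(1,8;n) - N⁰(3,8;n)). All entries are odd, so the rank has the
parity of n + 1 and only one of the two differences survives. The theorem thus asks for positivity
of this weighted count for n ≠ 0 with n mod 8 ≤ 3 (`rankSum_pos`).

Its generating function is r G(r), where G is a universal mock theta function: a sum over D of
q^(D²+D) divided by ∏ (1 - ζ r^(2l+1)) (1 - ζ⁻¹ r^(2l+1)), with q = r². Partial fractions and
Cauchy's identity turn G into a Lambert-type series (`hasSum_mock`). Such a series also appears at
each of the three poles in the partial fraction expansion of the reciprocal of three theta functions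
(`three_theta`). With poles 1, ir, -ir evaluated at x = ζr, the first pole gives G and the other two
combine into the third order mock theta functions ν and φ at y = r^8. Hence √2 r (G + r² ν) + 2φ is
a theta quotient (`durfee_identity`).

The functions ν and φ enter with the wrong sign. Each is one half of a bilateral series summed by a
limit of Ramanujan's ₁ψ₁ (`bilat_eq`); the other halves Y and X have nonnegative coefficients
(`mock_nu_identity`, `mock_phi_identity`). Trading ν, φ for Y, X and dissecting the thetas yields
`durfee_positive_form`: r G = √2 X + r³ Y + (-y²; y²)_∞ (r θ(1, y) + √2 r² θ(y, y²)). Everything on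
the right is nonnegative, and the four terms occupy the residues 0, 3, 1, 2 modulo 8. Every exponent
in these classes occurs, except 0, since X starts with y. Uniqueness of power series coefficients
finishes the argument. -/

open Finset Filter Topology

/-! ### Pochhammer symbols: recurrences, convergence, bounds -/

/-- The finite `q`-Pochhammer symbol `(a; q)_n`. -/
noncomputable def qPoch (a q : ℂ) (n : ℕ) : ℂ := ∏ k ∈ range n, (1 - a * q ^ k)

/-- The infinite `q`-Pochhammer symbol `(a; q)_∞`. -/
noncomputable def qPochInf (a q : ℂ) : ℂ := ∏' k : ℕ, (1 - a * q ^ k)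

@[simp] theorem qPoch_zero (a q : ℂ) : qPoch a q 0 = 1 := by simp [qPoch]

theorem qPoch_succ (a q : ℂ) (n : ℕ) : qPoch a q (n + 1) = qPoch a q n * (1 - a * q ^ n) := by
  simp [qPoch, prod_range_succ]

theorem qPoch_succ' (a q : ℂ) (n : ℕ) : qPoch a q (n + 1) = (1 - a) * qPoch (a * q) q n := by
  simp only [qPoch, prod_range_succ', pow_zero, mul_one]
  rw [mul_comm]
  congr 1
  exact prod_congr rfl fun k _ => by ring

theorem qPoch_add (a q : ℂ) (m n : ℕ) :
    qPoch a q (m + n) = qPoch a q m * qPoch (a * q ^ m) q n := by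
  simp only [qPoch, prod_range_add]
  congr 1
  exact prod_congr rfl fun k _ => by ring

theorem qPoch_ne_zero {a q : ℂ} (h : ∀ k : ℕ, 1 - a * q ^ k ≠ 0) (n : ℕ) : qPoch a q n ≠ 0 :=
  prod_ne_zero_iff.2 fun k _ => h k

theorem summable_norm_mul_pow {q : ℂ} (hq : ‖q‖ < 1) (a : ℂ) :
    Summable fun k : ℕ => ‖-(a * q ^ k)‖ := by
  simp only [norm_neg, norm_mul, norm_pow]
  exact (summable_geometric_of_lt_one (norm_nonneg _) hq).mul_left _

theorem multipliable_qPoch {q : ℂ} (hq : ‖q‖ < 1) (a : ℂ) :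
    Multipliable fun k : ℕ => (1 - a * q ^ k) := by
  simpa [sub_eq_add_neg] using multipliable_one_add_of_summable (summable_norm_mul_pow hq a)

theorem tendsto_qPoch {q : ℂ} (hq : ‖q‖ < 1) (a : ℂ) :
    Tendsto (qPoch a q) atTop (𝓝 (qPochInf a q)) :=
  (multipliable_qPoch hq a).hasProd.tendsto_prod_nat

theorem qPochInf_ne_zero {a q : ℂ} (hq : ‖q‖ < 1) (h : ∀ k : ℕ, 1 - a * q ^ k ≠ 0) :
    qPochInf a q ≠ 0 := by
  have := tprod_one_add_ne_zero_of_summable (f := fun k : ℕ => -(a * q ^ k))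
    (fun k => by simpa [sub_eq_add_neg] using h k) (summable_norm_mul_pow hq a)
  simpa [qPochInf, sub_eq_add_neg] using this

theorem qPochInf_succ {q : ℂ} (hq : ‖q‖ < 1) (a : ℂ) :
    qPochInf a q = (1 - a) * qPochInf (a * q) q := by
  refine tendsto_nhds_unique ((tendsto_qPoch hq a).comp (tendsto_add_atTop_nat 1)) ?_
  refine ((tendsto_qPoch hq (a * q)).const_mul (1 - a)).congr fun n => ?_
  simp [qPoch_succ']

theorem qPochInf_eq_qPoch_mul {q : ℂ} (hq : ‖q‖ < 1) (a : ℂ) (n : ℕ) :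
    qPochInf a q = qPoch a q n * qPochInf (a * q ^ n) q := by
  induction n with
  | zero => simp
  | succ n ih => rw [ih, qPoch_succ, qPochInf_succ hq (a * q ^ n)]; ring_nf

@[simp] theorem qPochInf_zero_left (q : ℂ) : qPochInf 0 q = 1 := by simp [qPochInf]

theorem qPochInf_one_left {q : ℂ} (hq : ‖q‖ < 1) : qPochInf 1 q = 0 := by
  rw [qPochInf_succ hq]; simp

theorem qPochInf_mul_neg {q : ℂ} (hq : ‖q‖ < 1) (a : ℂ) :
    qPochInf a q * qPochInf (-a) q = qPochInf (a ^ 2) (q ^ 2) := by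
  have h := (multipliable_qPoch hq a).tprod_mul (multipliable_qPoch hq (-a))
  rw [qPochInf, qPochInf, qPochInf, ← h]
  exact tprod_congr fun k => by ring

theorem norm_sq_lt_one {q : ℂ} (hq : ‖q‖ < 1) : ‖q ^ 2‖ < 1 := by
  rw [norm_pow]; exact pow_lt_one₀ (norm_nonneg _) hq two_ne_zero

theorem qPochInf_even_mul_odd {q : ℂ} (hq : ‖q‖ < 1) (a : ℂ) :
    qPochInf a (q ^ 2) * qPochInf (a * q) (q ^ 2) = qPochInf a q := by
  have h := tprod_even_mul_odd (f := fun k : ℕ => (1 - a * q ^ k))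
    ((multipliable_qPoch (norm_sq_lt_one hq) a).congr fun k => by rw [pow_mul])
    ((multipliable_qPoch (norm_sq_lt_one hq) (a * q)).congr fun k => by ring)
  rw [qPochInf, qPochInf, qPochInf, ← h]
  congr 1
  · exact tprod_congr fun k => by rw [pow_mul]
  · exact tprod_congr fun k => by ring

theorem exists_norm_le_of_tendsto {f : ℕ → ℂ} {l : ℂ} (h : Tendsto f atTop (𝓝 l)) :
    ∃ C : ℝ, 0 < C ∧ ∀ n, ‖f n‖ ≤ C := by
  obtain ⟨C, hC⟩ := h.norm.bddAbove_range
  exact ⟨max C 1, by positivity, fun n => (hC ⟨n, rfl⟩).trans (le_max_left _ _)⟩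

theorem exists_norm_inv_qPoch_le {a q : ℂ} (hq : ‖q‖ < 1) (h : ∀ k : ℕ, 1 - a * q ^ k ≠ 0) :
    ∃ C : ℝ, 0 < C ∧ ∀ n, ‖(qPoch a q n)⁻¹‖ ≤ C :=
  exists_norm_le_of_tendsto ((tendsto_qPoch hq a).inv₀ (qPochInf_ne_zero hq h))

theorem tendsto_mul_pow_zero {q : ℂ} (hq : ‖q‖ < 1) (a : ℂ) :
    Tendsto (fun k : ℕ => a * q ^ k) atTop (𝓝 0) := by
  simpa using (tendsto_pow_atTop_nhds_zero_of_norm_lt_one hq).const_mul a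

theorem exists_norm_inv_one_sub_le {q : ℂ} (hq : ‖q‖ < 1) (a : ℂ) :
    ∃ C : ℝ, 0 < C ∧ ∀ n : ℕ, ‖(1 - a * q ^ n)⁻¹‖ ≤ C := by
  refine exists_norm_le_of_tendsto (l := (1 - 0)⁻¹) (Tendsto.inv₀ ?_ (by simp))
  exact tendsto_const_nhds.sub (tendsto_mul_pow_zero hq a)

theorem one_sub_pow_ne_zero {q : ℂ} (hq : ‖q‖ < 1) (k : ℕ) : 1 - q * q ^ k ≠ 0 := by
  intro h
  have h1 : ‖q ^ (k + 1)‖ < 1 := by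
    rw [norm_pow]; exact pow_lt_one₀ (norm_nonneg _) hq (by omega)
  rw [pow_succ', ← sub_eq_zero.1 h] at h1
  simp at h1

/-- The ratio test. The basic series below have terms given as products over `range k`, so that this
one criterion dominates them. -/
theorem summable_prod_range {g : ℕ → ℝ} {l : ℝ} (hl : l < 1) (hg : ∀ j, 0 ≤ g j)
    (h : Tendsto g atTop (𝓝 l)) : Summable fun k => ∏ j ∈ range k, g j := by
  obtain ⟨r, hr, hr1⟩ := exists_between hl
  refine summable_of_ratio_norm_eventually_le hr1 ?_
  filter_upwards [h.eventually (gt_mem_nhds hr)] with n hn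
  rw [prod_range_succ, norm_mul, mul_comm]
  refine mul_le_mul_of_nonneg_right ?_ (norm_nonneg _)
  rw [Real.norm_of_nonneg (hg n)]
  exact hn.le

theorem tsum_sub_telescope {v : ℕ → ℂ} (hv : Tendsto v atTop (𝓝 0))
    (hs : Summable fun k => v (k + 1) - v k) : ∑' k, (v (k + 1) - v k) = - v 0 := by
  refine tendsto_nhds_unique hs.hasSum.tendsto_sum_nat ?_
  simp only [sum_range_sub]
  simpa using hv.sub_const (v 0)

/-! ### The ₁φ₁ summation, with Euler's and Cauchy's identities -/

/-- The terms of the basic hypergeometric series `₁φ₁(C / z; C; q, z)`. -/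
noncomputable def phiTerm (q z C : ℂ) (k : ℕ) : ℂ :=
  ∏ j ∈ range k, (-(q ^ j * (z - C * q ^ j)) / ((1 - q * q ^ j) * (1 - C * q ^ j)))

theorem phiTerm_succ (q z C : ℂ) (k : ℕ) : phiTerm q z C (k + 1) = phiTerm q z C k *
    (-(q ^ k * (z - C * q ^ k)) / ((1 - q * q ^ k) * (1 - C * q ^ k))) := by
  rw [phiTerm, prod_range_succ, phiTerm]

/-- Writes the series at (zq, Cq) over the terms of the series at (z, C), so that the two can be
compared term by term. -/
theorem phiTerm_shift {q z C : ℂ} (hC : ∀ k : ℕ, 1 - C * q ^ k ≠ 0) (k : ℕ) :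
    phiTerm q (z * q) (C * q) k * (1 - C * q ^ k) = phiTerm q z C k * (q ^ k * (1 - C)) := by
  induction k with
  | zero => simp [phiTerm]
  | succ k ih =>
    have h1 := hC k
    have h2 := hC (k + 1)
    have h2' : 1 - C * q * q ^ k ≠ 0 := by convert h2 using 1; ring
    have e : phiTerm q (z * q) (C * q) k = phiTerm q z C k * (q ^ k * (1 - C)) / (1 - C * q ^ k) := by
      rw [← ih]; field_simp
    rw [phiTerm_succ, phiTerm_succ, e, pow_succ']
    rw [pow_succ'] at h2
    generalize q ^ k = X at *
    by_cases h3 : 1 - q * X = 0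
    · simp [h3]
    have h4 : 1 - X * q ≠ 0 := by rwa [mul_comm]
    have h5 : 1 - X * C ≠ 0 := by rwa [mul_comm]
    have h6 : 1 - X * C * q ≠ 0 := by rwa [show X * C * q = C * q * X by ring]
    field_simp

/-- The bound is uniform in the shift N: the factor ‖q‖^j B gives a dominating series, and the
factor ‖q‖^N gives the limit of each term. -/
theorem exists_phiTerm_bound {q : ℂ} (hq : ‖q‖ < 1) (z : ℂ) {C : ℂ}
    (_hC : ∀ k : ℕ, 1 - C * q ^ k ≠ 0) :
    ∃ B : ℝ, 0 < B ∧ ∀ N j : ℕ, ‖-(q ^ j * (z * q ^ N - C * q ^ N * q ^ j)) /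
      ((1 - q * q ^ j) * (1 - C * q ^ N * q ^ j))‖ ≤ ‖q‖ ^ N * (‖q‖ ^ j * B) := by
  obtain ⟨K, hK, hK'⟩ := exists_norm_inv_one_sub_le hq q
  obtain ⟨M, hM, hM'⟩ := exists_norm_inv_one_sub_le hq C
  refine ⟨(‖z‖ + ‖C‖ + 1) * (K * M), by positivity, fun N j => ?_⟩
  have e : -(q ^ j * (z * q ^ N - C * q ^ N * q ^ j)) / ((1 - q * q ^ j) * (1 - C * q ^ N * q ^ j)) =
      -(q ^ N * (q ^ j * ((z - C * q ^ j) * ((1 - q * q ^ j)⁻¹ * (1 - C * q ^ (N + j))⁻¹)))) := by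
    rw [show C * q ^ N * q ^ j = C * q ^ (N + j) by ring, div_eq_mul_inv, mul_inv]; ring
  rw [e, norm_neg, norm_mul, norm_mul, norm_mul, norm_mul, norm_pow, norm_pow]
  gcongr
  · refine (norm_sub_le _ _).trans ?_
    have : ‖C * q ^ j‖ ≤ ‖C‖ := by
      rw [norm_mul, norm_pow]
      exact mul_le_of_le_one_right (norm_nonneg _) (pow_le_one₀ (norm_nonneg _) hq.le)
    linarith
  · exact hK' j
  · exact hM' _

theorem summable_pow_mul_prod {r : ℝ} (hr : 0 ≤ r) (hr1 : r < 1) {B : ℝ} (hB : 0 ≤ B) :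
    Summable fun k => ∏ j ∈ range k, (r ^ j * B) := by
  refine summable_prod_range zero_lt_one (fun j => by positivity) ?_
  simpa using (tendsto_pow_atTop_nhds_zero_of_lt_one hr hr1).mul_const B

theorem summable_phiTerm {q : ℂ} (hq : ‖q‖ < 1) (z : ℂ) {C : ℂ}
    (hC : ∀ k : ℕ, 1 - C * q ^ k ≠ 0) : Summable (phiTerm q z C) := by
  obtain ⟨B, hB, h⟩ := exists_phiTerm_bound hq z hC
  refine Summable.of_norm_bounded (summable_pow_mul_prod (norm_nonneg q) hq hB.le) fun k => ?_
  rw [phiTerm, norm_prod]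
  refine prod_le_prod (fun _ _ => norm_nonneg _) fun j _ => ?_
  simpa using h 0 j

/-- The termwise difference of the two sides telescopes, so iterating moves all dependence on z and
C into Pochhammer symbols. -/
theorem tsum_phiTerm_succ {q : ℂ} (hq : ‖q‖ < 1) (z : ℂ) {C : ℂ}
    (hC : ∀ k : ℕ, 1 - C * q ^ k ≠ 0) :
    (1 - C) * ∑' k, phiTerm q z C k = (1 - z) * ∑' k, phiTerm q (z * q) (C * q) k := by
  have hC' : ∀ k : ℕ, 1 - C * q * q ^ k ≠ 0 := fun k => by
    have := hC (k + 1); rwa [pow_succ', ← mul_assoc] at this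
  have s1 := summable_phiTerm hq z hC
  have s2 := summable_phiTerm hq (z * q) hC'
  -- The telescoping certificate; the factor 1 - q^k makes it vanish at k = 0, so no boundary term
  -- remains.
  set v : ℕ → ℂ := fun k => -((1 - C) * (1 - q ^ k)) * phiTerm q z C k with hv
  have key : ∀ k, (1 - C) * phiTerm q z C k - (1 - z) * phiTerm q (z * q) (C * q) k
      = v (k + 1) - v k := fun k => by
    have h1 := hC k
    have h3 := one_sub_pow_ne_zero hq k
    have e : phiTerm q (z * q) (C * q) k =
        phiTerm q z C k * (q ^ k * (1 - C)) / (1 - C * q ^ k) := by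
      rw [← phiTerm_shift hC]; field_simp
    simp only [hv]
    rw [phiTerm_succ, e]
    rw [show (1 - q ^ (k + 1)) = 1 - q * q ^ k by ring]
    generalize q ^ k = X at *
    have h4 : 1 - X * q ≠ 0 := by rwa [mul_comm]
    have h5 : 1 - X * C ≠ 0 := by rwa [mul_comm]
    field_simp
    ring
  have hv0 : Tendsto v atTop (𝓝 0) := by
    have h1 : Tendsto (fun k : ℕ => -((1 - C) * (1 - q ^ k))) atTop (𝓝 (-((1 - C) * (1 - 0)))) :=
      ((tendsto_const_nhds.sub (tendsto_pow_atTop_nhds_zero_of_norm_lt_one hq)).const_mul _).neg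
    simpa [hv] using h1.mul s1.tendsto_atTop_zero
  have hs := ((s1.mul_left (1 - C)).sub (s2.mul_left (1 - z)))
  have h := tsum_sub_telescope hv0 (hs.congr key)
  rw [← tsum_congr key, (s1.mul_left _).tsum_sub (s2.mul_left _), tsum_mul_left, tsum_mul_left] at h
  simp only [hv, pow_zero, sub_self, mul_zero, neg_zero, zero_mul] at h
  exact sub_eq_zero.1 h

theorem tendsto_tsum_phiTerm {q : ℂ} (hq : ‖q‖ < 1) (z : ℂ) {C : ℂ}
    (hC : ∀ k : ℕ, 1 - C * q ^ k ≠ 0) :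
    Tendsto (fun N : ℕ => ∑' k, phiTerm q (z * q ^ N) (C * q ^ N) k) atTop (𝓝 1) := by
  obtain ⟨B, hB, h⟩ := exists_phiTerm_bound hq z hC
  -- In the limit every factor is 0, and only the empty product at k = 0 survives.
  have h1 : ∑' k : ℕ, ∏ _j ∈ range k, (0 : ℂ) = 1 := by
    rw [tsum_eq_single 0]
    · simp
    · intro k hk; simp [hk]
  rw [← h1]
  refine tendsto_tsum_of_dominated_convergence
    (summable_pow_mul_prod (norm_nonneg q) hq hB.le) (fun k => ?_) (Eventually.of_forall fun N k => ?_)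
  · refine tendsto_finsetProd _ fun j _ => ?_
    refine squeeze_zero_norm (fun N => h N j) ?_
    simpa using (tendsto_pow_atTop_nhds_zero_of_lt_one (norm_nonneg q) hq).mul_const _
  · rw [phiTerm, norm_prod]
    refine prod_le_prod (fun _ _ => norm_nonneg _) fun j _ => (h N j).trans ?_
    exact mul_le_of_le_one_left (by positivity) (pow_le_one₀ (norm_nonneg _) hq.le)

/-- The summation of `₁φ₁`. -/
theorem tsum_phiTerm {q : ℂ} (hq : ‖q‖ < 1) (z : ℂ) {C : ℂ}
    (hC : ∀ k : ℕ, 1 - C * q ^ k ≠ 0) :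
    ∑' k, phiTerm q z C k = qPochInf z q / qPochInf C q := by
  have key : ∀ N : ℕ, qPoch C q N * ∑' k, phiTerm q z C k =
      qPoch z q N * ∑' k, phiTerm q (z * q ^ N) (C * q ^ N) k := by
    intro N
    induction N with
    | zero => simp
    | succ N ih =>
      have hC' : ∀ k : ℕ, 1 - C * q ^ N * q ^ k ≠ 0 := fun k => by
        have := hC (N + k); rwa [pow_add, ← mul_assoc] at this
      have := tsum_phiTerm_succ hq (z * q ^ N) hC'
      rw [qPoch_succ, qPoch_succ, mul_right_comm, ih]
      rw [pow_succ, ← mul_assoc, ← mul_assoc]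
      linear_combination qPoch z q N * this
  have h1 := (tendsto_qPoch hq C).mul_const (∑' k, phiTerm q z C k)
  have h2 := (tendsto_qPoch hq z).mul (tendsto_tsum_phiTerm hq z hC)
  have := tendsto_nhds_unique h1 (h2.congr fun N => (key N).symm)
  rw [eq_div_iff (qPochInf_ne_zero hq hC), mul_comm, this, mul_one]

/-- Euler's expansion of `(z; q)_∞`. -/
theorem hasSum_euler {q : ℂ} (hq : ‖q‖ < 1) (z : ℂ) :
    HasSum (fun k => ∏ j ∈ range k, (-(q ^ j * z) / (1 - q * q ^ j))) (qPochInf z q) := by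
  have h := (summable_phiTerm hq z (C := 0) (by simp)).hasSum
  rw [tsum_phiTerm hq z (by simp)] at h
  rw [qPochInf_zero_left, div_one] at h
  convert h using 2 with k
  simp only [phiTerm, zero_mul, sub_zero, mul_one]

theorem prod_pow_mul_const (q b : ℂ) (k : ℕ) :
    ∏ j ∈ range k, (q ^ j * (b * q * q ^ j)) = q ^ (k ^ 2) * b ^ k := by
  induction k with
  | zero => simp
  | succ k ih => rw [prod_range_succ, ih]; ring

/-- Cauchy's identity, counting partitions by their Durfee rectangles. -/
theorem hasSum_cauchy {q : ℂ} (hq : ‖q‖ < 1) {b : ℂ} (hb : ∀ k : ℕ, 1 - b * q * q ^ k ≠ 0) :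
    HasSum (fun k => q ^ (k ^ 2) * b ^ k / (qPoch q q k * qPoch (b * q) q k))
      (qPochInf (b * q) q)⁻¹ := by
  have h := (summable_phiTerm hq 0 hb).hasSum
  rw [tsum_phiTerm hq 0 hb, qPochInf_zero_left, one_div] at h
  convert h using 2 with k
  rw [phiTerm, prod_div_distrib, prod_mul_distrib, ← prod_pow_mul_const]
  simp [qPoch]

/-! ### The bilateral series: Jacobi's triple product and a limit of ₁ψ₁ -/

/-- The term of index `n ≥ 0` of the bilateral series `∑ (-1)^n q^(n(n-1)/2) z^n / (b; q)_n`. -/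
noncomputable def bilatPos (q z b : ℂ) (n : ℕ) : ℂ :=
  ∏ j ∈ range n, (-(q ^ j * z) / (1 - b * q ^ j))

/-- The term of index `-m ≤ 0` of the bilateral series `∑ (-1)^n q^(n(n-1)/2) z^n / (b; q)_n`. -/
noncomputable def bilatNeg (q z b : ℂ) (m : ℕ) : ℂ :=
  ∏ j ∈ range m, ((b - q ^ (j + 1)) / z)

/-- The bilateral series `∑ (-1)^n q^(n(n-1)/2) z^n / (b; q)_n`. -/
noncomputable def bilat (q z b : ℂ) : ℂ :=
  ∑' n, bilatPos q z b n + ∑' m, bilatNeg q z b (m + 1)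

theorem bilatPos_succ (q z b : ℂ) (n : ℕ) :
    bilatPos q z b (n + 1) = bilatPos q z b n * (-(q ^ n * z) / (1 - b * q ^ n)) := by
  rw [bilatPos, prod_range_succ, bilatPos]

theorem bilatNeg_succ (q z b : ℂ) (m : ℕ) :
    bilatNeg q z b (m + 1) = bilatNeg q z b m * ((b - q ^ (m + 1)) / z) := by
  rw [bilatNeg, prod_range_succ, bilatNeg]

theorem exists_bilatPos_bound {q : ℂ} (hq : ‖q‖ < 1) (z b : ℂ) :
    ∃ B : ℝ, 0 < B ∧ ∀ N j : ℕ, ‖-(q ^ j * z) / (1 - b * q ^ N * q ^ j)‖ ≤ ‖q‖ ^ j * B := by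
  obtain ⟨M, hM, hM'⟩ := exists_norm_inv_one_sub_le hq b
  refine ⟨(‖z‖ + 1) * M, by positivity, fun N j => ?_⟩
  rw [mul_assoc b, ← pow_add, div_eq_mul_inv, norm_mul, norm_neg, norm_mul, norm_pow, ← mul_assoc]
  gcongr
  · linarith
  · exact hM' _

theorem summable_bilatPos {q : ℂ} (hq : ‖q‖ < 1) (z b : ℂ) : Summable (bilatPos q z b) := by
  obtain ⟨B, hB, h⟩ := exists_bilatPos_bound hq z b
  refine Summable.of_norm_bounded (summable_pow_mul_prod (norm_nonneg q) hq hB.le) fun k => ?_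
  rw [bilatPos, norm_prod]
  refine prod_le_prod (fun _ _ => norm_nonneg _) fun j _ => ?_
  simpa using h 0 j

theorem summable_prod_add_pow_div {q : ℂ} (hq : ‖q‖ < 1) {z : ℂ} {r : ℝ} (hr : 0 ≤ r)
    (h : r < ‖z‖) : Summable fun m => ∏ j ∈ range m, ((r + ‖q‖ ^ (j + 1)) / ‖z‖) := by
  have hz : 0 < ‖z‖ := hr.trans_lt h
  refine summable_prod_range (l := r / ‖z‖) ((div_lt_one hz).2 h) (fun j => by positivity) ?_
  have := ((tendsto_pow_atTop_nhds_zero_of_lt_one (norm_nonneg q) hq).comp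
    (tendsto_add_atTop_nat 1)).const_add r
  simpa using this.div_const ‖z‖

theorem norm_bilatNeg_le (q z : ℂ) {b : ℂ} {r : ℝ} (h : ‖b‖ ≤ r) (m : ℕ) :
    ‖bilatNeg q z b m‖ ≤ ∏ j ∈ range m, ((r + ‖q‖ ^ (j + 1)) / ‖z‖) := by
  rw [bilatNeg, norm_prod]
  refine prod_le_prod (fun _ _ => norm_nonneg _) fun j _ => ?_
  rw [norm_div]
  gcongr
  refine (norm_sub_le _ _).trans ?_
  rw [norm_pow]
  gcongr

theorem summable_bilatNeg {q : ℂ} (hq : ‖q‖ < 1) {z b : ℂ} (h : ‖b‖ < ‖z‖) :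
    Summable (bilatNeg q z b) :=
  Summable.of_norm_bounded (summable_prod_add_pow_div hq (norm_nonneg b) h)
    (norm_bilatNeg_le q z le_rfl)

theorem bilatPos_shift {q z b : ℂ} (hb : ∀ k : ℕ, 1 - b * q ^ k ≠ 0) (n : ℕ) :
    bilatPos q z (b * q) n * (1 - b * q ^ n) = (1 - b) * bilatPos q z b n := by
  induction n with
  | zero => simp [bilatPos]
  | succ n ih =>
    have h1 := hb n
    have h2 := hb (n + 1)
    rw [bilatPos_succ, bilatPos_succ]
    rw [show b * q ^ (n + 1) = b * q * q ^ n by ring] at *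
    rw [mul_assoc, div_mul_cancel₀ _ h2, ← mul_assoc, ← ih, mul_assoc, mul_div_cancel₀ _ h1]

theorem bilatNeg_shift (q z b : ℂ) (m : ℕ) :
    bilatNeg q z (b * q) (m + 1) = q ^ (m + 1) / z * (b - 1) * bilatNeg q z b m := by
  induction m with
  | zero => simp [bilatNeg]; ring
  | succ m ih => rw [bilatNeg_succ, ih, bilatNeg_succ]; ring

/-- The functional equation in b behind both product formulas: its iteration relates b to b q^N,
hence to b = 0. -/
theorem bilat_succ {q : ℂ} (hq : ‖q‖ < 1) {z b : ℂ} (hz : z ≠ 0)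
    (hb : ∀ k : ℕ, 1 - b * q ^ k ≠ 0) (hs : Summable (bilatNeg q z b)) :
    (1 - b) * (1 - b / z) * bilat q z b = bilat q z (b * q) := by
  have p1 := summable_bilatPos hq z b
  have p2 := summable_bilatPos hq z (b * q)
  have n1 := (summable_nat_add_iff 1).2 hs
  have n2 : Summable fun m => bilatNeg q z (b * q) (m + 1) := by
    simp only [bilatNeg_shift]
    refine Summable.of_norm_bounded (hs.norm.mul_left ‖(b - 1) / z‖) fun m => ?_
    rw [show q ^ (m + 1) / z * (b - 1) * bilatNeg q z b m =
      q ^ (m + 1) * ((b - 1) / z * bilatNeg q z b m) by ring, norm_mul, norm_mul _ (bilatNeg _ _ _ _),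
      norm_pow]
    exact mul_le_of_le_one_left (by positivity) (pow_le_one₀ (norm_nonneg _) hq.le)
  -- Both halves telescope with the potential (1 - b)(b / z) times the term. Their boundary values
  -- at index 0 are opposite and cancel in the total.
  have key1 : ∀ n, (1 - b) * (1 - b / z) * bilatPos q z b n - bilatPos q z (b * q) n =
      (1 - b) * (b / z) * bilatPos q z b (n + 1) - (1 - b) * (b / z) * bilatPos q z b n := by
    intro n
    have h1 := hb n
    have e : bilatPos q z (b * q) n = (1 - b) * bilatPos q z b n / (1 - b * q ^ n) := by
      rw [← bilatPos_shift hb]; field_simp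
    rw [bilatPos_succ, e]
    generalize q ^ n = X at *
    field_simp
    ring
  have key2 : ∀ m, (1 - b) * (1 - b / z) * bilatNeg q z b (m + 1) - bilatNeg q z (b * q) (m + 1) =
      -((1 - b) * (b / z) * bilatNeg q z b (m + 1) - (1 - b) * (b / z) * bilatNeg q z b m) := by
    intro m
    rw [bilatNeg_shift, bilatNeg_succ]
    field_simp
    ring
  have hp0 : Tendsto (fun n => (1 - b) * (b / z) * bilatPos q z b n) atTop (𝓝 0) := by
    simpa using p1.tendsto_atTop_zero.const_mul ((1 - b) * (b / z))
  have hn0 : Tendsto (fun n => (1 - b) * (b / z) * bilatNeg q z b n) atTop (𝓝 0) := by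
    simpa using hs.tendsto_atTop_zero.const_mul ((1 - b) * (b / z))
  have t1 := tsum_sub_telescope hp0 (((p1.mul_left _).sub p2).congr key1)
  have t2 := tsum_sub_telescope hn0 (by
    simpa only [neg_neg] using (((n1.mul_left _).sub n2).congr key2).neg)
  rw [← tsum_congr key1, (p1.mul_left _).tsum_sub p2, tsum_mul_left] at t1
  have t3 : ∑' m, -((1 - b) * (1 - b / z) * bilatNeg q z b (m + 1) -
      bilatNeg q z (b * q) (m + 1)) = -((1 - b) * (b / z) * bilatNeg q z b 0) := by
    rw [← t2]
    exact tsum_congr fun m => by rw [key2, neg_neg]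
  rw [tsum_neg, (n1.mul_left _).tsum_sub n2, tsum_mul_left] at t3
  simp only [bilatPos, bilatNeg, range_zero, prod_empty, mul_one] at t1 t3
  simp only [bilat, bilatPos, bilatNeg]
  linear_combination t1 - t3

theorem tendsto_bilat {q : ℂ} (hq : ‖q‖ < 1) {z : ℂ} (hz : z ≠ 0) (b : ℂ) :
    Tendsto (fun N : ℕ => bilat q z (b * q ^ N)) atTop (𝓝 (bilat q z 0)) := by
  have hbq := tendsto_mul_pow_zero hq b
  refine Tendsto.add ?_ ?_
  · obtain ⟨B, hB, h⟩ := exists_bilatPos_bound hq z b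
    refine tendsto_tsum_of_dominated_convergence
      (summable_pow_mul_prod (norm_nonneg q) hq hB.le) (fun k => ?_)
      (Eventually.of_forall fun N k => ?_)
    · refine tendsto_finsetProd _ fun j _ => ?_
      refine Tendsto.div tendsto_const_nhds ?_ (by simp)
      exact tendsto_const_nhds.sub (hbq.mul_const _)
    · rw [bilatPos, norm_prod]
      exact prod_le_prod (fun _ _ => norm_nonneg _) fun j _ => h N j
  · have hz' : 0 < ‖z‖ := norm_pos_iff.2 hz
    -- Any radius below ‖z‖ would do: b q^N tends to 0, so it eventually lies below ‖z‖ / 2 and one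
    -- dominating series serves all large N.
    have hs := summable_prod_add_pow_div hq (z := z) (r := ‖z‖ / 2) (by positivity) (by linarith)
    refine tendsto_tsum_of_dominated_convergence ((summable_nat_add_iff 1).2 hs) (fun k => ?_) ?_
    · refine tendsto_finsetProd _ fun j _ => ?_
      exact (hbq.sub_const _).div_const _
    · have : ∀ᶠ N : ℕ in atTop, ‖b * q ^ N‖ < ‖z‖ / 2 :=
        hbq.norm.eventually (gt_mem_nhds (by simpa using hz'))
      filter_upwards [this] with N hN k
      exact norm_bilatNeg_le q z hN.le _

/-- At b = q each term of negative index contains the factor q - q = 0, which leaves Euler's series.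
-/
theorem bilat_q {q : ℂ} (hq : ‖q‖ < 1) (z : ℂ) : bilat q z q = qPochInf z q := by
  have h : ∀ m, bilatNeg q z q (m + 1) = 0 := fun m => by
    rw [bilatNeg, prod_eq_zero (mem_range.2 m.succ_pos)]; simp
  rw [bilat, tsum_congr h, tsum_zero, add_zero, ← (hasSum_euler hq z).tsum_eq]
  rfl

/-- The Jacobi triple product identity. -/
theorem bilat_zero {q : ℂ} (hq : ‖q‖ < 1) {z : ℂ} (hz : z ≠ 0) :
    bilat q z 0 = qPochInf z q * qPochInf (q / z) q * qPochInf q q := by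
  -- The functional equation leads from b = q, where the value is Euler's product, to b = q^(N+1),
  -- and then N → ∞.
  have key : ∀ N : ℕ, bilat q z (q * q ^ N) =
      qPoch q q N * qPoch (q / z) q N * qPochInf z q := by
    intro N
    induction N with
    | zero => simp [bilat_q hq]
    | succ N ih =>
      have hs : Summable (bilatNeg q z (q * q ^ N)) := by
        -- The negative half terminates because the factor with j = N is zero; no comparison of ‖b‖
        -- with ‖z‖ is needed.
        refine summable_of_ne_finset_zero (s := range (N + 1)) fun m hm => ?_
        rw [bilatNeg, prod_eq_zero (i := N)]
        · simp only [mem_range] at *; omega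
        · rw [pow_succ', sub_self, zero_div]
      have := bilat_succ hq hz (b := q * q ^ N) (fun k => by
        rw [mul_assoc, ← pow_add]; exact one_sub_pow_ne_zero hq _) hs
      rw [pow_succ, ← mul_assoc, ← this, ih, qPoch_succ, qPoch_succ]
      ring
  have h := tendsto_nhds_unique ((tendsto_bilat hq hz q).congr key)
    (((tendsto_qPoch hq q).mul (tendsto_qPoch hq (q / z))).mul_const (qPochInf z q))
  rw [h]; ring

/-- The limiting case `a → ∞` of Ramanujan's `₁ψ₁` summation. -/
theorem bilat_eq {q : ℂ} (hq : ‖q‖ < 1) {z b : ℂ} (hb : ∀ k : ℕ, 1 - b * q ^ k ≠ 0)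
    (hbz : ‖b‖ < ‖z‖) :
    qPochInf b q * qPochInf (b / z) q * bilat q z b =
      qPochInf z q * qPochInf (q / z) q * qPochInf q q := by
  have hz : z ≠ 0 := norm_pos_iff.1 ((norm_nonneg b).trans_lt hbz)
  have key : ∀ N : ℕ, qPoch b q N * qPoch (b / z) q N * bilat q z b = bilat q z (b * q ^ N) := by
    intro N
    induction N with
    | zero => simp
    | succ N ih =>
      have := bilat_succ hq hz (b := b * q ^ N) (fun k => by
        rw [mul_assoc, ← pow_add]; exact hb _) (summable_bilatNeg hq (by
          rw [norm_mul, norm_pow]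
          exact (mul_le_of_le_one_right (norm_nonneg _)
            (pow_le_one₀ (norm_nonneg _) hq.le)).trans_lt hbz))
      rw [pow_succ, ← mul_assoc, ← this, ← ih, qPoch_succ, qPoch_succ]
      ring
  rw [← bilat_zero hq hz]
  exact tendsto_nhds_unique
    ((((tendsto_qPoch hq b).mul (tendsto_qPoch hq (b / z))).mul_const _).congr key)
    (tendsto_bilat hq hz b)

/-! ### Theta functions and their dissections -/

theorem HasSum.int_even_add_odd {f : ℤ → ℂ} {a b : ℂ} (he : HasSum (fun k => f (2 * k)) a)
    (ho : HasSum (fun k => f (2 * k + 1)) b) : HasSum f (a + b) := by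
  have := mul_right_injective₀ (two_ne_zero' ℤ)
  replace ho := ((add_left_injective 1).comp this).hasSum_range_iff.2 ho
  refine (this.hasSum_range_iff.2 he).add_isCompl ?_ ho
  simpa [Function.comp_def] using Int.isCompl_even_odd

/-- The theta function `∑ w ^ n t ^ (n ^ 2)`, in its product form. -/
noncomputable def theta (w t : ℂ) : ℂ :=
  qPochInf (-(t * w)) (t ^ 2) * qPochInf (-(t / w)) (t ^ 2) * qPochInf (t ^ 2) (t ^ 2)

theorem theta_inv (w t : ℂ) : theta w⁻¹ t = theta w t := by
  simp only [theta, div_inv_eq_mul, ← div_eq_mul_inv]; ring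

theorem theta_eq_bilat {w t : ℂ} (ht0 : t ≠ 0) (ht : ‖t‖ < 1) (hw : w ≠ 0) :
    theta w t = bilat (t ^ 2) (-(t * w)) 0 := by
  rw [bilat_zero (norm_sq_lt_one ht) (neg_ne_zero.2 (mul_ne_zero ht0 hw)), theta,
    show t ^ 2 / -(t * w) = -(t / w) by field_simp]

theorem bilatPos_theta (w t : ℂ) (n : ℕ) :
    bilatPos (t ^ 2) (-(t * w)) 0 n = w ^ n * t ^ (n ^ 2) := by
  induction n with
  | zero => simp [bilatPos]
  | succ n ih => rw [bilatPos_succ, ih]; ring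

theorem bilatNeg_theta {w t : ℂ} (ht0 : t ≠ 0) (hw : w ≠ 0) (n : ℕ) :
    bilatNeg (t ^ 2) (-(t * w)) 0 n = (w ^ n)⁻¹ * t ^ (n ^ 2) := by
  induction n with
  | zero => simp [bilatNeg]
  | succ n ih => rw [bilatNeg_succ, ih]; field_simp; ring

theorem hasSum_theta {w t : ℂ} (ht0 : t ≠ 0) (ht : ‖t‖ < 1) (hw : w ≠ 0) :
    HasSum (fun n : ℤ => w ^ n * t ^ (n ^ 2)) (theta w t) := by
  have hq := norm_sq_lt_one ht
  have h1 := (summable_bilatPos hq (-(t * w)) 0).hasSum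
  have h2 := ((summable_nat_add_iff 1).2 (summable_bilatNeg hq (z := -(t * w)) (b := 0) (by
    simpa using mul_pos (norm_pos_iff.2 ht0) (norm_pos_iff.2 hw)))).hasSum
  rw [theta_eq_bilat ht0 ht hw]
  refine HasSum.of_nat_of_neg_add_one ?_ ?_
  · refine h1.congr_fun fun n => ?_
    rw [bilatPos_theta]; norm_cast
  · refine h2.congr_fun fun n => ?_
    rw [bilatNeg_theta ht0 hw, neg_sq, zpow_neg]; norm_cast

/-- Splits the theta series by the parity of the summation index. -/
theorem theta_dissect {w t : ℂ} (ht0 : t ≠ 0) (ht : ‖t‖ < 1) (hw : w ≠ 0) :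
    theta w t = theta (w ^ 2) (t ^ 4) + w * t * theta (w ^ 2 * t ^ 4) (t ^ 4) := by
  have ht4 : ‖t ^ 4‖ < 1 := by
    rw [norm_pow]; exact pow_lt_one₀ (norm_nonneg _) ht (by norm_num)
  have h0 : t ^ 4 ≠ 0 := pow_ne_zero _ ht0
  have h1 := hasSum_theta h0 ht4 (pow_ne_zero 2 hw)
  have h2 := (hasSum_theta h0 ht4 (mul_ne_zero (pow_ne_zero 2 hw) h0)).mul_left (w * t)
  refine (hasSum_theta ht0 ht hw).unique (HasSum.int_even_add_odd ?_ ?_)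
  · refine h1.congr_fun fun n => ?_
    rw [← zpow_natCast, ← zpow_natCast, ← zpow_mul, ← zpow_mul]
    congr 2; push_cast; ring
  · refine h2.congr_fun fun n => ?_
    rw [mul_zpow, ← zpow_natCast, ← zpow_natCast, ← zpow_mul, ← zpow_mul, ← zpow_mul]
    rw [show (2 * n + 1 : ℤ) ^ 2 = 1 + ((4 : ℕ) : ℤ) * n + ((4 : ℕ) : ℤ) * n ^ 2 by push_cast; ring,
      show (2 * n + 1 : ℤ) = ((2 : ℕ) : ℤ) * n + 1 by push_cast; ring,
      zpow_add₀ hw, zpow_add₀ ht0, zpow_add₀ ht0, zpow_one, zpow_one]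
    ring

theorem theta_neg_self {t : ℂ} (ht0 : t ≠ 0) (ht : ‖t‖ < 1) : theta (-t) t = 0 := by
  rw [theta, show -(t / -t) = 1 by field_simp, qPochInf_one_left (norm_sq_lt_one ht)]
  simp

theorem theta_mul_sq {w t : ℂ} (ht0 : t ≠ 0) (ht : ‖t‖ < 1) (hw : w ≠ 0) :
    t * w * theta (w * t ^ 2) t = theta w t := by
  have hq := norm_sq_lt_one ht
  rw [theta, theta, qPochInf_succ hq (-(t * w)), qPochInf_succ hq (-(t / (w * t ^ 2))),
    show -(t / (w * t ^ 2)) * t ^ 2 = -(t / w) by field_simp,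
    show -(t * (w * t ^ 2)) = -(t * w) * t ^ 2 by ring]
  field_simp
  ring

/-- Two dissections give four thetas in t^16. One is θ(-t^16, t^16) = 0, and quasi-periodicity
(`theta_mul_sq`) merges the two thetas of odd index, which produces the factor 1 - i. -/
theorem theta_dissect_eight {z t : ℂ} (ht0 : t ≠ 0) (ht : ‖t‖ < 1) (hz : z ^ 2 = Complex.I) :
    theta z t = theta (-1) (t ^ 16) +
      z * (1 - Complex.I) * t * theta (-t ^ 8) (t ^ 16) := by
  have hz0 : z ≠ 0 := by
    rintro rfl; exact Complex.I_ne_zero (by simpa using hz.symm)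
  have hI := Complex.I_ne_zero
  have ht4 : ‖t ^ 4‖ < 1 := by
    rw [norm_pow]; exact pow_lt_one₀ (norm_nonneg _) ht (by norm_num)
  have ht16 : ‖t ^ 16‖ < 1 := by
    rw [norm_pow]; exact pow_lt_one₀ (norm_nonneg _) ht (by norm_num)
  have h0 : t ^ 4 ≠ 0 := pow_ne_zero _ ht0
  have h16 : t ^ 16 ≠ 0 := pow_ne_zero _ ht0
  have h8 : t ^ 8 ≠ 0 := pow_ne_zero _ ht0
  rw [theta_dissect ht0 ht hz0, hz, theta_dissect h0 ht4 hI,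
    theta_dissect h0 ht4 (mul_ne_zero hI h0)]
  rw [show Complex.I ^ 2 * (t ^ 4) ^ 4 = -t ^ 16 by rw [Complex.I_sq]; ring,
    show (t ^ 4) ^ 4 = t ^ 16 by ring, theta_neg_self h16 ht16, Complex.I_sq,
    show (Complex.I * t ^ 4) ^ 2 = -t ^ 8 by rw [mul_pow, Complex.I_sq]; ring]
  have h := theta_mul_sq h16 ht16 (w := (-t ^ 8)⁻¹) (inv_ne_zero (neg_ne_zero.2 h8))
  rw [theta_inv, show (-t ^ 8)⁻¹ * (t ^ 16) ^ 2 = -t ^ 8 * t ^ 16 by field_simp,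
    show t ^ 16 * (-t ^ 8)⁻¹ = -t ^ 8 by field_simp] at h
  rw [← h]
  ring

/-! ### Partial fractions over a finite set of poles -/

/-- Partial fractions of `w ^ m / ∏ k ∈ S, (A k - B k * w)`. -/
theorem pow_div_prod_eq_sum {ι : Type*} [DecidableEq ι] {S : Finset ι} (hS : S.Nonempty)
    {A B : ι → ℂ} (hB : ∀ k ∈ S, B k ≠ 0)
    (hd : ∀ k ∈ S, ∀ l ∈ S, k ≠ l → A l * B k - B l * A k ≠ 0) {m : ℕ} (hm : m < #S) {w : ℂ}
    (hw : ∀ k ∈ S, A k - B k * w ≠ 0) :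
    w ^ m / ∏ k ∈ S, (A k - B k * w) = ∑ k ∈ S, A k ^ m * B k ^ (#S - 1 - m) /
      (∏ l ∈ S.erase k, (A l * B k - B l * A k)) / (A k - B k * w) := by
  induction hS using Finset.Nonempty.cons_induction generalizing m w with
  | singleton a =>
    have : m = 0 := by simpa using hm
    subst this
    simp
  | cons s S hs hS ih =>
    have hBs : B s ≠ 0 := hB s (mem_cons_self _ _)
    have hws : A s - B s * w ≠ 0 := hw s (mem_cons_self _ _)
    have hB' : ∀ k ∈ S, B k ≠ 0 := fun k hk => hB k (mem_cons_of_mem hk)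
    have hw' : ∀ k ∈ S, A k - B k * w ≠ 0 := fun k hk => hw k (mem_cons_of_mem hk)
    have hne : ∀ k ∈ S, k ≠ s := fun k hk h => hs (h ▸ hk)
    have hds : ∀ k ∈ S, A s * B k - B s * A k ≠ 0 := fun k hk =>
      hd k (mem_cons_of_mem hk) s (mem_cons_self _ _) (hne k hk)
    have hds' : ∀ k ∈ S, A k * B s - B k * A s ≠ 0 := fun k hk =>
      hd s (mem_cons_self _ _) k (mem_cons_of_mem hk) (hne k hk).symm
    have hd' : ∀ k ∈ S, ∀ l ∈ S, k ≠ l → A l * B k - B l * A k ≠ 0 := fun k hk l hl =>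
      hd k (mem_cons_of_mem hk) l (mem_cons_of_mem hl)
    have herase : ∀ k ∈ S, (cons s S hs).erase k = cons s (S.erase k) (by simp [hs]) :=
      fun k hk => by ext x; simp only [mem_erase, mem_cons]; grind
    -- The residue at the new pole s: the induction hypothesis evaluated at w = A s / B s.
    have hlast : ∀ j < #S, ∑ k ∈ S, A k ^ j * B k ^ (#S - 1 - j) /
        (∏ l ∈ S.erase k, (A l * B k - B l * A k)) / (A s * B k - B s * A k) =
        - (A s ^ j * B s ^ (#S - 1 - j) / ∏ l ∈ S, (A l * B s - B l * A s)) := by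
      intro j hj
      have hv : ∀ k ∈ S, A k - B k * (A s / B s) ≠ 0 := fun k hk => by
        have := hds' k hk
        rw [show A k - B k * (A s / B s) = (A k * B s - B k * A s) / B s by field_simp]
        exact div_ne_zero this hBs
      have h := ih hB' hd' hj hv
      have e1 : ∏ k ∈ S, (A k - B k * (A s / B s)) =
          (∏ l ∈ S, (A l * B s - B l * A s)) / B s ^ #S := by
        rw [← prod_const, ← prod_div_distrib]
        exact prod_congr rfl fun k _ => by field_simp
      have e2 : ∑ k ∈ S, A k ^ j * B k ^ (#S - 1 - j) /
          (∏ l ∈ S.erase k, (A l * B k - B l * A k)) / (A k - B k * (A s / B s)) =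
          - B s * ∑ k ∈ S, A k ^ j * B k ^ (#S - 1 - j) /
        (∏ l ∈ S.erase k, (A l * B k - B l * A k)) / (A s * B k - B s * A k) := by
        rw [mul_sum]
        refine sum_congr rfl fun k hk => ?_
        have h1 := hds k hk
        rw [show A k - B k * (A s / B s) = -(A s * B k - B s * A k) / B s by field_simp; ring]
        rw [div_div_eq_mul_div, div_neg]
        ring
      rw [e1, e2] at h
      obtain ⟨c, hc⟩ : ∃ c, #S = c + 1 + j := ⟨#S - 1 - j, by omega⟩
      have hP : ∏ l ∈ S, (A l * B s - B l * A s) ≠ 0 := prod_ne_zero_iff.2 hds'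
      rw [show #S - 1 - j = c by omega] at h ⊢
      generalize ∑ k ∈ S, A k ^ j * B k ^ c /
        (∏ l ∈ S.erase k, (A l * B k - B l * A k)) / (A s * B k - B s * A k) = Z at *
      rw [hc, div_pow] at h
      generalize ∏ l ∈ S, (A l * B s - B l * A s) = P at *
      have h2 : Z = -((A s ^ j / B s ^ j / (P / B s ^ (c + 1 + j))) / B s) := by
        rw [h]; field_simp
      rw [h2]
      field_simp
      ring
    -- The exponent j goes to the induction hypothesis and m - j to the splitting of two linear
    -- factors. The choice is j = m when m < #S, and j = m - 1 when m = #S, which the induction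
    -- hypothesis does not reach.
    have step : ∀ j < #S, (∀ k ∈ S, w ^ (m - j) / ((A k - B k * w) * (A s - B s * w)) =
          (A k ^ (m - j) * B k ^ (1 - (m - j)) / (A k - B k * w) -
            A s ^ (m - j) * B s ^ (1 - (m - j)) / (A s - B s * w)) / (A s * B k - B s * A k)) →
        j ≤ m → m ≤ j + 1 →
        w ^ m / ∏ k ∈ cons s S hs, (A k - B k * w) = ∑ k ∈ cons s S hs,
          A k ^ m * B k ^ (#(cons s S hs) - 1 - m) /
          (∏ l ∈ (cons s S hs).erase k, (A l * B k - B l * A k)) / (A k - B k * w) := by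
      intro j hj hsplit hjm hmj
      have h := ih hB' hd' hj hw'
      rw [sum_cons, erase_cons, prod_cons, card_cons]
      have e1 : w ^ m / ((A s - B s * w) * ∏ k ∈ S, (A k - B k * w)) =
          w ^ (m - j) / (A s - B s * w) * (w ^ j / ∏ k ∈ S, (A k - B k * w)) := by
        rw [div_mul_div_comm, ← pow_add, Nat.sub_add_cancel hjm]
      rw [e1, h, mul_sum]
      have e2 : ∀ k ∈ S, w ^ (m - j) / (A s - B s * w) * (A k ^ j * B k ^ (#S - 1 - j) /
          (∏ l ∈ S.erase k, (A l * B k - B l * A k)) / (A k - B k * w)) =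
          A k ^ m * B k ^ (#S + 1 - 1 - m) /
          (∏ l ∈ (cons s S hs).erase k, (A l * B k - B l * A k)) / (A k - B k * w) -
          A s ^ (m - j) * B s ^ (1 - (m - j)) / (A s - B s * w) *
            (A k ^ j * B k ^ (#S - 1 - j) /
          (∏ l ∈ S.erase k, (A l * B k - B l * A k)) / (A s * B k - B s * A k)) := by
        intro k hk
        have h1 := hsplit k hk
        rw [herase k hk, prod_cons]
        have e3 : A k ^ m = A k ^ (m - j) * A k ^ j := by rw [← pow_add, Nat.sub_add_cancel hjm]
        have e4 : B k ^ (#S + 1 - 1 - m) = B k ^ (1 - (m - j)) * B k ^ (#S - 1 - j) := by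
          rw [← pow_add]; congr 1; omega
        rw [e3, e4]
        generalize B k ^ (#S - 1 - j) = X
        generalize (∏ l ∈ S.erase k, (A l * B k - B l * A k)) = Y
        have h2 : w ^ (m - j) / (A s - B s * w) * (A k ^ j * X / Y / (A k - B k * w)) =
          w ^ (m - j) / ((A k - B k * w) * (A s - B s * w)) * (A k ^ j * X / Y) := by
          simp only [div_eq_mul_inv, mul_inv]; ring
        rw [h2, h1]
        simp only [div_eq_mul_inv, mul_inv]; ring
      rw [sum_congr rfl e2, sum_sub_distrib, ← mul_sum, hlast j hj]
      have e3 : A s ^ m = A s ^ (m - j) * A s ^ j := by rw [← pow_add, Nat.sub_add_cancel hjm]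
      have e4 : B s ^ (#S + 1 - 1 - m) = B s ^ (1 - (m - j)) * B s ^ (#S - 1 - j) := by
        rw [← pow_add]; congr 1; omega
      rw [e3, e4]
      simp only [div_eq_mul_inv]; ring
    rcases Nat.lt_or_ge m #S with h | h
    · refine step m h (fun k hk => ?_) le_rfl (by omega)
      have h1 := hw' k hk
      have h2 := hds k hk
      simp only [Nat.sub_self, pow_zero, one_mul, Nat.sub_zero, pow_one]
      rw [div_sub_div _ _ h1 hws, div_div, div_eq_div_iff (mul_ne_zero h1 hws)
        (mul_ne_zero (mul_ne_zero h1 hws) h2)]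
      ring
    · rw [card_cons] at hm
      have hm' : m = #S := by omega
      have hc := hS.card_pos
      refine step (m - 1) (by omega) (fun k hk => ?_) (by omega) (by omega)
      have h1 := hw' k hk
      have h2 := hds k hk
      rw [show m - (m - 1) = 1 by omega]
      simp only [pow_one, Nat.sub_self, pow_zero, mul_one]
      rw [div_sub_div _ _ h1 hws, div_div, div_eq_div_iff (mul_ne_zero h1 hws)
        (mul_ne_zero (mul_ne_zero h1 hws) h2)]
      ring

theorem prod_erase_range {M : Type*} [CommMonoid M] (f : ℕ → M) (n k : ℕ) :
    ∏ l ∈ (range (n + k + 1)).erase n, f l =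
      (∏ l ∈ range n, f l) * ∏ j ∈ range k, f (n + 1 + j) := by
  have : (range (n + k + 1)).erase n = range n ∪ (range k).image (n + 1 + ·) := by
    ext x
    simp only [mem_erase, mem_range, mem_union, mem_image]
    constructor
    · rintro ⟨h1, h2⟩
      rcases Nat.lt_or_ge x n with h | h
      · exact Or.inl h
      · exact Or.inr ⟨x - (n + 1), by omega, by omega⟩
    · rintro (h | ⟨y, hy, rfl⟩) <;> omega
  rw [this, prod_union, prod_image]
  · intro a _ b _ h; simpa using h
  · rw [disjoint_left]
    simp only [mem_range, mem_image, not_exists, not_and]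
    omega

/-! ### The Appell-type expansion of universal mock theta functions -/

/-- The factor `(-1)^n q^(n(n+1)/2)`. -/
noncomputable def signPow (q : ℂ) (n : ℕ) : ℂ := ∏ l ∈ range n, (-q ^ (l + 1))

theorem signPow_succ (q : ℂ) (n : ℕ) : signPow q (n + 1) = signPow q n * (-q ^ (n + 1)) := by
  rw [signPow, prod_range_succ, signPow]

theorem signPow_sq (t : ℂ) (n : ℕ) : signPow (t ^ 2) n = (-1) ^ n * t ^ (n ^ 2 + n) := by
  induction n with
  | zero => simp [signPow]
  | succ n ih => rw [signPow_succ, ih]; ring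

theorem signPow_ne_zero {q : ℂ} (hq : q ≠ 0) (n : ℕ) : signPow q n ≠ 0 :=
  prod_ne_zero_iff.2 fun _ _ => neg_ne_zero.2 (pow_ne_zero _ hq)

theorem norm_signPow_le_one {q : ℂ} (hq : ‖q‖ < 1) (n : ℕ) : ‖signPow q n‖ ≤ 1 := by
  rw [signPow, norm_prod]
  refine prod_le_one (fun _ _ => norm_nonneg _) fun l _ => ?_
  rw [norm_neg, norm_pow]
  exact pow_le_one₀ (norm_nonneg _) hq.le

theorem prod_neg_pow_mul_signPow (q : ℂ) (n : ℕ) :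
    (∏ l ∈ range n, (-q ^ l)) * signPow q n = q ^ (n ^ 2) := by
  induction n with
  | zero => simp [signPow]
  | succ n ih =>
    rw [prod_range_succ, signPow_succ]
    linear_combination (q ^ n * q ^ (n + 1)) * ih

/-- Factoring b q^l out of each difference and reversing the order leaves a Pochhammer symbol;
multiplying by `signPow` clears the negative powers of q. -/
theorem prod_sub_lt (q a : ℂ) {b : ℂ} (hb : b ≠ 0) (n : ℕ) :
    (∏ l ∈ range n, (a * q ^ n - b * q ^ l)) * signPow q n =
      b ^ n * q ^ (n ^ 2) * qPoch (a * q / b) q n := by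
  have h1 : ∏ l ∈ range n, (a * q ^ n - b * q ^ l) =
      ∏ l ∈ range n, (b * (-q ^ l * (1 - a * q / b * q ^ (n - 1 - l)))) := by
    refine prod_congr rfl fun l hl => ?_
    have := mem_range.1 hl
    have : q ^ n = q ^ l * (q * q ^ (n - 1 - l)) := by
      rw [← pow_succ', ← pow_add]; congr 1; omega
    rw [this]; field_simp; ring
  have h2 : ∏ l ∈ range n, (1 - a * q / b * q ^ (n - 1 - l)) = qPoch (a * q / b) q n :=
    prod_range_reflect (fun l => 1 - a * q / b * q ^ l) n
  rw [h1, prod_mul_distrib, prod_mul_distrib, h2, prod_const, card_range,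
    ← prod_neg_pow_mul_signPow]
  ring

theorem prod_sub_ge (q b : ℂ) {a : ℂ} (ha : a ≠ 0) (n k : ℕ) :
    ∏ j ∈ range k, (a * q ^ n - b * q ^ (n + j)) =
      a ^ k * q ^ (n * k) * qPoch (b / a) q k := by
  rw [qPoch, pow_mul]
  conv_rhs => rw [show a ^ k * (q ^ n) ^ k = ∏ _j ∈ range k, (a * q ^ n) by simp [mul_pow]]
  rw [← prod_mul_distrib]
  exact prod_congr rfl fun j _ => by rw [pow_add]; field_simp

theorem prod_pow_sub_pow_lt (q : ℂ) (n : ℕ) :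
    (∏ l ∈ range n, (q ^ n - q ^ l)) * signPow q n = q ^ (n ^ 2) * qPoch q q n := by
  simpa using prod_sub_lt q 1 one_ne_zero n

theorem prod_pow_sub_pow_gt (q : ℂ) (n k : ℕ) :
    ∏ j ∈ range k, (q ^ n - q ^ (n + 1 + j)) = q ^ (n * k) * qPoch q q k := by
  have h := prod_sub_ge q q one_ne_zero n k
  simp only [one_mul, one_pow, div_one] at h
  rw [← h]
  exact prod_congr rfl fun j _ => by ring

/-- Partial fractions of the reciprocal of `∏ l ≤ D, (1 + a q^(2l) - q^l w)`. -/
theorem inv_prod_eq_sum {q a w : ℂ} (hq0 : q ≠ 0) (hq : ‖q‖ < 1)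
    (ha : ∀ k : ℕ, 1 - a * q * q ^ k ≠ 0) (hw : ∀ n : ℕ, 1 + a * q ^ (2 * n) - q ^ n * w ≠ 0)
    (D : ℕ) :
    (∏ l ∈ range (D + 1), (1 + a * q ^ (2 * l) - q ^ l * w))⁻¹ =
      ∑ n ∈ range (D + 1), signPow q n / (qPoch q q n * qPoch q q (D - n) *
        (qPoch (a * q ^ n) q n * qPoch (a * q ^ (2 * n + 1)) q (D - n))) /
          (1 + a * q ^ (2 * n) - q ^ n * w) := by
  -- The cross-differences of A l = 1 + a q^(2l) and B l = q^l factor; this makes the residues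
  -- quotients of Pochhammer symbols.
  have hfac : ∀ k l : ℕ, (1 + a * q ^ (2 * l)) * q ^ k - q ^ l * (1 + a * q ^ (2 * k)) =
      (q ^ k - q ^ l) * (1 - a * q ^ (k + l)) := fun k l => by ring
  have hne : ∀ k l : ℕ, k < l → q ^ k - q ^ l ≠ 0 := by
    intro k l hkl
    obtain ⟨d, rfl⟩ := Nat.exists_eq_add_of_lt hkl
    rw [show q ^ k - q ^ (k + d + 1) = q ^ k * (1 - q * q ^ d) by ring]
    exact mul_ne_zero (pow_ne_zero _ hq0) (one_sub_pow_ne_zero hq d)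
  have ha' : ∀ m : ℕ, 0 < m → 1 - a * q ^ m ≠ 0 := by
    intro m hm
    obtain ⟨d, rfl⟩ := Nat.exists_eq_succ_of_ne_zero hm.ne'
    have := ha d
    rwa [Nat.succ_eq_add_one, pow_succ', ← mul_assoc]
  have h := pow_div_prod_eq_sum (S := range (D + 1)) (by simp)
    (A := fun l => 1 + a * q ^ (2 * l)) (B := fun l => q ^ l) (fun k _ => pow_ne_zero _ hq0)
    (fun k _ l _ hkl => by
      rw [hfac]
      refine mul_ne_zero ?_ (ha' _ (by omega))
      rcases lt_or_gt_of_ne hkl with h | h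
      · exact hne k l h
      · rw [← neg_sub]; exact neg_ne_zero.2 (hne l k h)) (m := 0) (by simp) (fun k _ => hw k)
  rw [pow_zero, one_div] at h
  rw [h]
  refine sum_congr rfl fun n hn => ?_
  obtain ⟨k, rfl⟩ := Nat.exists_eq_add_of_le (Nat.lt_succ_iff.1 (mem_range.1 hn))
  congr 1
  rw [prod_congr rfl fun l _ => hfac n l, prod_mul_distrib, prod_erase_range, prod_erase_range,
    prod_pow_sub_pow_gt, card_range, Nat.add_sub_cancel_left]
  have e1 : ∏ l ∈ range n, (1 - a * q ^ (n + l)) = qPoch (a * q ^ n) q n :=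
    prod_congr rfl fun l _ => by ring
  have e2 : ∏ j ∈ range k, (1 - a * q ^ (n + (n + 1 + j))) = qPoch (a * q ^ (2 * n + 1)) q k :=
    prod_congr rfl fun l _ => by ring
  have e3 := prod_pow_sub_pow_lt q n
  have hs := signPow_ne_zero hq0 n
  have e4 : ∏ l ∈ range n, (q ^ n - q ^ l) = q ^ (n ^ 2) * qPoch q q n / signPow q n := by
    rw [← e3]; field_simp
  have h1 : qPoch q q n ≠ 0 := qPoch_ne_zero (one_sub_pow_ne_zero hq) n
  have h2 : qPoch q q k ≠ 0 := qPoch_ne_zero (one_sub_pow_ne_zero hq) k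
  have h3 : qPoch (a * q ^ n) q n ≠ 0 := by
    rw [← e1, prod_ne_zero_iff]
    intro l hl
    have := mem_range.1 hl
    exact ha' _ (by omega)
  have h4 : qPoch (a * q ^ (2 * n + 1)) q k ≠ 0 := by
    rw [← e2, prod_ne_zero_iff]
    intro l hl
    exact ha' _ (by omega)
  rw [e1, e2, e4, pow_zero, one_mul, ← pow_mul,
    show n * (n + k + 1 - 1 - 0) = n ^ 2 + n * k by simp; ring, pow_add]
  field_simp

/-- The summand of the double series behind the expansion of a universal mock theta function. -/
noncomputable def mockTerm (q a w : ℂ) (n k : ℕ) : ℂ :=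
  q ^ ((n + k) ^ 2) * a ^ (n + k) * (signPow q n / (qPoch q q n * qPoch q q k *
    (qPoch (a * q ^ n) q n * qPoch (a * q ^ (2 * n + 1)) q k)) /
      (1 + a * q ^ (2 * n) - q ^ n * w))

/-- The symbol is the quotient (aq)_(m+n) / (aq)_m, so bounds on (aq)_n and on its inverse give one
uniform in m. -/
theorem exists_qPoch_mul_pow_bound {q a : ℂ} (hq : ‖q‖ < 1)
    (ha : ∀ k : ℕ, 1 - a * q * q ^ k ≠ 0) :
    ∃ C : ℝ, 0 < C ∧ ∀ m n : ℕ, ‖(qPoch (a * q ^ (m + 1)) q n)⁻¹‖ ≤ C := by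
  obtain ⟨C, hC, hC'⟩ := exists_norm_inv_qPoch_le hq ha
  obtain ⟨K, hK, hK'⟩ := exists_norm_le_of_tendsto (tendsto_qPoch hq (a * q))
  refine ⟨K * C, by positivity, fun m n => ?_⟩
  have h := qPoch_add (a * q) q m n
  have h0 := qPoch_ne_zero ha m
  rw [show (qPoch (a * q ^ (m + 1)) q n)⁻¹ = qPoch (a * q) q m * (qPoch (a * q) q (m + n))⁻¹ by
    rw [h, mul_inv, mul_inv_cancel_left₀ h0]; congr 2; ring, norm_mul]
  gcongr
  · exact hK' m
  · exact hC' _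

theorem summable_mockTerm {q a w : ℂ} (hq : ‖q‖ < 1) (ha1 : ‖a‖ ≤ 1)
    (ha : ∀ k : ℕ, 1 - a * q * q ^ k ≠ 0) :
    Summable fun p : ℕ × ℕ => mockTerm q a w p.1 p.2 := by
  obtain ⟨C, hC, hC'⟩ := exists_qPoch_mul_pow_bound hq ha
  obtain ⟨K, hK, hK'⟩ := exists_norm_inv_qPoch_le hq (one_sub_pow_ne_zero hq)
  have hlim : Tendsto (fun n : ℕ => (1 + a * q ^ (2 * n) - q ^ n * w)⁻¹) atTop
      (𝓝 (1 + 0 - 0)⁻¹) := by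
    refine Tendsto.inv₀ (Tendsto.sub (tendsto_const_nhds.add ?_) ?_) (by simp)
    · simpa only [pow_mul] using tendsto_mul_pow_zero (norm_sq_lt_one hq) a
    · simpa only [mul_comm] using tendsto_mul_pow_zero hq w
  obtain ⟨M, hM, hM'⟩ := exists_norm_le_of_tendsto hlim
  -- For n = 0 the symbol is an empty product, so a = 1 is admitted although 1 - a vanishes; the
  -- function φ needs this case.
  have hC0 : ∀ n : ℕ, ‖(qPoch (a * q ^ n) q n)⁻¹‖ ≤ C + 1 := by
    intro n
    rcases n with _ | n
    · simp; linarith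
    · exact (hC' n (n + 1)).trans (by linarith)
  have hg := summable_geometric_of_lt_one (norm_nonneg q) hq
  refine Summable.of_norm_bounded
    (g := fun p : ℕ × ℕ => ‖q‖ ^ p.1 * ‖q‖ ^ p.2 * (1 * (K * K * ((C + 1) * C)) * M))
    ((hg.mul_of_nonneg hg (fun _ => by positivity) (fun _ => by positivity)).mul_right _) ?_
  rintro ⟨n, k⟩
  simp only [mockTerm, div_eq_mul_inv, mul_inv, norm_mul]
  gcongr ?_ * (?_ * (?_ * ?_ * (?_ * ?_)) * ?_)
  · rw [← pow_add, norm_pow, norm_pow]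
    refine (mul_le_of_le_one_right (by positivity) (pow_le_one₀ (norm_nonneg _) ha1)).trans ?_
    refine pow_le_pow_of_le_one (norm_nonneg _) hq.le ?_
    nlinarith [Nat.zero_le (n + k), Nat.le_self_pow (two_ne_zero) (n + k)]
  · exact norm_signPow_le_one hq n
  · exact hK' n
  · exact hK' k
  · exact hC0 n
  · exact hC' (2 * n) k
  · exact hM' n

/-- The Appell-type expansion of a universal mock theta function. -/
theorem hasSum_mock {q a w : ℂ} (hq0 : q ≠ 0) (hq : ‖q‖ < 1) (ha1 : ‖a‖ ≤ 1)
    (ha : ∀ k : ℕ, 1 - a * q * q ^ k ≠ 0) (hw : ∀ n : ℕ, 1 + a * q ^ (2 * n) - q ^ n * w ≠ 0) :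
    ∃ s : ℂ, HasSum (fun D : ℕ => q ^ (D ^ 2) * a ^ D *
        (∏ l ∈ range (D + 1), (1 + a * q ^ (2 * l) - q ^ l * w))⁻¹) s ∧
      HasSum (fun n : ℕ => signPow q n * (q ^ (n ^ 2) * a ^ n) /
        (qPoch q q n * qPoch (a * q ^ n) q n * qPochInf (a * q ^ (2 * n + 1)) q) /
          (1 + a * q ^ (2 * n) - q ^ n * w)) s := by
  have hs := (summable_mockTerm (w := w) hq ha1 ha).hasSum
  refine ⟨_, ?_, hs.prod_fiberwise fun n => ?_⟩
  -- Along the antidiagonals n + k = D the double series reassembles the partial fractions of the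
  -- D-th product.
  · have h := ((Equiv.hasSum_iff HasAntidiagonal.sigmaAntidiagonalEquivProd).2 hs).sigma
      (fun D => hasSum_fintype _)
    refine h.congr_fun fun D => ?_
    rw [inv_prod_eq_sum hq0 hq ha hw, mul_sum]
    simp only [Function.comp_apply, HasAntidiagonal.sigmaAntidiagonalEquivProd_apply]
    rw [Finset.sum_coe_sort (antidiagonal D) (fun p : ℕ × ℕ => mockTerm q a w p.1 p.2),
      Finset.Nat.sum_antidiagonal_eq_sum_range_succ (mockTerm q a w)]
    refine sum_congr rfl fun n hn => ?_
    rw [mockTerm, Nat.add_sub_cancel' (Nat.lt_succ_iff.1 (mem_range.1 hn))]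
  -- For fixed n the sum over k is Cauchy's identity with b = a q^(2n).
  · have hb : ∀ k : ℕ, 1 - a * q ^ (2 * n) * q * q ^ k ≠ 0 := fun k => by
      have := ha (2 * n + k)
      rwa [show a * q * q ^ (2 * n + k) = a * q ^ (2 * n) * q * q ^ k by ring] at this
    have h := (hasSum_cauchy hq hb).mul_left (signPow q n * (q ^ (n ^ 2) * a ^ n) /
        (qPoch q q n * qPoch (a * q ^ n) q n) / (1 + a * q ^ (2 * n) - q ^ n * w))
    rw [show a * q ^ (2 * n) * q = a * q ^ (2 * n + 1) by ring] at h
    rw [← div_eq_mul_inv, div_right_comm _ (1 + a * q ^ (2 * n) - q ^ n * w), div_div _ _ (qPochInf _ q)] at h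
    refine h.congr_fun fun k => ?_
    simp only [mockTerm]
    rw [show q ^ ((n + k) ^ 2) * a ^ (n + k) =
      q ^ (n ^ 2) * a ^ n * (q ^ (k ^ 2) * (a * q ^ (2 * n)) ^ k) by ring]
    simp only [div_eq_mul_inv, mul_inv]
    ring

/-! ### Finite partial fractions for three theta functions -/

theorem prod_erase_own {q a : ℂ} (hq0 : q ≠ 0) (j k : ℕ) :
    ∏ l ∈ (range (j + k + 1)).erase j, (a * q ^ j - a * q ^ l) =
      a ^ (j + k) * q ^ (j ^ 2 + j * k) * (qPoch q q j * qPoch q q k) / signPow q j := by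
  have hs := signPow_ne_zero hq0 j
  have h := prod_pow_sub_pow_lt q j
  rw [eq_div_iff hs]
  simp only [← mul_sub]
  rw [prod_mul_distrib, prod_const, card_erase_of_mem (by simp), card_range,
    Nat.add_sub_cancel, prod_erase_range, prod_pow_sub_pow_gt]
  linear_combination (a ^ (j + k) * q ^ (j * k) * qPoch q q k) * h

theorem prod_other {q a b : ℂ} (hq0 : q ≠ 0) (ha : a ≠ 0) (hb : b ≠ 0) (j k : ℕ) :
    ∏ l ∈ range (j + k + 1), (a * q ^ j - b * q ^ l) =
      b ^ j * a ^ (k + 1) * q ^ (j ^ 2 + j * (k + 1)) *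
        (qPoch (a * q / b) q j * qPoch (b / a) q (k + 1)) / signPow q j := by
  have hs := signPow_ne_zero hq0 j
  have h := prod_sub_lt q a hb j
  rw [eq_div_iff hs, add_assoc, prod_range_add, prod_sub_ge _ _ ha]
  linear_combination (a ^ (k + 1) * q ^ (j * (k + 1)) * qPoch (b / a) q (k + 1)) * h

/-- The product of finite Pochhammer symbols in the coefficients of the finite partial fractions. -/
noncomputable def thetaDen (q a b c : ℂ) (j k : ℕ) : ℂ :=
  (qPoch q q j * qPoch q q k) * (qPoch (a * q / b) q j * qPoch (b / a) q (k + 1)) *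
    (qPoch (a * q / c) q j * qPoch (c / a) q (k + 1))

/-- The numerators of the partial fractions of the reciprocal of a product of three theta
functions. -/
noncomputable def thetaNum (t a b c : ℂ) (n : ℤ) : ℂ :=
  (-1) ^ n * t ^ (3 * n ^ 2 + 5 * n) * a * (a ^ 2 / (b * c)) ^ n

/-- Collecting all powers and signs, the residue depends on j and N only through n = j - N, so it is
stable as N → ∞. The cases j < N and j ≥ N only serve to write the integer exponents with natural
ones. -/
theorem thetaNum_eq {t a b c : ℂ} (ht : t ≠ 0) (ha : a ≠ 0) (hb : b ≠ 0) (hc : c ≠ 0)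
    {N j k : ℕ} (hjk : j + k + 1 = 2 * N) :
    (t ^ 2) ^ (3 * N ^ 2) / (t ^ 2) ^ N * (a * b * c) ^ N / signPow (t ^ 2) N ^ 3 *
      ((a * (t ^ 2) ^ j) ^ (3 * N) /
        ((a ^ (j + k) * (t ^ 2) ^ (j ^ 2 + j * k) / signPow (t ^ 2) j) *
          (b ^ j * a ^ (k + 1) * (t ^ 2) ^ (j ^ 2 + j * (k + 1)) / signPow (t ^ 2) j) *
          (c ^ j * a ^ (k + 1) * (t ^ 2) ^ (j ^ 2 + j * (k + 1)) / signPow (t ^ 2) j))) =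
    thetaNum t a b c ((j : ℤ) - N) := by
  rw [signPow_sq, signPow_sq, thetaNum]
  rcases Nat.lt_or_ge j N with h | h
  · obtain ⟨m, rfl⟩ := Nat.exists_eq_add_of_lt h
    obtain rfl : k = j + 2 * m + 1 := by omega
    rw [show ((j : ℤ) - (j + m + 1 : ℕ)) = -((m + 1 : ℕ) : ℤ) by push_cast; ring]
    have e1 : t ^ (3 * (-((m + 1 : ℕ) : ℤ)) ^ 2 + 5 * -((m + 1 : ℕ) : ℤ)) =
        t ^ (3 * (m + 1) ^ 2) / t ^ (5 * (m + 1)) := by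
      rw [zpow_add₀ ht, mul_neg, zpow_neg, neg_sq, div_eq_mul_inv]; norm_cast
    rw [e1, zpow_neg, zpow_neg, zpow_natCast, zpow_natCast, ← inv_pow,
      show (-1 : ℂ)⁻¹ = -1 by norm_num]
    field_simp
    ring_nf
    have e2 : (-1 : ℂ) ^ (m * 4) = 1 := by rw [mul_comm, pow_mul]; norm_num
    rw [e2]
    simp only [inv_pow]
    field_simp
  · obtain ⟨n, rfl⟩ := Nat.exists_eq_add_of_le h
    obtain rfl : N = n + k + 1 := by omega
    rw [show (((n + k + 1 + n : ℕ) : ℤ) - (n + k + 1 : ℕ)) = ((n : ℕ) : ℤ) by push_cast; ring]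
    have e1 : t ^ (3 * (n : ℤ) ^ 2 + 5 * (n : ℤ)) = t ^ (3 * n ^ 2 + 5 * n) := by norm_cast
    rw [e1, zpow_natCast, zpow_natCast]
    field_simp
    ring_nf
    have e2 : (-1 : ℂ) ^ (n * 4) = 1 := by rw [mul_comm, pow_mul]; norm_num
    have e3 : (-1 : ℂ) ^ (n * 6) = 1 := by rw [mul_comm, pow_mul]; norm_num
    rw [e2, e3]
    simp only [inv_pow]
    field_simp
    ring

theorem prod_erase_product (R : Finset ℕ) (i : Fin 3) (j : ℕ) (f : Fin 3 × ℕ → ℂ) :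
    ∏ p ∈ (univ ×ˢ R).erase (i, j), f p =
      (∏ l ∈ R.erase j, f (i, l)) * ∏ i' ∈ univ.erase i, ∏ l ∈ R, f (i', l) := by
  have : (univ ×ˢ R).erase (i, j) = ({i} ×ˢ R.erase j) ∪ ((univ.erase i) ×ˢ R) := by
    ext ⟨x, y⟩
    simp only [mem_erase, mem_product, mem_union, mem_singleton, mem_univ, Prod.mk.injEq, ne_eq]
    tauto
  rw [this, prod_union, prod_product, prod_product, prod_singleton]
  rw [disjoint_left]
  rintro ⟨x, y⟩
  simp only [mem_product, mem_singleton, mem_erase]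
  tauto

/-- The lower N factors carry negative powers of q and reverse into (q/y)_N; the upper N factors are
(y)_N. -/
theorem qPoch_shift {q y : ℂ} (hq0 : q ≠ 0) (hy : y ≠ 0) (N : ℕ) :
    ∏ l ∈ range (2 * N), (1 - y * q ^ l / q ^ N) =
      y ^ N * (qPoch y q N * qPoch (q / y) q N) / signPow q N := by
  rw [eq_div_iff (signPow_ne_zero hq0 N), two_mul, prod_range_add]
  have h1 : ∏ x ∈ range N, (1 - y * q ^ (N + x) / q ^ N) = qPoch y q N :=
    prod_congr rfl fun l _ => by rw [pow_add]; field_simp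
  have h2 : ∏ l ∈ range N, (1 - y * q ^ l / q ^ N) =
      (∏ l ∈ range N, (1 * q ^ N - y * q ^ l)) / q ^ (N ^ 2) := by
    rw [sq, pow_mul, show (q ^ N) ^ N = ∏ _l ∈ range N, q ^ N by simp, ← prod_div_distrib]
    exact prod_congr rfl fun l _ => by field_simp
  have h3 := prod_sub_lt q 1 hy N
  rw [one_mul q] at h3
  rw [h1, h2]
  have : q ^ (N ^ 2) ≠ 0 := pow_ne_zero _ hq0
  rw [div_mul_eq_mul_div, div_mul_eq_mul_div, div_eq_iff this]
  linear_combination qPoch y q N * h3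

/-- A summand of the finite partial fractions of the reciprocal of a product of three theta
functions. -/
noncomputable def thetaPF (t a b c x : ℂ) (N j : ℕ) : ℂ :=
  thetaNum t a b c ((j : ℤ) - N) / (1 - a * x * (t ^ 2) ^ ((j : ℤ) - N)) /
    thetaDen (t ^ 2) a b c j (2 * N - 1 - j)

/-- A finite form of `three_theta`: the theta functions are truncated to 2N factors each, and the 6N
linear factors in w = x / q^N are separated. -/
theorem sum_thetaPF {t x : ℂ} {a : Fin 3 → ℂ} (ht : t ≠ 0) (ht1 : ‖t‖ < 1) (ha : ∀ i, a i ≠ 0)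
    (hx0 : x ≠ 0)
    (hd : ∀ i l, i ≠ l → ∀ j k : ℕ, a i * (t ^ 2) ^ j ≠ a l * (t ^ 2) ^ k)
    (hx : ∀ i, ∀ n : ℤ, 1 - a i * x * (t ^ 2) ^ n ≠ 0) {N : ℕ} (hN : 0 < N) :
    x⁻¹ / ∏ i, (qPoch (a i * x) (t ^ 2) N * qPoch (t ^ 2 / (a i * x)) (t ^ 2) N) =
      ∑ j ∈ range (2 * N), (thetaPF t (a 0) (a 1) (a 2) x N j + thetaPF t (a 1) (a 0) (a 2) x N j +
        thetaPF t (a 2) (a 0) (a 1) x N j) := by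
  have hq0 : t ^ 2 ≠ 0 := pow_ne_zero 2 ht
  have hq := norm_sq_lt_one ht1
  have hexp : ∀ j : ℕ, (t ^ 2) ^ ((j : ℤ) - N) = (t ^ 2) ^ j / (t ^ 2) ^ N := fun j => by
    rw [zpow_sub₀ hq0, zpow_natCast, zpow_natCast]
  set q := t ^ 2 with hqdef
  have hpow : ∀ k l : ℕ, k ≠ l → q ^ k ≠ q ^ l := by
    have aux : ∀ k l : ℕ, k < l → q ^ k ≠ q ^ l := by
      intro k l hkl h
      obtain ⟨d, rfl⟩ := Nat.exists_eq_add_of_lt hkl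
      have := mul_ne_zero (pow_ne_zero k hq0) (one_sub_pow_ne_zero hq d)
      apply this
      linear_combination h
    intro k l hkl
    rcases lt_or_gt_of_ne hkl with h | h
    · exact aux k l h
    · exact (aux l k h).symm
  have hne : ∀ p p' : Fin 3 × ℕ, p ≠ p' → a p.1 * q ^ p.2 ≠ a p'.1 * q ^ p'.2 := by
    rintro ⟨i, j⟩ ⟨l, k⟩ h
    by_cases hil : i = l
    · subst hil
      have : j ≠ k := fun h' => h (by rw [h'])
      exact fun h' => hpow j k this (mul_left_cancel₀ (ha i) h')
    · exact hd i l hil j k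
  have hw : ∀ p : Fin 3 × ℕ, 1 - a p.1 * q ^ p.2 * (x / q ^ N) ≠ 0 := by
    rintro ⟨i, j⟩
    have := hx i ((j : ℤ) - N)
    rw [hexp] at this
    convert this using 2
    ring
  -- The three truncated thetas contribute x^(3N), so the numerator w^(3N-1) leaves x⁻¹; it also
  -- balances the exponents, since 6N - 1 - (3N - 1) = 3N.
  have h := pow_div_prod_eq_sum (S := (univ : Finset (Fin 3)) ×ˢ range (2 * N))
    (by simp; omega) (A := fun _ => 1) (B := fun p => a p.1 * q ^ p.2)
    (fun p _ => mul_ne_zero (ha _) (pow_ne_zero _ hq0))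
    (fun p _ p' _ hpp => by simpa [sub_eq_zero] using hne p p' hpp) (m := 3 * N - 1)
    (w := x / q ^ N) (by simp; omega) (fun p _ => hw p)
  have hs := signPow_ne_zero hq0 N
  have ha0 := ha 0
  have ha1 := ha 1
  have ha2 := ha 2
  have hL : q ^ (3 * N ^ 2) / q ^ N * (a 0 * a 1 * a 2) ^ N / signPow q N ^ 3 *
      ((x / q ^ N) ^ (3 * N - 1) / ∏ p ∈ (univ : Finset (Fin 3)) ×ˢ range (2 * N),
        (1 - a p.1 * q ^ p.2 * (x / q ^ N))) =
      x⁻¹ / ∏ i, (qPoch (a i * x) q N * qPoch (q / (a i * x)) q N) := by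
    have e : ∀ i, ∏ l ∈ range (2 * N), (1 - a i * q ^ l * (x / q ^ N)) =
        (a i * x) ^ N * (qPoch (a i * x) q N * qPoch (q / (a i * x)) q N) / signPow q N := by
      intro i
      rw [← qPoch_shift hq0 (mul_ne_zero (ha i) hx0)]
      exact prod_congr rfl fun l _ => by ring
    rw [prod_product, prod_congr rfl fun i _ => e i, Fin.prod_univ_three, Fin.prod_univ_three]
    have hx3 : (x / q ^ N) ^ (3 * N - 1) = x⁻¹ * (x ^ N) ^ 3 / q ^ (3 * N ^ 2) * q ^ N := by
      obtain ⟨M, rfl⟩ : ∃ M, N = M + 1 := ⟨N - 1, by omega⟩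
      have hY : q ^ (3 * (M + 1) ^ 2) = (q ^ (M + 1)) ^ (3 * M + 2) * q ^ (M + 1) := by ring
      have : q ^ (M + 1) ≠ 0 := pow_ne_zero _ hq0
      rw [show 3 * (M + 1) - 1 = 3 * M + 2 by omega, div_pow, hY]
      generalize q ^ (M + 1) = Z at *
      field_simp
      ring
    rw [hx3]
    simp only [mul_pow]
    generalize qPoch (a 0 * x) q N * qPoch (q / (a 0 * x)) q N = X0
    generalize qPoch (a 1 * x) q N * qPoch (q / (a 1 * x)) q N = X1
    generalize qPoch (a 2 * x) q N * qPoch (q / (a 2 * x)) q N = X2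
    field_simp
  have hR : ∀ i i1 i2 : Fin 3, (univ.erase i = {i1, i2}) → i1 ≠ i2 →
      a 0 * a 1 * a 2 = a i * a i1 * a i2 → ∀ j ∈ range (2 * N),
      q ^ (3 * N ^ 2) / q ^ N * (a 0 * a 1 * a 2) ^ N / signPow q N ^ 3 *
      (1 ^ (3 * N - 1) * (a i * q ^ j) ^
        (#((univ : Finset (Fin 3)) ×ˢ range (2 * N)) - 1 - (3 * N - 1)) /
        (∏ p ∈ ((univ : Finset (Fin 3)) ×ˢ range (2 * N)).erase (i, j),
          (1 * (a i * q ^ j) - a p.1 * q ^ p.2 * 1)) / (1 - a i * q ^ j * (x / q ^ N))) =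
      thetaPF t (a i) (a i1) (a i2) x N j := by
    intro i i1 i2 herase h12 habc j hj
    have hj' := mem_range.1 hj
    obtain ⟨k, hk⟩ : ∃ k, j + k + 1 = 2 * N := ⟨2 * N - 1 - j, by omega⟩
    rw [prod_erase_product, herase, prod_pair h12, habc, thetaPF, hexp,
      show 2 * N - 1 - j = k by omega, ← thetaNum_eq ht (ha i) (ha i1) (ha i2) hk, thetaDen, ← hqdef]
    simp only [one_mul, mul_one, one_pow]
    rw [← hk, prod_erase_own hq0, prod_other hq0 (ha i) (ha i1), prod_other hq0 (ha i) (ha i2)]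
    rw [show #((univ : Finset (Fin 3)) ×ˢ range (j + k + 1)) - 1 - (3 * N - 1) = 3 * N by
      simp; omega, show a i * q ^ j * (x / q ^ N) = a i * x * (q ^ j / q ^ N) by ring]
    simp only [div_eq_mul_inv, mul_inv, inv_inv]
    ring
  rw [← hL, h, mul_sum, sum_product, Fin.sum_univ_three, ← sum_add_distrib, ← sum_add_distrib]
  refine sum_congr rfl fun j hj => ?_
  rw [hR 0 1 2 (by decide) (by decide) rfl j hj, hR 1 0 2 (by decide) (by decide) (by ring) j hj,
    hR 2 0 1 (by decide) (by decide) (by ring) j hj]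

/-! ### The limit of infinitely many poles -/

/-- The theta function `(y; q)_∞ (q / y; q)_∞`. -/
noncomputable def thetaProd (y q : ℂ) : ℂ := qPochInf y q * qPochInf (q / y) q

/-- For n → -∞ the term y q^n is large; factoring it out reduces to the one-sided bound with y⁻¹. -/
theorem exists_norm_inv_one_sub_zpow_le {q : ℂ} (hq : ‖q‖ < 1) (y : ℂ) :
    ∃ C : ℝ, 0 < C ∧ ∀ n : ℤ, ‖(1 - y * q ^ n)⁻¹‖ ≤ C := by
  by_cases hy : y = 0
  · exact ⟨1, one_pos, fun n => by simp [hy]⟩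
  by_cases hq0 : q = 0
  · refine ⟨1 + ‖(1 - y)⁻¹‖, by positivity, fun n => ?_⟩
    by_cases hn : n = 0
    · simp [hn]
    · simp [hq0, zero_zpow n hn]
  obtain ⟨C, hC, hC'⟩ := exists_norm_inv_one_sub_le hq y
  obtain ⟨M, hM, hM'⟩ := exists_norm_inv_one_sub_le hq y⁻¹
  refine ⟨C + ‖y⁻¹‖ * M, by positivity, fun n => ?_⟩
  rcases Int.eq_nat_or_neg n with ⟨m, rfl | rfl⟩
  · rw [zpow_natCast]
    exact (hC' m).trans (by nlinarith [norm_nonneg y⁻¹])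
  · have hqm : q ^ m ≠ 0 := pow_ne_zero _ hq0
    rw [zpow_neg, zpow_natCast, show 1 - y * (q ^ m)⁻¹ = -(y * (q ^ m)⁻¹ * (1 - y⁻¹ * q ^ m)) by
      field_simp; ring, inv_neg, norm_neg, mul_inv, mul_inv, inv_inv, norm_mul, norm_mul]
    have h1 : ‖q ^ m‖ ≤ 1 := by rw [norm_pow]; exact pow_le_one₀ (norm_nonneg _) hq.le
    have h2 : ‖y⁻¹‖ * ‖q ^ m‖ * ‖(1 - y⁻¹ * q ^ m)⁻¹‖ ≤ ‖y⁻¹‖ * 1 * M := by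
      gcongr
      exact hM' m
    linarith

theorem tendsto_thetaDen {ι : Type*} {l : Filter ι} {q : ℂ} (hq : ‖q‖ < 1) {a b c : ℂ}
    {j k : ι → ℕ} (hj : Tendsto j l atTop) (hk : Tendsto k l atTop) :
    Tendsto (fun i => thetaDen q a b c (j i) (k i)) l
      (𝓝 (qPochInf q q ^ 2 * (thetaProd (b / a) q * thetaProd (c / a) q))) := by
  have hk1 : Tendsto (fun i => k i + 1) l atTop := (tendsto_add_atTop_nat 1).comp hk
  have h := ((((tendsto_qPoch hq q).comp hj).mul ((tendsto_qPoch hq q).comp hk)).mul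
    (((tendsto_qPoch hq (a * q / b)).comp hj).mul ((tendsto_qPoch hq (b / a)).comp hk1))).mul
    (((tendsto_qPoch hq (a * q / c)).comp hj).mul ((tendsto_qPoch hq (c / a)).comp hk1))
  rw [show qPochInf q q ^ 2 * (thetaProd (b / a) q * thetaProd (c / a) q) =
      qPochInf q q * qPochInf q q * (qPochInf (a * q / b) q * qPochInf (b / a) q) *
        (qPochInf (a * q / c) q * qPochInf (c / a) q) by
    simp only [thetaProd, div_div_eq_mul_div, mul_comm q a]
    ring]
  exact h

theorem one_sub_div_mul_pow_ne_zero {q a b : ℂ} (ha : a ≠ 0) {n : ℕ} (h : a ≠ b * q ^ n) :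
    1 - b / a * q ^ n ≠ 0 := by
  intro h'
  apply h
  field_simp at h'
  linear_combination h'

theorem one_sub_div_ne_zero {q a b : ℂ} (ha : a ≠ 0) (hb : b ≠ 0)
    (h : ∀ j k : ℕ, a * q ^ j ≠ b * q ^ k) :
    (∀ k : ℕ, 1 - a * q / b * q ^ k ≠ 0) ∧ (∀ k : ℕ, 1 - b / a * q ^ k ≠ 0) := by
  refine ⟨fun k => ?_, fun k => one_sub_div_mul_pow_ne_zero ha (by simpa using h 0 k)⟩
  have := one_sub_div_mul_pow_ne_zero hb (n := k + 1) (by simpa using (h (k + 1) 0).symm)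
  rwa [show a * q / b * q ^ k = a / b * q ^ (k + 1) by ring]

theorem thetaProd_div_ne_zero {q a b : ℂ} (hq : ‖q‖ < 1) (ha : a ≠ 0) (hb : b ≠ 0)
    (h : ∀ j k : ℕ, a * q ^ j ≠ b * q ^ k) : thetaProd (b / a) q ≠ 0 := by
  obtain ⟨h1, h2⟩ := one_sub_div_ne_zero ha hb h
  refine mul_ne_zero (qPochInf_ne_zero hq h2) (qPochInf_ne_zero hq fun k => ?_)
  rw [div_div_eq_mul_div, mul_comm q a]
  exact h1 k

theorem exists_thetaDen_bound {q : ℂ} (hq : ‖q‖ < 1) {a b c : ℂ} (ha : a ≠ 0) (hb : b ≠ 0)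
    (hc : c ≠ 0) (hab : ∀ j k : ℕ, a * q ^ j ≠ b * q ^ k) (hac : ∀ j k : ℕ, a * q ^ j ≠ c * q ^ k) :
    ∃ C : ℝ, 0 < C ∧ ∀ j k : ℕ, ‖(thetaDen q a b c j k)⁻¹‖ ≤ C := by
  obtain ⟨b1, b2⟩ := one_sub_div_ne_zero ha hb hab
  obtain ⟨c1, c2⟩ := one_sub_div_ne_zero ha hc hac
  obtain ⟨K0, hK0, h0⟩ := exists_norm_inv_qPoch_le hq (one_sub_pow_ne_zero hq)
  obtain ⟨K1, hK1, h1⟩ := exists_norm_inv_qPoch_le hq b1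
  obtain ⟨K2, hK2, h2⟩ := exists_norm_inv_qPoch_le hq b2
  obtain ⟨K3, hK3, h3⟩ := exists_norm_inv_qPoch_le hq c1
  obtain ⟨K4, hK4, h4⟩ := exists_norm_inv_qPoch_le hq c2
  refine ⟨(K0 * K0) * (K1 * K2) * (K3 * K4), by positivity, fun j k => ?_⟩
  simp only [thetaDen, mul_inv, norm_mul]
  gcongr ?_ * ?_ * (?_ * ?_) * (?_ * ?_)
  exacts [h0 j, h0 k, h1 j, h2 (k + 1), h3 j, h4 (k + 1)]

/-- Up to the constant a, this is a theta series in t³. -/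
theorem summable_thetaNum {t : ℂ} (ht : t ≠ 0) (ht1 : ‖t‖ < 1) {a b c : ℂ} (ha : a ≠ 0)
    (hb : b ≠ 0) (hc : c ≠ 0) : Summable (thetaNum t a b c) := by
  have ht3 : ‖t ^ 3‖ < 1 := by
    rw [norm_pow]; exact pow_lt_one₀ (norm_nonneg _) ht1 (by norm_num)
  have hw : -t ^ 5 * (a ^ 2 / (b * c)) ≠ 0 :=
    mul_ne_zero (neg_ne_zero.2 (pow_ne_zero _ ht))
      (div_ne_zero (pow_ne_zero _ ha) (mul_ne_zero hb hc))
  refine ((hasSum_theta (pow_ne_zero 3 ht) ht3 hw).summable.mul_left a).congr fun n => ?_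
  rw [thetaNum, mul_zpow, ← neg_one_mul (t ^ 5), mul_zpow, zpow_add₀ ht, ← zpow_natCast t 3,
    ← zpow_natCast t 5, ← zpow_mul, ← zpow_mul]
  push_cast
  ring

theorem summable_thetaNum_div {t : ℂ} (ht : t ≠ 0) (ht1 : ‖t‖ < 1) {a b c : ℂ} (ha : a ≠ 0)
    (hb : b ≠ 0) (hc : c ≠ 0) (x : ℂ) :
    Summable fun n : ℤ => thetaNum t a b c n / (1 - a * x * (t ^ 2) ^ n) := by
  obtain ⟨C, hC, hC'⟩ := exists_norm_inv_one_sub_zpow_le (norm_sq_lt_one ht1) (a * x)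
  refine Summable.of_norm_bounded ((summable_thetaNum ht ht1 ha hb hc).norm.mul_right C) fun n => ?_
  rw [div_eq_mul_inv, norm_mul]
  gcongr
  exact hC' n

theorem tendsto_sum_thetaPF {t : ℂ} (ht : t ≠ 0) (ht1 : ‖t‖ < 1) {a b c : ℂ} (ha : a ≠ 0)
    (hb : b ≠ 0) (hc : c ≠ 0) (hab : ∀ j k : ℕ, a * (t ^ 2) ^ j ≠ b * (t ^ 2) ^ k)
    (hac : ∀ j k : ℕ, a * (t ^ 2) ^ j ≠ c * (t ^ 2) ^ k) (x : ℂ) :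
    Tendsto (fun N : ℕ => ∑ j ∈ range (2 * N), thetaPF t a b c x N j) atTop
      (𝓝 (∑' n : ℤ, thetaNum t a b c n / (1 - a * x * (t ^ 2) ^ n) /
        (qPochInf (t ^ 2) (t ^ 2) ^ 2 *
          (thetaProd (b / a) (t ^ 2) * thetaProd (c / a) (t ^ 2))))) := by
  have hq := norm_sq_lt_one ht1
  obtain ⟨C, hC, hC'⟩ := exists_thetaDen_bound hq ha hb hc hab hac
  have hs := summable_thetaNum_div ht ht1 ha hb hc x
  -- With j = n + N and extension by zero, all finite sums become sums over ℤ, to which dominated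
  -- convergence applies.
  set F : ℕ → ℤ → ℂ := fun N n => if n ∈ Ico (-(N : ℤ)) N then
    thetaNum t a b c n / (1 - a * x * (t ^ 2) ^ n) /
      thetaDen (t ^ 2) a b c (n + N).toNat (N - 1 - n).toNat else 0 with hF
  have e : ∀ N : ℕ, ∑ j ∈ range (2 * N), thetaPF t a b c x N j = ∑' n : ℤ, F N n := by
    intro N
    rw [tsum_eq_sum (s := Ico (-(N : ℤ)) N) (fun n hn => by simp only [hF, if_neg hn])]
    refine sum_nbij' (fun j : ℕ => (j : ℤ) - N) (fun n : ℤ => (n + N).toNat) ?_ ?_ ?_ ?_ ?_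
    · intro j hj; simp only [mem_range, mem_Ico] at *; omega
    · intro n hn; simp only [mem_range, mem_Ico] at *; omega
    · intro j hj; simp
    · intro n hn; simp only [mem_Ico] at hn; simp; omega
    · intro j hj
      simp only [mem_range] at hj
      simp only [hF]
      rw [if_pos (by simp only [mem_Ico]; omega), thetaPF]
      congr 2
      · simp
      · omega
  simp only [e]
  have hnz : qPochInf (t ^ 2) (t ^ 2) ^ 2 *
      (thetaProd (b / a) (t ^ 2) * thetaProd (c / a) (t ^ 2)) ≠ 0 :=
    mul_ne_zero (pow_ne_zero _ (qPochInf_ne_zero hq (one_sub_pow_ne_zero hq)))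
      (mul_ne_zero (thetaProd_div_ne_zero hq ha hb hab) (thetaProd_div_ne_zero hq ha hc hac))
  refine tendsto_tsum_of_dominated_convergence (hs.norm.mul_right C) (fun n => ?_)
    (Eventually.of_forall fun N n => ?_)
  · have hj : Tendsto (fun N : ℕ => (n + N).toNat) atTop atTop :=
      tendsto_atTop.2 fun b => eventually_atTop.2 ⟨b + n.natAbs, fun N hN => by omega⟩
    have hk : Tendsto (fun N : ℕ => ((N : ℤ) - 1 - n).toNat) atTop atTop :=
      tendsto_atTop.2 fun b => eventually_atTop.2 ⟨b + n.natAbs + 1, fun N hN => by omega⟩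
    refine (tendsto_const_nhds.div (tendsto_thetaDen hq hj hk) hnz).congr' ?_
    filter_upwards [eventually_ge_atTop (n.natAbs + 1)] with N hN
    simp only [hF, Pi.div_apply]
    rw [if_pos (by simp only [mem_Ico]; omega)]
  · simp only [hF]
    split_ifs
    · rw [div_eq_mul_inv _ (thetaDen _ _ _ _ _ _), norm_mul]
      gcongr
      exact hC' _ _
    · rw [norm_zero]; positivity

/-- Partial fractions of the reciprocal of a product of three theta functions. -/
theorem three_theta {t x : ℂ} {a : Fin 3 → ℂ} (ht : t ≠ 0) (ht1 : ‖t‖ < 1) (ha : ∀ i, a i ≠ 0)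
    (hx0 : x ≠ 0)
    (hd : ∀ i l, i ≠ l → ∀ j k : ℕ, a i * (t ^ 2) ^ j ≠ a l * (t ^ 2) ^ k)
    (hx : ∀ i, ∀ n : ℤ, 1 - a i * x * (t ^ 2) ^ n ≠ 0) :
    x⁻¹ * qPochInf (t ^ 2) (t ^ 2) ^ 2 / (thetaProd (a 0 * x) (t ^ 2) *
        thetaProd (a 1 * x) (t ^ 2) * thetaProd (a 2 * x) (t ^ 2)) =
      (∑' n : ℤ, thetaNum t (a 0) (a 1) (a 2) n / (1 - a 0 * x * (t ^ 2) ^ n)) /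
          (thetaProd (a 1 / a 0) (t ^ 2) * thetaProd (a 2 / a 0) (t ^ 2)) +
        (∑' n : ℤ, thetaNum t (a 1) (a 0) (a 2) n / (1 - a 1 * x * (t ^ 2) ^ n)) /
          (thetaProd (a 0 / a 1) (t ^ 2) * thetaProd (a 2 / a 1) (t ^ 2)) +
        (∑' n : ℤ, thetaNum t (a 2) (a 0) (a 1) n / (1 - a 2 * x * (t ^ 2) ^ n)) /
          (thetaProd (a 0 / a 2) (t ^ 2) * thetaProd (a 1 / a 2) (t ^ 2)) := by
  have hq := norm_sq_lt_one ht1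
  have hne : ∀ i, thetaProd (a i * x) (t ^ 2) ≠ 0 := by
    intro i
    refine mul_ne_zero (qPochInf_ne_zero hq fun k => by simpa using hx i k)
      (qPochInf_ne_zero hq fun k h => ?_)
    have h2 := hx i (-((k + 1 : ℕ) : ℤ))
    rw [zpow_neg, zpow_natCast] at h2
    apply h2
    have h3 := ha i
    field_simp at h ⊢
    linear_combination -h
  have hT := fun i => (tendsto_qPoch hq (a i * x)).mul (tendsto_qPoch hq (t ^ 2 / (a i * x)))
  have hL : Tendsto (fun N : ℕ => x⁻¹ / ∏ i, (qPoch (a i * x) (t ^ 2) N *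
      qPoch (t ^ 2 / (a i * x)) (t ^ 2) N)) atTop
      (𝓝 (x⁻¹ / ∏ i, thetaProd (a i * x) (t ^ 2))) :=
    tendsto_const_nhds.div (tendsto_finsetProd _ fun i _ => hT i)
      (prod_ne_zero_iff.2 fun i _ => hne i)
  have hR := ((tendsto_sum_thetaPF ht ht1 (ha 0) (ha 1) (ha 2) (hd 0 1 (by decide))
    (hd 0 2 (by decide)) x).add (tendsto_sum_thetaPF ht ht1 (ha 1) (ha 0) (ha 2)
    (hd 1 0 (by decide)) (hd 1 2 (by decide)) x)).add (tendsto_sum_thetaPF ht ht1 (ha 2) (ha 0)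
    (ha 1) (hd 2 0 (by decide)) (hd 2 1 (by decide)) x)
  have h := tendsto_nhds_unique (hL.congr' (by
    filter_upwards [eventually_gt_atTop 0] with N hN
    rw [sum_thetaPF ht ht1 ha hx0 hd hx hN, sum_add_distrib, sum_add_distrib])) hR
  have hP : qPochInf (t ^ 2) (t ^ 2) ≠ 0 := qPochInf_ne_zero hq (one_sub_pow_ne_zero hq)
  rw [Fin.prod_univ_three] at h
  rw [mul_comm x⁻¹, mul_div_assoc, h]
  simp only [tsum_div_const]
  field_simp

/-! ### Lambert-type series for G, ν and φ -/

/-- The expansion of the universal mock theta function whose denominators are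
`∏ (1 - x q^l) (1 - q^(l+1) / x)`, with `q = t ^ 2` and `w = x + q / x`. -/
theorem hasSum_mock_q {t w : ℂ} (ht0 : t ≠ 0) (ht : ‖t‖ < 1)
    (hw : ∀ n : ℕ, 1 + t ^ 2 * (t ^ 2) ^ (2 * n) - (t ^ 2) ^ n * w ≠ 0) :
    ∃ s : ℂ, HasSum (fun D : ℕ => (t ^ 2) ^ (D ^ 2) * (t ^ 2) ^ D *
        (∏ l ∈ range (D + 1), (1 + t ^ 2 * (t ^ 2) ^ (2 * l) - (t ^ 2) ^ l * w))⁻¹) s ∧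
      HasSum (fun n : ℕ => (-1) ^ n * t ^ (3 * n ^ 2 + 3 * n) * (1 - t ^ 2 * (t ^ 2) ^ (2 * n)) /
          (1 + t ^ 2 * (t ^ 2) ^ (2 * n) - (t ^ 2) ^ n * w))
        (s * qPochInf (t ^ 2) (t ^ 2)) := by
  have hq := norm_sq_lt_one ht
  have h1 := one_sub_pow_ne_zero hq
  obtain ⟨s, hs, hs'⟩ := hasSum_mock (a := t ^ 2) (pow_ne_zero 2 ht0) hq hq.le
    (fun k => by rw [mul_assoc, ← pow_succ']; exact h1 (k + 1)) hw
  refine ⟨s, hs, (hs'.mul_right _).congr_fun fun n => ?_⟩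
  -- The Pochhammer symbols of the n-th term make up (q; q)_∞ except for the factor 1 - q^(2n+1),
  -- which becomes the numerator.
  have e1 := qPochInf_eq_qPoch_mul hq (t ^ 2) (2 * n)
  have e2 := qPochInf_succ hq (t ^ 2 * (t ^ 2) ^ (2 * n))
  have e3 := qPoch_add (t ^ 2) (t ^ 2) n n
  rw [← two_mul] at e3
  have n1 := qPoch_ne_zero h1 n
  have n2 := qPoch_ne_zero h1 (2 * n)
  have n3 := qPochInf_ne_zero hq h1
  rw [e3] at n2
  have n4 := right_ne_zero_of_mul n2
  rw [show t ^ 2 * (t ^ 2) ^ (2 * n) * t ^ 2 = t ^ 2 * (t ^ 2) ^ (2 * n + 1) by ring] at e2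
  rw [e1, e2, e3] at n3
  have n5 := right_ne_zero_of_mul (right_ne_zero_of_mul n3)
  rw [e1, e2, e3, signPow_sq]
  generalize qPoch (t ^ 2) (t ^ 2) n = A at *
  generalize qPoch (t ^ 2 * (t ^ 2) ^ n) (t ^ 2) n = B at *
  generalize qPochInf (t ^ 2 * (t ^ 2) ^ (2 * n + 1)) (t ^ 2) = C at *
  have hwn := hw n
  rw [show (-1 : ℂ) ^ n * t ^ (3 * n ^ 2 + 3 * n) =
    (-1) ^ n * t ^ (n ^ 2 + n) * ((t ^ 2) ^ (n ^ 2) * (t ^ 2) ^ n) by ring]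
  generalize 1 + t ^ 2 * (t ^ 2) ^ (2 * n) - (t ^ 2) ^ n * w = E at *
  field_simp

/-- The expansion of the third order mock theta function `φ`, with `q = t ^ 2`. -/
theorem hasSum_mock_one {t : ℂ} (ht0 : t ≠ 0) (ht : ‖t‖ < 1)
    (hw : ∀ n : ℕ, 1 + (t ^ 2) ^ (2 * n) ≠ 0) :
    ∃ s : ℂ, HasSum (fun D : ℕ => (t ^ 2) ^ (D ^ 2) *
        (∏ l ∈ range (D + 1), (1 + (t ^ 2) ^ (2 * l)))⁻¹) s ∧
      HasSum (fun n : ℕ => (-1) ^ n * t ^ (3 * n ^ 2 + n) * (1 + (t ^ 2) ^ n) /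
          (1 + (t ^ 2) ^ (2 * n)))
        (s * qPochInf (t ^ 2) (t ^ 2) + 1 / 2) := by
  have hq := norm_sq_lt_one ht
  have h1 := one_sub_pow_ne_zero hq
  have n3 := qPochInf_ne_zero hq h1
  obtain ⟨s, hs, hs'⟩ := hasSum_mock (a := 1) (w := 0) (pow_ne_zero 2 ht0) hq (by simp)
    (by simpa using h1) (by simpa using hw)
  refine ⟨s, ?_, ?_⟩
  · refine hs.congr_fun fun D => ?_
    simp
  have h2 := (hs'.mul_right (qPochInf (t ^ 2) (t ^ 2))).add
    (hasSum_ite_eq (0 : ℕ) ((1 : ℂ) / 2))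
  refine h2.congr_fun fun n => ?_
  -- At n = 0 the true term is 1/2 whereas the formula gives 1, hence the extra 1/2. For positive n
  -- the factor 1 - q^(2n) = (1 - q^n)(1 + q^n) leaves the numerator 1 + q^n.
  rcases n with _ | n
  · simp [signPow]
    field_simp
    norm_num
  have e1 := qPochInf_eq_qPoch_mul hq (t ^ 2) (2 * n + 1)
  have e3 := qPoch_add (t ^ 2) (t ^ 2) n (n + 1)
  have e4 := qPoch_succ (t ^ 2) (t ^ 2) n
  have e5 := qPoch_succ (t ^ 2 * (t ^ 2) ^ n) (t ^ 2) n
  have n1 := qPoch_ne_zero h1 n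
  have n2 := qPoch_ne_zero h1 (n + (n + 1))
  have n6 := h1 n
  rw [e3] at n2
  have n4 := right_ne_zero_of_mul n2
  rw [show 2 * n + 1 = n + (n + 1) by ring] at e1
  rw [e1] at n3
  have n5 := right_ne_zero_of_mul n3
  have hwn := hw (n + 1)
  simp only [one_pow, mul_one, one_mul, mul_zero, sub_zero, if_neg (Nat.succ_ne_zero n), add_zero]
  rw [show (t ^ 2) ^ (2 * (n + 1) + 1) = t ^ 2 * (t ^ 2) ^ (n + (n + 1)) * t ^ 2 by ring]
  rw [e1, e3, signPow_sq, show (t ^ 2) ^ (n + 1) = t ^ 2 * (t ^ 2) ^ n by ring]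
  have e6 := qPochInf_succ hq (t ^ 2 * (t ^ 2) ^ (n + (n + 1)))
  rw [e6] at n5 ⊢
  rw [show (-1 : ℂ) ^ (n + 1) * t ^ (3 * (n + 1) ^ 2 + (n + 1)) =
    (-1) ^ (n + 1) * t ^ ((n + 1) ^ 2 + (n + 1)) * (t ^ 2) ^ ((n + 1) ^ 2) by ring, e4]
  have e7 : 1 - t ^ 2 * (t ^ 2) ^ (n + (n + 1)) =
      (1 - t ^ 2 * (t ^ 2) ^ n) * (1 + t ^ 2 * (t ^ 2) ^ n) := by ring
  rw [e7] at n5 ⊢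
  generalize (-1 : ℂ) ^ (n + 1) * t ^ ((n + 1) ^ 2 + (n + 1)) * (t ^ 2) ^ ((n + 1) ^ 2) = Y
  generalize qPoch (t ^ 2) (t ^ 2) n = A at *
  generalize qPoch (t ^ 2 * (t ^ 2) ^ n) (t ^ 2) (n + 1) = B at *
  generalize qPochInf (t ^ 2 * (t ^ 2) ^ (n + (n + 1)) * t ^ 2) (t ^ 2) = C at *
  generalize 1 + (t ^ 2) ^ (2 * (n + 1)) = E at *
  generalize 1 - t ^ 2 * (t ^ 2) ^ n = F at *
  have n7 := right_ne_zero_of_mul n5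
  have n8 := right_ne_zero_of_mul (left_ne_zero_of_mul n5)
  generalize 1 + t ^ 2 * (t ^ 2) ^ n = H at *
  field_simp

/-! ### Eighth roots of unity and the contributions of the three poles -/

/-- The primitive eighth root of unity `exp (π i / 4)`. -/
noncomputable def zeta8 : ℂ := ((√2 / 2 : ℝ) : ℂ) * (1 + Complex.I)

theorem sqrt_two_sq : ((√2 : ℝ) : ℂ) ^ 2 = 2 := by
  norm_cast
  norm_num

theorem zeta8_sq : zeta8 ^ 2 = Complex.I := by
  have h := sqrt_two_sq
  have hI := Complex.I_sq
  rw [zeta8]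
  push_cast
  linear_combination (1 + Complex.I) ^ 2 / 4 * h + hI / 2

theorem zeta8_mul : zeta8 * (1 - Complex.I) = (√2 : ℝ) := by
  have hI := Complex.I_sq
  rw [zeta8]
  push_cast
  linear_combination -((√2 : ℝ) : ℂ) / 2 * hI

theorem zeta8_ne_zero : zeta8 ≠ 0 := by
  intro h
  have := zeta8_sq
  rw [h] at this
  simpa using this.symm

theorem zeta8_inv : zeta8⁻¹ = ((√2 / 2 : ℝ) : ℂ) * (1 - Complex.I) := by
  have h := sqrt_two_sq
  have hI := Complex.I_sq
  refine inv_eq_of_mul_eq_one_right ?_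
  rw [zeta8]
  push_cast
  linear_combination (1 - Complex.I ^ 2) / 4 * h - hI / 2

theorem zeta8_add_inv : zeta8 + zeta8⁻¹ = (√2 : ℝ) := by
  rw [zeta8_inv, zeta8]
  push_cast
  ring

theorem one_sub_zeta8_ne_zero (r : ℝ) : 1 - zeta8 * r ≠ 0 ∧ 1 - Complex.I * zeta8 * r ≠ 0 ∧
    1 + Complex.I * zeta8 * r ≠ 0 := by
  refine ⟨fun h => ?_, fun h => ?_, fun h => ?_⟩ <;>
  · have h3 := congrArg Complex.im h
    have h4 := congrArg Complex.re h
    simp [zeta8] at h3 h4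
    simp [h3] at h4

theorem one_add_I_mul_ne_zero (r : ℝ) : 1 + Complex.I * r ≠ 0 := by
  intro h
  have h4 := congrArg Complex.re h
  simp at h4

theorem neg_one_zpow_add (k : ℤ) : (-1 : ℂ) ^ (k + 1) = - (-1) ^ k := by
  rw [zpow_add₀ (by norm_num)]; simp

theorem I_mul_zpow_two_mul (t : ℂ) (k : ℤ) :
    (Complex.I * t) ^ (2 * k) = (-1) ^ k * (t ^ k) ^ 2 := by
  rw [zpow_mul, mul_zpow Complex.I, show Complex.I ^ (2 : ℤ) = -1 from Complex.I_sq, mul_zpow,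
    ← zpow_mul, mul_comm (2 : ℤ), zpow_mul]
  norm_cast

theorem thetaNum_I {t : ℂ} (ht : t ≠ 0) (n : ℤ) :
    thetaNum t (Complex.I * t) 1 (-(Complex.I * t)) n =
      Complex.I * t * t ^ (3 * n ^ 2 + 5 * n) * (Complex.I * t) ^ n := by
  have hI := Complex.I_ne_zero
  rw [thetaNum, show (Complex.I * t) ^ 2 / (1 * -(Complex.I * t)) = -1 * (Complex.I * t) by
    field_simp, mul_zpow]
  have : (-1 : ℂ) ^ n * (-1) ^ n = 1 := by rw [← mul_zpow]; simp
  linear_combination (t ^ (3 * n ^ 2 + 5 * n) * (Complex.I * t) * (Complex.I * t) ^ n) * this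

theorem thetaNum_neg_I {t : ℂ} (ht : t ≠ 0) (n : ℤ) :
    thetaNum t (-(Complex.I * t)) 1 (Complex.I * t) n =
      - (Complex.I * t * (-1) ^ n * t ^ (3 * n ^ 2 + 5 * n) * (Complex.I * t) ^ n) := by
  have hI := Complex.I_ne_zero
  rw [thetaNum, show (-(Complex.I * t)) ^ 2 / (1 * (Complex.I * t)) = Complex.I * t by
    field_simp]
  ring

/-- The difference of the terms of index `n` belonging to the poles `± (i t) q ^ n`. -/
noncomputable def poleTerm (t : ℂ) (n : ℤ) : ℂ :=
  thetaNum t (Complex.I * t) 1 (-(Complex.I * t)) n /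
      (1 - Complex.I * t * (zeta8 * t) * (t ^ 2) ^ n) -
    thetaNum t (-(Complex.I * t)) 1 (Complex.I * t) n /
      (1 - -(Complex.I * t) * (zeta8 * t) * (t ^ 2) ^ n)

/-- Since (iζ)² = -i, the two denominators multiply to 1 + iX². At even index the numerators
reinforce each other and the part linear in X cancels. -/
theorem poleTerm_even {r : ℝ} (hr : r ≠ 0) (k : ℤ) : poleTerm (r : ℂ) (2 * k) =
    2 * Complex.I * r * ((-1) ^ k * (r : ℂ) ^ (12 * k ^ 2 + 12 * k) /
      (1 + Complex.I * (r : ℂ) ^ (8 * k + 4))) := by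
  have ht : (r : ℂ) ≠ 0 := by exact_mod_cast hr
  obtain ⟨-, h1, h2⟩ := one_sub_zeta8_ne_zero (r ^ 2 * r ^ (4 * k))
  have h3 := one_add_I_mul_ne_zero (r ^ (8 * k + 4))
  push_cast at h1 h2 h3
  rw [poleTerm, thetaNum_I ht, thetaNum_neg_I ht, I_mul_zpow_two_mul]
  have e1 : ((r : ℂ) ^ 2) ^ (2 * k) = (r : ℂ) ^ (4 * k) := by
    rw [← zpow_natCast, ← zpow_mul]; congr 1; push_cast; ring
  have e2 : (-1 : ℂ) ^ (2 * k) = 1 := by rw [zpow_mul]; norm_num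
  have e3 : (r : ℂ) ^ (8 * k + 4) = ((r : ℂ) ^ 2 * (r : ℂ) ^ (4 * k)) ^ 2 := by
    rw [mul_pow, zpow_add₀ ht, ← zpow_natCast ((r : ℂ) ^ (4 * k)), ← zpow_mul,
      show 4 * k * ((2 : ℕ) : ℤ) = 8 * k by push_cast; ring]
    norm_cast; ring
  have e4 : (r : ℂ) ^ (12 * k ^ 2 + 12 * k) =
      (r : ℂ) ^ (3 * (2 * k) ^ 2 + 5 * (2 * k)) * ((r : ℂ) ^ k) ^ 2 := by
    rw [← zpow_natCast ((r : ℂ) ^ k), ← zpow_mul, ← zpow_add₀ ht]; congr 1; push_cast; ring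
  rw [e1, e2, e4]
  rw [e3] at h3 ⊢
  rw [show 1 - Complex.I * r * (zeta8 * r) * (r : ℂ) ^ (4 * k) =
      1 - Complex.I * zeta8 * ((r : ℂ) ^ 2 * (r : ℂ) ^ (4 * k)) by ring,
    show 1 - -(Complex.I * r) * (zeta8 * r) * (r : ℂ) ^ (4 * k) =
      1 + Complex.I * zeta8 * ((r : ℂ) ^ 2 * (r : ℂ) ^ (4 * k)) by ring]
  generalize (r : ℂ) ^ 2 * (r : ℂ) ^ (4 * k) = X at *
  have e5 : 1 + Complex.I * X ^ 2 =
      (1 - Complex.I * zeta8 * X) * (1 + Complex.I * zeta8 * X) := by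
    have hz := zeta8_sq
    have hI := Complex.I_sq
    linear_combination (-X ^ 2) * hz + X ^ 2 * zeta8 ^ 2 * hI
  rw [e5]
  have hAB : (1 - Complex.I * zeta8 * X) + (1 + Complex.I * zeta8 * X) = 2 := by ring
  generalize 1 - Complex.I * zeta8 * X = A at *
  generalize 1 + Complex.I * zeta8 * X = B at *
  field_simp
  linear_combination hAB

/-- At odd index the signs are opposite, so exactly the part linear in X survives. Indexing by k + 1
makes the series symmetric about 0. -/
theorem poleTerm_odd {r : ℝ} (hr : r ≠ 0) (k : ℤ) : poleTerm (r : ℂ) (2 * k + 1) =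
    2 * Complex.I * zeta8 / (r : ℂ) ^ 2 * ((-1) ^ (k + 1) *
      (r : ℂ) ^ (12 * (k + 1) ^ 2 + 4 * (k + 1)) /
      (1 + Complex.I * (r : ℂ) ^ (8 * (k + 1)))) := by
  have ht : (r : ℂ) ≠ 0 := by exact_mod_cast hr
  obtain ⟨-, h1, h2⟩ := one_sub_zeta8_ne_zero (r ^ (4 * (k + 1)))
  have h3 := one_add_I_mul_ne_zero (r ^ (8 * (k + 1)))
  push_cast at h1 h2 h3
  rw [poleTerm, thetaNum_I ht, thetaNum_neg_I ht,
    show (Complex.I * (r : ℂ)) ^ (2 * k + 1) = (-1) ^ k * ((r : ℂ) ^ k) ^ 2 * (Complex.I * r) by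
      rw [zpow_add₀ (by simp [ht]), I_mul_zpow_two_mul, zpow_one]]
  have e1 : (r : ℂ) ^ 2 * ((r : ℂ) ^ 2) ^ (2 * k + 1) = (r : ℂ) ^ (4 * (k + 1)) := by
    rw [← zpow_natCast, ← zpow_mul, ← zpow_add₀ ht]; congr 1; push_cast; ring
  have e2 : (-1 : ℂ) ^ (2 * k + 1) = -1 := by
    rw [zpow_add₀ (by norm_num), zpow_mul]; norm_num
  have e3 : (r : ℂ) ^ (8 * (k + 1)) = ((r : ℂ) ^ (4 * (k + 1))) ^ 2 := by
    rw [← zpow_natCast, ← zpow_mul]; congr 1; push_cast; ring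
  have e4 : (r : ℂ) ^ (12 * (k + 1) ^ 2 + 4 * (k + 1)) =
      (r : ℂ) ^ 4 * ((r : ℂ) ^ (3 * (2 * k + 1) ^ 2 + 5 * (2 * k + 1)) * ((r : ℂ) ^ k) ^ 2) *
        (r : ℂ) ^ (4 * (k + 1)) := by
    rw [← zpow_natCast ((r : ℂ) ^ k), ← zpow_natCast (r : ℂ) 4, ← zpow_mul, ← zpow_add₀ ht,
      ← zpow_add₀ ht, ← zpow_add₀ ht]
    congr 1; push_cast; ring
  rw [show 1 - Complex.I * r * (zeta8 * r) * ((r : ℂ) ^ 2) ^ (2 * k + 1) =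
      1 - Complex.I * zeta8 * ((r : ℂ) ^ 2 * ((r : ℂ) ^ 2) ^ (2 * k + 1)) by ring,
    show 1 - -(Complex.I * r) * (zeta8 * r) * ((r : ℂ) ^ 2) ^ (2 * k + 1) =
      1 + Complex.I * zeta8 * ((r : ℂ) ^ 2 * ((r : ℂ) ^ 2) ^ (2 * k + 1)) by ring,
    e1, e2, e4, neg_one_zpow_add]
  rw [e3] at h3 ⊢
  generalize (r : ℂ) ^ (4 * (k + 1)) = X at *
  have e5 : 1 + Complex.I * X ^ 2 =
      (1 - Complex.I * zeta8 * X) * (1 + Complex.I * zeta8 * X) := by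
    have hz := zeta8_sq
    have hI := Complex.I_sq
    linear_combination (-X ^ 2) * hz + X ^ 2 * zeta8 ^ 2 * hI
  rw [e5]
  have hAB : (1 + Complex.I * zeta8 * X) - (1 - Complex.I * zeta8 * X) =
    2 * Complex.I * zeta8 * X := by ring
  have hI := Complex.I_sq
  generalize 1 - Complex.I * zeta8 * X = A at *
  generalize 1 + Complex.I * zeta8 * X = B at *
  generalize (r : ℂ) ^ (3 * (2 * k + 1) ^ 2 + 5 * (2 * k + 1)) = Y at *
  generalize (r : ℂ) ^ k = Z at *
  field_simp
  linear_combination (Complex.I * Y * Z ^ 2) * hAB + 2 * Y * Z ^ 2 * zeta8 * X * hI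

theorem summable_poleTerm {r : ℝ} (hr0 : 0 < r) (hr1 : r < 1) :
    Summable (fun n : ℤ => thetaNum (r : ℂ) (Complex.I * r) 1 (-(Complex.I * r)) n /
      (1 - Complex.I * r * (zeta8 * r) * ((r : ℂ) ^ 2) ^ n)) ∧
    Summable (fun n : ℤ => thetaNum (r : ℂ) (-(Complex.I * r)) 1 (Complex.I * r) n /
      (1 - -(Complex.I * r) * (zeta8 * r) * ((r : ℂ) ^ 2) ^ n)) := by
  have ht : (r : ℂ) ≠ 0 := by exact_mod_cast hr0.ne'
  have ht1 : ‖(r : ℂ)‖ < 1 := by simpa [abs_of_pos hr0] using hr1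
  have hI : Complex.I * r ≠ 0 := mul_ne_zero Complex.I_ne_zero ht
  exact ⟨summable_thetaNum_div ht ht1 hI one_ne_zero (neg_ne_zero.2 hI) _,
    summable_thetaNum_div ht ht1 (neg_ne_zero.2 hI) one_ne_zero hI _⟩

theorem neg_one_zpow_neg_add_one (n : ℕ) : (-1 : ℂ) ^ (-((n : ℤ) + 1)) = -(-1) ^ n := by
  rw [zpow_neg, zpow_add₀ (by norm_num), zpow_natCast, zpow_one, mul_neg_one, inv_neg,
    ← inv_pow, inv_neg_one]

theorem one_add_ofReal_ne_zero {r : ℝ} (hr : 0 ≤ r) : 1 + (r : ℂ) ≠ 0 := by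
  norm_cast
  positivity

/-- Rationalises the terms of an index and of its mirror image, where u becomes u⁻¹; the two pair
identities fold a bilateral sum into a one-sided one with denominators 1 + u². -/
theorem inv_one_add_I_mul_inv {u : ℂ} (n1 : 1 + Complex.I * u ≠ 0) (n3 : 1 + u ^ 2 ≠ 0)
    (n4 : u ≠ 0) :
    (1 + Complex.I * u⁻¹)⁻¹ = -Complex.I * u * ((1 + Complex.I * u) / (1 + u ^ 2)) ∧
      (1 + Complex.I * u)⁻¹ = (1 - Complex.I * u) / (1 + u ^ 2) := by
  have hI := Complex.I_sq
  have hI' := Complex.I_ne_zero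
  have e2 : 1 + u ^ 2 = (1 + Complex.I * u) * (1 - Complex.I * u) := by
    linear_combination u ^ 2 * hI
  rw [e2] at n3 ⊢
  have n5 := right_ne_zero_of_mul n3
  constructor
  · rw [show (1 : ℂ) + Complex.I * u⁻¹ = Complex.I * (1 - Complex.I * u) / u by
      field_simp; linear_combination u * hI]
    generalize 1 - Complex.I * u = B at *
    generalize 1 + Complex.I * u = A at *
    field_simp
    linear_combination hI
  · generalize 1 - Complex.I * u = B at *
    generalize 1 + Complex.I * u = A at *
    field_simp

theorem pair_identity_sub {u : ℂ} (c : ℂ) (n1 : 1 + Complex.I * u ≠ 0) (n3 : 1 + u ^ 2 ≠ 0)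
    (n4 : u ≠ 0) (b : ℂ) : c * b * (1 - u ^ 2) / (1 + u ^ 2) =
      c * b / (1 + Complex.I * u) + -c * b / (1 + Complex.I * u⁻¹) := by
  obtain ⟨h1, h2⟩ := inv_one_add_I_mul_inv n1 n3 n4
  have hI := Complex.I_sq
  rw [div_eq_mul_inv (c * b), div_eq_mul_inv (-c * b), h1, h2]
  field_simp
  linear_combination -c * b * u ^ 2 * hI

theorem pair_identity_add {u : ℂ} (c : ℂ) (n1 : 1 + Complex.I * u ≠ 0) (n3 : 1 + u ^ 2 ≠ 0)
    (n4 : u ≠ 0) (b : ℂ) : (1 - Complex.I) * (c * b * (1 + u) / (1 + u ^ 2)) =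
      c * b / (1 + Complex.I * u) + c * (b * u⁻¹) / (1 + Complex.I * u⁻¹) := by
  obtain ⟨h1, h2⟩ := inv_one_add_I_mul_inv n1 n3 n4
  have hI := Complex.I_sq
  rw [div_eq_mul_inv (c * b), div_eq_mul_inv (c * (b * u⁻¹)), h1, h2]
  field_simp
  linear_combination c * b * u * hI

/-- Folding k with -k - 1 inverts u = r^(8k+4) and produces the expansion of ν in base r^8. -/
theorem hasSum_poleTerm_even {r : ℝ} (hr0 : 0 < r) (hr1 : r < 1) {ν : ℂ}
    (hν : HasSum (fun D : ℕ => ((r : ℂ) ^ 8) ^ (D ^ 2) * ((r : ℂ) ^ 8) ^ D *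
      (∏ l ∈ range (D + 1), (1 + (r : ℂ) ^ 8 * ((r : ℂ) ^ 8) ^ (2 * l)))⁻¹) ν) :
    HasSum (fun k : ℤ => poleTerm (r : ℂ) (2 * k))
      (2 * Complex.I * r * (ν * qPochInf ((r : ℂ) ^ 8) ((r : ℂ) ^ 8))) := by
  have ht : (r : ℂ) ≠ 0 := by exact_mod_cast hr0.ne'
  have ht1 : ‖(r : ℂ) ^ 4‖ < 1 := by
    simpa [abs_of_pos hr0] using pow_lt_one₀ hr0.le hr1 (by norm_num)
  have hsum : Summable (fun k : ℤ => poleTerm (r : ℂ) (2 * k)) := by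
    have h := (summable_poleTerm hr0 hr1).1.sub (summable_poleTerm hr0 hr1).2
    exact h.comp_injective (fun a b h => by simpa using h)
  simp only [poleTerm_even hr0.ne'] at hsum ⊢
  have hc : 2 * Complex.I * (r : ℂ) ≠ 0 := by simp [ht]
  rw [summable_mul_left_iff hc] at hsum
  refine HasSum.mul_left _ ?_
  have hT : ((r : ℂ) ^ 4) ^ 2 = (r : ℂ) ^ 8 := by ring
  obtain ⟨s, h1, h2⟩ := hasSum_mock_q (t := (r : ℂ) ^ 4) (w := 0) (pow_ne_zero _ ht) ht1
    (fun n => by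
      have h := one_add_ofReal_ne_zero (r := (r ^ 4) ^ 2 * ((r ^ 4) ^ 2) ^ (2 * n)) (by positivity)
      push_cast at h
      simpa using h)
  rw [hT] at h1 h2
  simp only [mul_zero, sub_zero] at h1 h2
  rw [h1.unique hν] at h2
  have h3 := hsum.hasSum.nat_add_neg_add_one
  rw [h2.unique (h3.congr_fun fun n => ?_)]
  · exact hsum.hasSum
  rw [neg_one_zpow_neg_add_one, zpow_natCast,
    show 12 * (-((n : ℤ) + 1)) ^ 2 + 12 * (-((n : ℤ) + 1)) = ((12 * n ^ 2 + 12 * n : ℕ) : ℤ) by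
      push_cast; ring,
    show 12 * (n : ℤ) ^ 2 + 12 * n = ((12 * n ^ 2 + 12 * n : ℕ) : ℤ) by push_cast; ring,
    show 8 * (-((n : ℤ) + 1)) + 4 = -((8 * n + 4 : ℕ) : ℤ) by push_cast; ring,
    show 8 * (n : ℤ) + 4 = ((8 * n + 4 : ℕ) : ℤ) by push_cast; ring, zpow_neg, zpow_natCast,
    zpow_natCast,
    show ((r : ℂ) ^ 4) ^ (3 * n ^ 2 + 3 * n) = (r : ℂ) ^ (12 * n ^ 2 + 12 * n) by ring,
    show (r : ℂ) ^ 8 * ((r : ℂ) ^ 8) ^ (2 * n) = ((r : ℂ) ^ (8 * n + 4)) ^ 2 by ring]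
  have n1 := one_add_I_mul_ne_zero (r ^ (8 * n + 4))
  have n3 := one_add_ofReal_ne_zero (r := (r ^ (8 * n + 4)) ^ 2) (by positivity)
  have n4 : (r : ℂ) ^ (8 * n + 4) ≠ 0 := pow_ne_zero _ ht
  push_cast at n1 n3
  generalize (r : ℂ) ^ (8 * n + 4) = u at *
  exact pair_identity_sub _ n1 n3 n4 _

/-- Folding k with -k produces the expansion of φ. The index 0 is counted twice, and its value (1 -
i)/2 matches the extra 1/2 in `hasSum_mock_one`. -/
theorem hasSum_poleTerm_odd {r : ℝ} (hr0 : 0 < r) (hr1 : r < 1) {φ : ℂ}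
    (hφ : HasSum (fun D : ℕ => ((r : ℂ) ^ 8) ^ (D ^ 2) *
      (∏ l ∈ range (D + 1), (1 + ((r : ℂ) ^ 8) ^ (2 * l)))⁻¹) φ) :
    HasSum (fun k : ℤ => poleTerm (r : ℂ) (2 * k + 1))
      (2 * Complex.I * zeta8 / (r : ℂ) ^ 2 *
        ((1 - Complex.I) * (φ * qPochInf ((r : ℂ) ^ 8) ((r : ℂ) ^ 8)))) := by
  have ht : (r : ℂ) ≠ 0 := by exact_mod_cast hr0.ne'
  have ht1 : ‖(r : ℂ) ^ 4‖ < 1 := by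
    simpa [abs_of_pos hr0] using pow_lt_one₀ hr0.le hr1 (by norm_num)
  have hsum : Summable (fun k : ℤ => poleTerm (r : ℂ) (2 * k + 1)) := by
    have h := (summable_poleTerm hr0 hr1).1.sub (summable_poleTerm hr0 hr1).2
    exact h.comp_injective (i := fun k : ℤ => 2 * k + 1) (fun a b h => by simpa using h)
  simp only [poleTerm_odd hr0.ne'] at hsum ⊢
  have hc : 2 * Complex.I * zeta8 / (r : ℂ) ^ 2 ≠ 0 := by simp [ht, zeta8_ne_zero]
  rw [summable_mul_left_iff hc] at hsum
  refine HasSum.mul_left _ ?_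
  let E : ℤ → ℂ := fun k => (-1) ^ k * (r : ℂ) ^ (12 * k ^ 2 + 4 * k) /
    (1 + Complex.I * (r : ℂ) ^ (8 * k))
  change HasSum (fun k => E (k + 1)) _
  change Summable (fun k => E (k + 1)) at hsum
  have hE : Summable E := ((Equiv.addRight (1 : ℤ)).summable_iff (f := E)).1 hsum
  refine ((Equiv.addRight (1 : ℤ)).hasSum_iff (f := E)).2 ?_
  have hT : ((r : ℂ) ^ 4) ^ 2 = (r : ℂ) ^ 8 := by ring
  obtain ⟨s, h1, h2⟩ := hasSum_mock_one (t := (r : ℂ) ^ 4) (pow_ne_zero _ ht) ht1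
    (fun n => by
      have h := one_add_ofReal_ne_zero (r := ((r ^ 4) ^ 2) ^ (2 * n)) (by positivity)
      push_cast at h
      exact h)
  rw [hT] at h1 h2
  rw [h1.unique hφ] at h2
  have h3 := hE.hasSum.nat_add_neg
  have e0 : E 0 = (1 - Complex.I) / 2 := by
    have h := one_add_I_mul_ne_zero 1
    have hI := Complex.I_sq
    simp only [E]
    simp at h ⊢
    field_simp
    linear_combination hI
  have h4 := (h2.mul_left (1 - Complex.I)).unique (h3.congr_fun fun n => ?_)
  · rw [show (1 - Complex.I) * (φ * qPochInf ((r : ℂ) ^ 8) ((r : ℂ) ^ 8)) = ∑' k, E k by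
      rw [e0] at h4
      linear_combination h4]
    exact hE.hasSum
  have e1 : (-1 : ℂ) ^ (-(n : ℤ)) = (-1) ^ n := by
    rw [zpow_neg, zpow_natCast, ← inv_pow, inv_neg_one]
  simp only [E]
  rw [e1, zpow_natCast,
    show 12 * (-(n : ℤ)) ^ 2 + 4 * (-(n : ℤ)) =
      ((12 * n ^ 2 + 4 * n : ℕ) : ℤ) + -((8 * n : ℕ) : ℤ) by push_cast; ring,
    show 12 * (n : ℤ) ^ 2 + 4 * n = ((12 * n ^ 2 + 4 * n : ℕ) : ℤ) by push_cast; ring,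
    zpow_add₀ ht,
    show 8 * (-(n : ℤ)) = -((8 * n : ℕ) : ℤ) by push_cast; ring,
    show 8 * (n : ℤ) = ((8 * n : ℕ) : ℤ) by push_cast; ring, zpow_neg, zpow_natCast,
    zpow_natCast,
    show ((r : ℂ) ^ 4) ^ (3 * n ^ 2 + n) = (r : ℂ) ^ (12 * n ^ 2 + 4 * n) by ring,
    show ((r : ℂ) ^ 8) ^ (2 * n) = ((r : ℂ) ^ (8 * n)) ^ 2 by ring,
    show ((r : ℂ) ^ 8) ^ n = (r : ℂ) ^ (8 * n) by ring]
  have n1 := one_add_I_mul_ne_zero (r ^ (8 * n))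
  have n3 := one_add_ofReal_ne_zero (r := (r ^ (8 * n)) ^ 2) (by positivity)
  have n4 : (r : ℂ) ^ (8 * n) ≠ 0 := pow_ne_zero _ ht
  push_cast at n1 n3
  generalize (r : ℂ) ^ (8 * n) = u at *
  exact pair_identity_add _ n1 n3 n4 _

/-- As ζ + ζ⁻¹ = √2, the denominators of G factor as (1 - ζu)(1 - ζ⁻¹u) with u = r^(2n+1). The pole
term of index n gives one factor and that of index -n - 1 the other. -/
theorem hasSum_firstPole {r : ℝ} (hr0 : 0 < r) (hr1 : r < 1) {G : ℂ}
    (hG : HasSum (fun D : ℕ => ((r : ℂ) ^ 2) ^ (D ^ 2) * ((r : ℂ) ^ 2) ^ D *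
      (∏ l ∈ range (D + 1), (1 + (r : ℂ) ^ 2 * ((r : ℂ) ^ 2) ^ (2 * l) -
        ((r : ℂ) ^ 2) ^ l * ((√2 : ℝ) * r)))⁻¹) G) :
    HasSum (fun n : ℤ => thetaNum (r : ℂ) 1 (Complex.I * r) (-(Complex.I * r)) n /
      (1 - 1 * (zeta8 * r) * ((r : ℂ) ^ 2) ^ n)) (G * qPochInf ((r : ℂ) ^ 2) ((r : ℂ) ^ 2)) := by
  have ht : (r : ℂ) ≠ 0 := by exact_mod_cast hr0.ne'
  have ht1 : ‖(r : ℂ)‖ < 1 := by simpa [abs_of_pos hr0] using hr1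
  have hI : Complex.I * r ≠ 0 := mul_ne_zero Complex.I_ne_zero ht
  have hsum := summable_thetaNum_div ht ht1 one_ne_zero hI (neg_ne_zero.2 hI) (zeta8 * r)
  have hfac : ∀ u : ℂ, 1 + u ^ 2 - u * (√2 : ℝ) = (1 - zeta8 * u) * (1 - zeta8⁻¹ * u) := by
    intro u
    have := zeta8_ne_zero
    rw [← zeta8_add_inv]
    field_simp
    ring
  have hinv : ∀ u : ℝ, 1 - zeta8⁻¹ * u ≠ 0 := by
    intro u h
    rw [zeta8_inv] at h
    have h3 := congrArg Complex.im h
    have h4 := congrArg Complex.re h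
    simp at h3 h4
    simp [h3] at h4
  have hfac' : ∀ n : ℕ, 1 + (r : ℂ) ^ 2 * ((r : ℂ) ^ 2) ^ (2 * n) -
        ((r : ℂ) ^ 2) ^ n * ((√2 : ℝ) * r) =
        (1 - zeta8 * (r : ℂ) ^ (2 * n + 1)) * (1 - zeta8⁻¹ * (r : ℂ) ^ (2 * n + 1)) := by
    intro n
    rw [← hfac]
    ring
  obtain ⟨s, h1, h2⟩ := hasSum_mock_q (w := (√2 : ℝ) * r) ht ht1
    (fun n => by
      rw [hfac']
      have h1 := (one_sub_zeta8_ne_zero (r ^ (2 * n + 1))).1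
      have h2 := hinv (r ^ (2 * n + 1))
      push_cast at h1 h2
      exact mul_ne_zero h1 h2)
  rw [h1.unique hG] at h2
  have h3 := hsum.hasSum.nat_add_neg_add_one
  rw [h2.unique (h3.congr_fun fun n => ?_)]
  · exact hsum.hasSum
  have e1 : ∀ m : ℤ, thetaNum (r : ℂ) 1 (Complex.I * r) (-(Complex.I * r)) m =
      (-1) ^ m * (r : ℂ) ^ (3 * m ^ 2 + 3 * m) := by
    intro m
    have : (1 : ℂ) ^ 2 / (Complex.I * r * -(Complex.I * r)) = (r : ℂ) ^ (-2 : ℤ) := by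
      have hI := Complex.I_sq
      rw [zpow_neg, div_eq_iff (mul_ne_zero ‹_› (neg_ne_zero.2 ‹_›)), zpow_ofNat]
      field_simp
      linear_combination hI
    rw [thetaNum, this, ← zpow_mul, mul_one, mul_assoc, ← zpow_add₀ ht]
    congr 2; ring
  rw [hfac', e1, e1, neg_one_zpow_neg_add_one, zpow_natCast,
    show 3 * (-((n : ℤ) + 1)) ^ 2 + 3 * (-((n : ℤ) + 1)) = ((3 * n ^ 2 + 3 * n : ℕ) : ℤ) by
      push_cast; ring,
    show 3 * (n : ℤ) ^ 2 + 3 * n = ((3 * n ^ 2 + 3 * n : ℕ) : ℤ) by push_cast; ring,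
    zpow_natCast,
    show (1 : ℂ) * (zeta8 * r) * ((r : ℂ) ^ 2) ^ (n : ℤ) = zeta8 * (r : ℂ) ^ (2 * n + 1) by
      rw [zpow_natCast]; ring,
    show (1 : ℂ) * (zeta8 * r) * ((r : ℂ) ^ 2) ^ (-((n : ℤ) + 1)) =
        zeta8 * ((r : ℂ) ^ (2 * n + 1))⁻¹ by
      rw [zpow_neg, show ((n : ℤ) + 1) = ((n + 1 : ℕ) : ℤ) by push_cast; ring, zpow_natCast]
      field_simp; ring,
    show (r : ℂ) ^ 2 * ((r : ℂ) ^ 2) ^ (2 * n) = ((r : ℂ) ^ (2 * n + 1)) ^ 2 by ring]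
  have n1 := (one_sub_zeta8_ne_zero (r ^ (2 * n + 1))).1
  have n2 := hinv (r ^ (2 * n + 1))
  have n4 : (r : ℂ) ^ (2 * n + 1) ≠ 0 := pow_ne_zero _ ht
  push_cast at n1 n2
  generalize (r : ℂ) ^ (2 * n + 1) = u at *
  have n5 := zeta8_ne_zero
  rw [show 1 - zeta8 * u⁻¹ = -zeta8 * (1 - zeta8⁻¹ * u) / u by field_simp; ring]
  have e5 : (1 - u ^ 2) = (1 - zeta8⁻¹ * u) + zeta8⁻¹ * u * (1 - zeta8 * u) := by
    field_simp; ring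
  rw [e5]
  generalize 1 - zeta8 * u = A at *
  generalize 1 - zeta8⁻¹ * u = B at *
  field_simp

/-! ### Product identities and the relation between G, ν and φ -/

/-- Follows by pairing factors of opposite sign and separating even from odd exponents. In
`durfee_identity` it makes the coefficient of ν and φ free of infinite products. -/
theorem qPochInf_dilate_identity {q : ℂ} (hq : ‖q‖ < 1) :
    qPochInf (q ^ 4) (q ^ 4) * qPochInf (-q) (q ^ 2) = qPochInf q q * qPochInf (-q) q ^ 2 := by
  have hq2 : ‖q ^ 2‖ < 1 := norm_sq_lt_one hq
  have h1 := qPochInf_mul_neg hq q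
  have h2 := qPochInf_mul_neg hq2 (q ^ 2)
  have h3 := qPochInf_even_mul_odd hq (-q)
  rw [show (q ^ 2) ^ 2 = q ^ 4 by ring] at h2
  rw [show -q * q = -q ^ 2 by ring] at h3
  rw [← h2, ← h1, ← h3]
  ring

theorem thetaProd_neg_one {q : ℂ} (hq : ‖q‖ < 1) :
    thetaProd (-1) q = 2 * qPochInf (-q) q ^ 2 := by
  rw [thetaProd, qPochInf_succ hq (-1), show q / -1 = -q by ring]
  ring_nf

theorem thetaProd_mul_thetaProd_neg {q y : ℂ} (hq : ‖q‖ < 1) :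
    thetaProd y q * thetaProd (-y) q = thetaProd (y ^ 2) (q ^ 2) := by
  rw [thetaProd, thetaProd, thetaProd, ← qPochInf_mul_neg hq, ← div_pow, ← qPochInf_mul_neg hq,
    div_neg]
  ring

theorem thetaProd_I_mul {t : ℂ} (ht0 : t ≠ 0) (ht : ‖t‖ < 1) :
    thetaProd (Complex.I * t) (t ^ 2) = qPochInf (-t ^ 2) (t ^ 4) := by
  have hI := Complex.I_ne_zero
  have hI2 := Complex.I_sq
  have h := qPochInf_mul_neg (norm_sq_lt_one ht) (Complex.I * t)
  rw [thetaProd, show t ^ 2 / (Complex.I * t) = -(Complex.I * t) by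
    field_simp; linear_combination hI2, h, mul_pow, hI2]
  ring_nf

theorem thetaProd_neg_I_mul {t : ℂ} (ht0 : t ≠ 0) (ht : ‖t‖ < 1) :
    thetaProd (-(Complex.I * t)) (t ^ 2) = qPochInf (-t ^ 2) (t ^ 4) := by
  have hI := Complex.I_ne_zero
  have hI2 := Complex.I_sq
  have h := qPochInf_mul_neg (norm_sq_lt_one ht) (Complex.I * t)
  rw [thetaProd, show t ^ 2 / -(Complex.I * t) = Complex.I * t by
    field_simp; linear_combination -hI2, mul_comm, h, mul_pow, hI2]
  ring_nf

theorem thetaProd_mul {q y : ℂ} (hq0 : q ≠ 0) (hq : ‖q‖ < 1) (hy : y ≠ 0) :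
    thetaProd y q = - y * thetaProd (q * y) q := by
  rw [thetaProd, thetaProd, qPochInf_succ hq y, show q / (q * y) = y⁻¹ by field_simp,
    qPochInf_succ hq y⁻¹, show y * q = q * y by ring, show y⁻¹ * q = q / y by ring]
  field_simp
  ring

theorem thetaProd_inv_I_mul {t : ℂ} (ht0 : t ≠ 0) (ht : ‖t‖ < 1) :
    thetaProd (1 / (Complex.I * t)) (t ^ 2) = Complex.I / t * qPochInf (-t ^ 2) (t ^ 4) ∧
    thetaProd (1 / (-(Complex.I * t))) (t ^ 2) = -(Complex.I / t * qPochInf (-t ^ 2) (t ^ 4)) := by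
  have hI := Complex.I_ne_zero
  have hI2 := Complex.I_sq
  have e : 1 / (Complex.I * t) = -(Complex.I / t) := by
    field_simp; linear_combination hI2
  have n : Complex.I / t ≠ 0 := div_ne_zero hI ht0
  constructor
  · rw [e, thetaProd_mul (pow_ne_zero 2 ht0) (norm_sq_lt_one ht) (neg_ne_zero.2 n),
      show t ^ 2 * -(Complex.I / t) = -(Complex.I * t) by field_simp, thetaProd_neg_I_mul ht0 ht]
    ring
  · rw [one_div_neg_eq_neg_one_div, e, neg_neg, thetaProd_mul (pow_ne_zero 2 ht0) (norm_sq_lt_one ht) n,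
      show t ^ 2 * (Complex.I / t) = Complex.I * t by field_simp, thetaProd_I_mul ht0 ht]
    ring

/-- Pairing factors of opposite sign squares ζ to i, and pairing once more squares i to -1. This
moves the theta at ζt from the denominator to a numerator. -/
theorem theta_mul_thetaProd {t : ℂ} (ht0 : t ≠ 0) (ht : ‖t‖ < 1) :
    theta zeta8 t * thetaProd (zeta8 * t) (t ^ 2) =
      qPochInf (-t ^ 4) (t ^ 8) * qPochInf (t ^ 2) (t ^ 2) := by
  have hq := norm_sq_lt_one ht
  have h0 := zeta8_ne_zero
  have hz := zeta8_sq
  have hI := Complex.I_ne_zero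
  have hI2 := Complex.I_sq
  have h1 := qPochInf_mul_neg hq (t * zeta8)
  have h2 := qPochInf_mul_neg hq (t / zeta8)
  have h3 := qPochInf_mul_neg (norm_sq_lt_one hq) (Complex.I * t ^ 2)
  rw [mul_pow, hz, mul_comm (t ^ 2)] at h1
  rw [div_pow, hz, show t ^ 2 / Complex.I = -(Complex.I * t ^ 2) by
    field_simp; linear_combination hI2] at h2
  rw [mul_pow, hI2] at h3
  rw [theta, thetaProd, show t ^ 2 / (zeta8 * t) = t / zeta8 by field_simp, mul_comm zeta8 t,
    show -t ^ 4 = -1 * (t ^ 2) ^ 2 by ring, show t ^ 8 = ((t ^ 2) ^ 2) ^ 2 by ring, ← h3, ← h1,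
    ← h2]
  ring

theorem thetaProd_pair {t : ℂ} (ht0 : t ≠ 0) (ht : ‖t‖ < 1) :
    thetaProd (Complex.I * t * (zeta8 * t)) (t ^ 2) *
      thetaProd (-(Complex.I * t) * (zeta8 * t)) (t ^ 2) =
      (1 - Complex.I) * qPochInf (-t ^ 8) (t ^ 8) := by
  have hq := norm_sq_lt_one ht
  have hz := zeta8_sq
  have hI := Complex.I_ne_zero
  have hI2 := Complex.I_sq
  have h3 := qPochInf_mul_neg (norm_sq_lt_one hq) (Complex.I * t ^ 4)
  rw [mul_pow, hI2] at h3
  rw [neg_mul, thetaProd_mul_thetaProd_neg hq,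
    show (Complex.I * t * (zeta8 * t)) ^ 2 = -(Complex.I * t ^ 4) by
      linear_combination (Complex.I ^ 2 * t ^ 4) * hz + Complex.I * t ^ 4 * hI2,
    thetaProd, show (t ^ 2) ^ 2 / -(Complex.I * t ^ 4) = Complex.I by
      field_simp; linear_combination -hI2, qPochInf_succ (norm_sq_lt_one hq) Complex.I,
    show Complex.I * (t ^ 2) ^ 2 = Complex.I * t ^ 4 by ring]
  rw [show -t ^ 8 = -1 * (t ^ 4) ^ 2 by ring, show t ^ 8 = ((t ^ 2) ^ 2) ^ 2 by ring, ← h3]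
  ring

theorem norm_real_lt_one {r : ℝ} (hr0 : 0 < r) (hr1 : r < 1) : ‖(r : ℂ)‖ < 1 := by
  simpa [abs_of_pos hr0] using hr1

theorem one_sub_mul_pow_ne_zero {q a : ℂ} (hq : ‖q‖ < 1) (ha : ‖a‖ < 1) (k : ℕ) :
    1 - a * q ^ k ≠ 0 := by
  intro h
  have h1 : a * q ^ k = 1 := by linear_combination -h
  have h2 : ‖a * q ^ k‖ < 1 := by
    rw [norm_mul, norm_pow]
    exact mul_lt_one_of_nonneg_of_lt_one_left (norm_nonneg _) ha
      (pow_le_one₀ (norm_nonneg _) hq.le)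
  simp [h1] at h2

theorem qPochInf_ne_zero_of_norm_lt_one {q a : ℂ} (hq : ‖q‖ < 1) (ha : ‖a‖ < 1) : qPochInf a q ≠ 0 :=
  qPochInf_ne_zero hq (one_sub_mul_pow_ne_zero hq ha)

/-- The three families lie on the positive real, positive imaginary and negative imaginary
half-lines. -/
theorem three_poles_separated {r : ℝ} (hr0 : 0 < r) (j k : ℕ) :
    ((r : ℂ) ^ 2) ^ j ≠ Complex.I * r * ((r : ℂ) ^ 2) ^ k ∧
    ((r : ℂ) ^ 2) ^ j ≠ -(Complex.I * r) * ((r : ℂ) ^ 2) ^ k ∧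
    Complex.I * r * ((r : ℂ) ^ 2) ^ j ≠ -(Complex.I * r) * ((r : ℂ) ^ 2) ^ k := by
  have h1 : ((r : ℂ) ^ 2) ^ j = (((r ^ 2) ^ j : ℝ) : ℂ) := by push_cast; rfl
  have h2 : Complex.I * (r : ℂ) * ((r : ℂ) ^ 2) ^ k =
    Complex.I * ((r * (r ^ 2) ^ k : ℝ) : ℂ) := by push_cast; ring
  have h3 : Complex.I * (r : ℂ) * ((r : ℂ) ^ 2) ^ j =
    Complex.I * ((r * (r ^ 2) ^ j : ℝ) : ℂ) := by push_cast; ring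
  have p1 : 0 < (r ^ 2) ^ j := by positivity
  have p2 : 0 < r * (r ^ 2) ^ k := by positivity
  have p3 : 0 < r * (r ^ 2) ^ j := by positivity
  rw [neg_mul, h2, h3, h1]
  generalize (r ^ 2) ^ j = x at *
  generalize r * (r ^ 2) ^ k = y at *
  generalize r * x = z at *
  refine ⟨fun h => ?_, fun h => ?_, fun h => ?_⟩
  · have := congrArg Complex.re h
    simp at this
    linarith
  · have := congrArg Complex.re h
    simp at this
    linarith
  · have := congrArg Complex.im h
    simp at this
    linarith

/-- `three_theta` at x = ζr with poles 1, ir, -ir: the first pole carries G. The theta coefficients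
of the other two are opposite, so their series enter through `poleTerm`, whose even and odd indices
carry ν and φ. -/
theorem durfee_identity {r : ℝ} (hr0 : 0 < r) (hr1 : r < 1) {G ν φ : ℂ}
    (hG : HasSum (fun D : ℕ => ((r : ℂ) ^ 2) ^ (D ^ 2) * ((r : ℂ) ^ 2) ^ D *
      (∏ l ∈ range (D + 1), (1 + (r : ℂ) ^ 2 * ((r : ℂ) ^ 2) ^ (2 * l) -
        ((r : ℂ) ^ 2) ^ l * ((√2 : ℝ) * r)))⁻¹) G)
    (hν : HasSum (fun D : ℕ => ((r : ℂ) ^ 8) ^ (D ^ 2) * ((r : ℂ) ^ 8) ^ D *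
      (∏ l ∈ range (D + 1), (1 + (r : ℂ) ^ 8 * ((r : ℂ) ^ 8) ^ (2 * l)))⁻¹) ν)
    (hφ : HasSum (fun D : ℕ => ((r : ℂ) ^ 8) ^ (D ^ 2) *
      (∏ l ∈ range (D + 1), (1 + ((r : ℂ) ^ 8) ^ (2 * l)))⁻¹) φ) :
    (√2 : ℝ) * r * (G + (r : ℂ) ^ 2 * ν) + 2 * φ =
      theta 1 ((r : ℂ) ^ 2) * theta zeta8 r / qPochInf ((r : ℂ) ^ 8) ((r : ℂ) ^ 8) := by
  have ht : (r : ℂ) ≠ 0 := by exact_mod_cast hr0.ne'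
  have ht1 := norm_real_lt_one hr0 hr1
  have hq := norm_sq_lt_one ht1
  have hq2 := norm_sq_lt_one hq
  have hI := Complex.I_ne_zero
  have hI2 := Complex.I_sq
  have hz0 := zeta8_ne_zero
  have hpole : ∀ n : ℤ, 1 - zeta8 * (r * ((r : ℂ) ^ 2) ^ n) ≠ 0 ∧
      1 - Complex.I * zeta8 * (r ^ 2 * ((r : ℂ) ^ 2) ^ n) ≠ 0 ∧
      1 + Complex.I * zeta8 * (r ^ 2 * ((r : ℂ) ^ 2) ^ n) ≠ 0 := by
    intro n
    have h1 := one_sub_zeta8_ne_zero (r * (r ^ 2) ^ n)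
    have h2 := one_sub_zeta8_ne_zero (r ^ 2 * (r ^ 2) ^ n)
    push_cast at h1 h2
    exact ⟨h1.1, h2.2⟩
  have key := three_theta (t := (r : ℂ)) (x := zeta8 * r)
    (a := ![1, Complex.I * r, -(Complex.I * r)]) ht ht1
    (by
      intro i
      fin_cases i <;> simp [ht])
    (mul_ne_zero hz0 ht)
    (by
      intro i l hil j k
      have h1 := three_poles_separated hr0 j k
      have h2 := three_poles_separated hr0 k j
      fin_cases i <;> fin_cases l <;> first | exact absurd rfl hil | skip
      · simpa using h1.1
      · simpa using h1.2.1
      · simpa using h2.1.symm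
      · simpa using h1.2.2
      · simpa using h2.2.1.symm
      · simpa using h2.2.2.symm)
    (by
      intro i n
      obtain ⟨h1, h2, h3⟩ := hpole n
      fin_cases i
      · convert h1 using 1; simp; ring
      · convert h2 using 1; simp; ring
      · convert h3 using 1; simp; ring)
  simp only [Matrix.cons_val_zero, Matrix.cons_val_one, Matrix.cons_val, div_one] at key
  rw [(hasSum_firstPole hr0 hr1 hG).tsum_eq, thetaProd_I_mul ht ht1, thetaProd_neg_I_mul ht ht1] at key
  have hS := ((hasSum_poleTerm_even hr0 hr1 hν).int_even_add_odd
    (hasSum_poleTerm_odd hr0 hr1 hφ)).unique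
    ((summable_poleTerm hr0 hr1).1.hasSum.sub (summable_poleTerm hr0 hr1).2.hasSum)
  rw [(thetaProd_inv_I_mul ht ht1).1, (thetaProd_inv_I_mul ht ht1).2,
    show -(Complex.I * (r : ℂ)) / (Complex.I * r) = -1 by field_simp,
    show Complex.I * (r : ℂ) / -(Complex.I * r) = -1 by field_simp, thetaProd_neg_one hq] at key
  have eT := theta_mul_thetaProd ht ht1
  have eP := thetaProd_pair ht ht1
  have eC := qPochInf_even_mul_odd (q := (r : ℂ) ^ 4) (by
    rw [show (r : ℂ) ^ 4 = ((r : ℂ) ^ 2) ^ 2 by ring]; exact hq2) (-(r : ℂ) ^ 4)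
  have eR := qPochInf_dilate_identity hq
  have eW := qPochInf_mul_neg hq2 (((r : ℂ) ^ 2) ^ 2)
  have eθ : theta 1 ((r : ℂ) ^ 2) = qPochInf (-(r : ℂ) ^ 2) ((r : ℂ) ^ 4) ^ 2 *
      qPochInf ((r : ℂ) ^ 4) ((r : ℂ) ^ 4) := by
    rw [theta]; ring_nf
  have hn : ∀ n, n ≠ 0 → ‖(r : ℂ) ^ n‖ < 1 ∧ ‖-(r : ℂ) ^ n‖ < 1 := by
    intro n hn
    rw [norm_neg, norm_pow]
    exact ⟨pow_lt_one₀ (norm_nonneg _) ht1 hn, pow_lt_one₀ (norm_nonneg _) ht1 hn⟩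
  have nA := qPochInf_ne_zero_of_norm_lt_one (hn 8 (by norm_num)).1 (hn 4 (by norm_num)).2
  have nB := qPochInf_ne_zero_of_norm_lt_one (hn 8 (by norm_num)).1 (hn 8 (by norm_num)).2
  have nM := qPochInf_ne_zero_of_norm_lt_one (hn 4 (by norm_num)).1 (hn 2 (by norm_num)).2
  have nN := qPochInf_ne_zero_of_norm_lt_one (hn 2 (by norm_num)).1 (hn 2 (by norm_num)).2
  have nq := qPochInf_ne_zero_of_norm_lt_one (hn 2 (by norm_num)).1 (hn 2 (by norm_num)).1
  have nW := qPochInf_ne_zero_of_norm_lt_one (hn 4 (by norm_num)).1 (hn 4 (by norm_num)).1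
  rw [show -(r : ℂ) ^ 4 * r ^ 4 = -r ^ 8 by ring, show ((r : ℂ) ^ 4) ^ 2 = r ^ 8 by ring] at eC
  rw [show ((r : ℂ) ^ 2) ^ 4 = r ^ 8 by ring, show ((r : ℂ) ^ 2) ^ 2 = r ^ 4 by ring] at eR
  rw [show (((r : ℂ) ^ 2) ^ 2) ^ 2 = r ^ 8 by ring, show ((r : ℂ) ^ 2) ^ 2 = r ^ 4 by ring,
    ← eC] at eW
  rw [mul_assoc (thetaProd _ _), eP, one_mul] at key
  rw [eθ]
  have h2 := zeta8_mul
  have h3 := sqrt_two_sq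
  have nT : thetaProd (zeta8 * r) ((r : ℂ) ^ 2) ≠ 0 := by
    intro h
    rw [h, mul_zero] at eT
    exact mul_ne_zero nA nq eT.symm
  have hz0 := zeta8_ne_zero
  have n1I : 1 - Complex.I ≠ 0 := by
    intro h
    rw [h, mul_zero] at h2
    rw [← h2] at h3
    norm_num at h3
  rw [show 2 * Complex.I * zeta8 / (r : ℂ) ^ 2 * ((1 - Complex.I) *
    (φ * qPochInf ((r : ℂ) ^ 8) ((r : ℂ) ^ 8))) = 2 * Complex.I / (r : ℂ) ^ 2 *
      (zeta8 * (1 - Complex.I)) * (φ * qPochInf ((r : ℂ) ^ 8) ((r : ℂ) ^ 8)) by ring, h2] at hS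
  simp only [mul_inv, ← h2] at key ⊢
  have n2 : ((√2 : ℝ) : ℂ) ≠ 0 := by
    rw [← h2]; exact mul_ne_zero hz0 n1I
  generalize thetaProd (zeta8 * r) ((r : ℂ) ^ 2) = T at *
  generalize theta zeta8 r = Θ at *
  generalize qPochInf (-(r : ℂ) ^ 4) ((r : ℂ) ^ 8) = A at *
  generalize qPochInf (-(r : ℂ) ^ 8) ((r : ℂ) ^ 8) = B at *
  generalize qPochInf ((r : ℂ) ^ 8) ((r : ℂ) ^ 8) = R at *
  generalize qPochInf ((r : ℂ) ^ 4) ((r : ℂ) ^ 4) = W at *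
  generalize qPochInf ((r : ℂ) ^ 2) ((r : ℂ) ^ 2) = P at *
  generalize qPochInf (-(r : ℂ) ^ 2) ((r : ℂ) ^ 4) = M at *
  generalize qPochInf (-(r : ℂ) ^ 2) ((r : ℂ) ^ 2) = N at *
  generalize ∑' n : ℤ, thetaNum (r : ℂ) (Complex.I * r) 1 (-(Complex.I * r)) n /
    (1 - Complex.I * r * (zeta8 * r) * ((r : ℂ) ^ 2) ^ n) = S2 at *
  generalize ∑' n : ℤ, thetaNum (r : ℂ) (-(Complex.I * r)) 1 (Complex.I * r) n /
    (1 - -(Complex.I * r) * (zeta8 * r) * ((r : ℂ) ^ 2) ^ n) = S3 at *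
  have k1 : P ^ 2 / ((zeta8 * (1 - Complex.I)) * r * T * B) =
      G * P / (M * M) + (S2 - S3) * r / (2 * Complex.I * M * N ^ 2) := by
    refine Eq.trans ?_ (key.trans ?_)
    · field_simp
    · field_simp
      ring
  rw [← hS, h2] at k1
  rw [h2]
  have k2 : P ^ 2 / ((√2 : ℝ) * r * T * B) = P / ((√2 : ℝ) * r * M ^ 2) *
      (M ^ 2 * P / (T * B)) := by
    field_simp
  have nR : R ≠ 0 := by
    rw [← eW]; exact mul_ne_zero nW (mul_ne_zero nA nB)
  have k3 : M ^ 2 * P / (T * B) = M ^ 2 * W * Θ / R := by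
    rw [← eW]
    field_simp
    linear_combination -eT
  rw [k2, k3] at k1
  generalize M ^ 2 * W * Θ / R = Y at *
  -- The common factor R M / (P N²) is 1 by `eR`, and √2 squared is the 2 in front of φ.
  have k4 : Y = (√2 : ℝ) * r * G + (√2 : ℝ) * r ^ 3 * ν *(R * M / (P * N ^ 2)) +
      (√2 : ℝ) ^ 2 * φ * (R * M / (P * N ^ 2)) := by
    field_simp at k1 ⊢
    linear_combination k1
  rw [k4, eR, div_self (mul_ne_zero nq (pow_ne_zero 2 nN)), h3]
  ring

/-! ### Replacing ν and φ by series with nonnegative coefficients -/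

theorem theta_self {y : ℂ} (hy0 : y ≠ 0) (hy : ‖y‖ < 1) :
    theta y y = 2 * qPochInf (-y ^ 2) (y ^ 2) ^ 2 * qPochInf (y ^ 2) (y ^ 2) := by
  rw [theta, div_self hy0, qPochInf_succ (norm_sq_lt_one hy) (-1)]
  ring_nf

theorem euler_odd_distinct {y : ℂ} (hy : ‖y‖ < 1) :
    qPochInf (y ^ 2) (y ^ 4) * qPochInf (-y ^ 2) (y ^ 2) = 1 := by
  have hq := norm_sq_lt_one hy
  have h1 := qPochInf_even_mul_odd hq (y ^ 2)
  have h2 := qPochInf_mul_neg hq (y ^ 2)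
  have hn : ∀ n, n ≠ 0 → ‖y ^ n‖ < 1 := by
    intro n hn
    rw [norm_pow]
    exact pow_lt_one₀ (norm_nonneg _) hy hn
  have n1 := qPochInf_ne_zero_of_norm_lt_one hq hq
  rw [show (y ^ 2) ^ 2 = y ^ 4 by ring] at h1 h2
  rw [show y ^ 2 * y ^ 2 = y ^ 4 by ring, ← h2] at h1
  exact mul_left_cancel₀ n1 (by linear_combination h1)

theorem theta_neg {y : ℂ} (hy0 : y ≠ 0) (hy : ‖y‖ < 1) :
    theta (-y) (y ^ 2) = qPochInf (-y ^ 2) (y ^ 2) * qPochInf y y := by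
  have hq := norm_sq_lt_one hy
  have h1 := qPochInf_even_mul_odd hq y
  have h2 := qPochInf_mul_neg hq (y ^ 2)
  have h3 := qPochInf_even_mul_odd hy y
  rw [theta, show -(y ^ 2 * -y) = y * y ^ 2 by ring, show -(y ^ 2 / -y) = y by field_simp]
  rw [show y * y = y ^ 2 by ring] at h3
  linear_combination qPochInf ((y ^ 2) ^ 2) ((y ^ 2) ^ 2) * h1 - qPochInf y (y ^ 2) * h2 +
    qPochInf (-y ^ 2) (y ^ 2) * h3

theorem theta_neg_one {y : ℂ} (hy0 : y ≠ 0) (hy : ‖y‖ < 1) :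
    theta (-1) (y ^ 2) * qPochInf (-y ^ 2) (y ^ 2) * qPochInf y (y ^ 2) = qPochInf y y := by
  have hq := norm_sq_lt_one hy
  have h1 := qPochInf_even_mul_odd hq (y ^ 2)
  have h2 := euler_odd_distinct hy
  have h3 := qPochInf_even_mul_odd hy y
  rw [theta, show -(y ^ 2 * -1) = y ^ 2 by ring, show -(y ^ 2 / -1) = y ^ 2 by field_simp]
  rw [show y * y = y ^ 2 by ring] at h3
  rw [show (y ^ 2) ^ 2 = y ^ 4 by ring] at h1 ⊢
  rw [show y ^ 2 * y ^ 2 = y ^ 4 by ring] at h1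
  rw [← h3, ← h1]
  linear_combination (qPochInf (y ^ 2) (y ^ 4) * qPochInf (y ^ 4) (y ^ 4) *
    qPochInf y (y ^ 2)) * h2

theorem theta_sq {y : ℂ} (hy0 : y ≠ 0) (hy : ‖y‖ < 1) :
    theta y (y ^ 2) * qPochInf y (y ^ 2) = qPochInf (y ^ 2) (y ^ 2) := by
  have hq := norm_sq_lt_one hy
  have h1 := qPochInf_even_mul_odd hq (-y)
  have h2 := qPochInf_even_mul_odd hq (y ^ 2)
  have h3 := qPochInf_mul_neg hq y
  rw [theta, show -(y ^ 2 * y) = -y * y ^ 2 by ring, show -(y ^ 2 / y) = -y by field_simp]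
  rw [show y ^ 2 * y ^ 2 = (y ^ 2) ^ 2 by ring] at h2
  rw [← h2, ← h3, ← h1]
  ring

/-- `bilat_eq` with q = y², z = -y, b = -y²: the half of nonnegative index is 2φ, the other half is
2X, and the product side is θ(1, y). -/
theorem mock_phi_identity {y φ : ℂ} (hy0 : y ≠ 0) (hy : ‖y‖ < 1)
    (hφ : HasSum (fun D : ℕ => y ^ (D ^ 2) * (∏ l ∈ range (D + 1), (1 + y ^ (2 * l)))⁻¹) φ) :
    ∃ X, HasSum (fun m : ℕ => y ^ (m + 1) * ∏ j ∈ range m, (1 + y ^ (2 * j + 2))) X ∧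
      qPochInf (-y ^ 2) (y ^ 2) * qPochInf y (y ^ 2) * (2 * φ + 2 * X) = theta 1 y := by
  have hq := norm_sq_lt_one hy
  have hb : ‖-y ^ 2‖ < 1 := by rwa [norm_neg]
  have hbz : ‖-y ^ 2‖ < ‖-y‖ := by
    rw [norm_neg, norm_neg, norm_pow, sq]
    exact mul_lt_of_lt_one_left (norm_pos_iff.2 hy0) hy
  have h2 := (summable_nat_add_iff 1).2 (summable_bilatNeg hq hbz)
  have key := bilat_eq hq (one_sub_mul_pow_ne_zero hq hb) hbz
  rw [bilat, show -y ^ 2 / -y = y by field_simp, show y ^ 2 / -y = -y by field_simp] at key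
  rw [theta, mul_one, div_one, ← key]
  have e1 : ∀ n, bilatPos (y ^ 2) (-y) (-y ^ 2) n =
      2 * (y ^ (n ^ 2) * (∏ l ∈ range (n + 1), (1 + y ^ (2 * l)))⁻¹) := by
    intro n
    induction n with
    | zero => simp [bilatPos]; norm_num
    | succ n ih =>
      have h3 := one_sub_mul_pow_ne_zero hq hb n
      rw [bilatPos_succ, ih, prod_range_succ _ (n + 1), mul_inv]
      rw [show 1 - -y ^ 2 * (y ^ 2) ^ n = 1 + y ^ (2 * (n + 1)) by ring] at h3 ⊢
      generalize (∏ l ∈ range (n + 1), (1 + y ^ (2 * l)))⁻¹ = Z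
      field_simp
      ring
  have e2 : ∀ m, bilatNeg (y ^ 2) (-y) (-y ^ 2) (m + 1) =
      2 * (y ^ (m + 1) * ∏ j ∈ range m, (1 + y ^ (2 * j + 2))) := by
    intro m
    induction m with
    | zero => simp [bilatNeg]; field_simp; ring
    | succ m ih =>
      rw [bilatNeg_succ, ih, prod_range_succ]
      field_simp
      ring
  simp only [e1, e2] at h2 ⊢
  rw [summable_mul_left_iff two_ne_zero] at h2
  refine ⟨_, h2.hasSum, ?_⟩
  rw [tsum_mul_left, tsum_mul_left, hφ.tsum_eq]

/-- `bilat_eq` with q = y², z = -y², b = -y³: the two halves are ν and Y, each times 1 + y. -/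
theorem mock_nu_identity {y ν : ℂ} (hy0 : y ≠ 0) (hy : ‖y‖ < 1)
    (hν : HasSum (fun D : ℕ => y ^ (D ^ 2) * y ^ D *
      (∏ l ∈ range (D + 1), (1 + y * y ^ (2 * l)))⁻¹) ν) :
    ∃ Y, HasSum (fun m : ℕ => y ^ m * ∏ j ∈ range m, (1 + y ^ (2 * j + 1))) Y ∧
      ν + Y = theta y y * qPochInf (-y ^ 2) (y ^ 2) := by
  have hq := norm_sq_lt_one hy
  have hb : ‖-y ^ 3‖ < 1 := by
    rw [norm_neg, norm_pow]
    exact pow_lt_one₀ (norm_nonneg _) hy (by norm_num)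
  have hbz : ‖-y ^ 3‖ < ‖-y ^ 2‖ := by
    rw [norm_neg, norm_neg, norm_pow, norm_pow]
    exact pow_lt_pow_right_of_lt_one₀ (norm_pos_iff.2 hy0) hy (by norm_num)
  have h2 := (summable_nat_add_iff 1).2 (summable_bilatNeg hq hbz)
  have key := bilat_eq hq (one_sub_mul_pow_ne_zero hq hb) hbz
  have n1 : 1 + y ≠ 0 := by
    have := one_sub_mul_pow_ne_zero hq (a := -y) (by rwa [norm_neg]) 0
    simpa using this
  have e1 : ∀ n, bilatPos (y ^ 2) (-y ^ 2) (-y ^ 3) n =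
      (1 + y) * (y ^ (n ^ 2) * y ^ n * (∏ l ∈ range (n + 1), (1 + y * y ^ (2 * l)))⁻¹) := by
    intro n
    induction n with
    | zero => simp [bilatPos, n1]
    | succ n ih =>
      have h3 := one_sub_mul_pow_ne_zero hq hb n
      rw [bilatPos_succ, ih, prod_range_succ _ (n + 1), mul_inv]
      rw [show 1 - -y ^ 3 * (y ^ 2) ^ n = 1 + y * y ^ (2 * (n + 1)) by ring] at h3 ⊢
      generalize (∏ l ∈ range (n + 1), (1 + y * y ^ (2 * l)))⁻¹ = Z
      field_simp
      ring
  have e2 : ∀ m, bilatNeg (y ^ 2) (-y ^ 2) (-y ^ 3) (m + 1) =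
      (1 + y) * (y ^ m * ∏ j ∈ range m, (1 + y ^ (2 * j + 1))) := by
    intro m
    induction m with
    | zero => simp [bilatNeg]; field_simp; ring
    | succ m ih =>
      rw [bilatNeg_succ, ih, prod_range_succ]
      field_simp
      ring
  rw [bilat, show -y ^ 3 / -y ^ 2 = y by field_simp, show y ^ 2 / -y ^ 2 = -1 by field_simp] at key
  simp only [e2] at h2 key
  simp only [e1] at key
  rw [summable_mul_left_iff n1] at h2
  refine ⟨_, h2.hasSum, ?_⟩
  rw [tsum_mul_left, tsum_mul_left, hν.tsum_eq] at key
  rw [theta_self hy0 hy]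
  have h3 := qPochInf_succ hq (-y)
  have h4 := qPochInf_mul_neg hq y
  have h5 := euler_odd_distinct hy
  have h6 := qPochInf_succ hq (-1)
  rw [show -y * y ^ 2 = -y ^ 3 by ring] at h3
  rw [show -1 * y ^ 2 = -y ^ 2 by ring] at h6
  rw [show (y ^ 2) ^ 2 = y ^ 4 by ring] at h4
  rw [h6] at key
  generalize ∑' m, y ^ m * ∏ j ∈ range m, (1 + y ^ (2 * j + 1)) = Y at *
  rw [← h4, h3] at h5
  linear_combination qPochInf (-y ^ 2) (y ^ 2) * key - (ν + Y) * h5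

/-- The generating function of the odd Durfee symbols, weighted by a primitive eighth root of unity
to the power of the rank, as a combination of series with nonnegative coefficients. -/
theorem durfee_positive_form {r : ℝ} (hr0 : 0 < r) (hr1 : r < 1) {G : ℂ}
    (hG : HasSum (fun D : ℕ => ((r : ℂ) ^ 2) ^ (D ^ 2) * ((r : ℂ) ^ 2) ^ D *
      (∏ l ∈ range (D + 1), (1 + (r : ℂ) ^ 2 * ((r : ℂ) ^ 2) ^ (2 * l) -
        ((r : ℂ) ^ 2) ^ l * ((√2 : ℝ) * r)))⁻¹) G) :
    ∃ X Y : ℂ,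
      HasSum (fun m : ℕ => ((r : ℂ) ^ 8) ^ (m + 1) *
        ∏ j ∈ range m, (1 + ((r : ℂ) ^ 8) ^ (2 * j + 2))) X ∧
      HasSum (fun m : ℕ => ((r : ℂ) ^ 8) ^ m *
        ∏ j ∈ range m, (1 + ((r : ℂ) ^ 8) ^ (2 * j + 1))) Y ∧
      r * G = (√2 : ℝ) * X + r ^ 3 * Y + qPochInf (-((r : ℂ) ^ 8) ^ 2) (((r : ℂ) ^ 8) ^ 2) *
        (r * theta 1 ((r : ℂ) ^ 8) +
          (√2 : ℝ) * r ^ 2 * theta ((r : ℂ) ^ 8) (((r : ℂ) ^ 8) ^ 2)) := by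
  have ht : (r : ℂ) ≠ 0 := by exact_mod_cast hr0.ne'
  have ht1 := norm_real_lt_one hr0 hr1
  have hy0 : (r : ℂ) ^ 8 ≠ 0 := pow_ne_zero _ ht
  have hy : ‖(r : ℂ) ^ 8‖ < 1 := by
    rw [norm_pow]
    exact pow_lt_one₀ (norm_nonneg _) ht1 (by norm_num)
  have hq := norm_sq_lt_one ht1
  obtain ⟨ν, hν, -⟩ := hasSum_mock_q (t := (r : ℂ) ^ 4) (w := 0) (pow_ne_zero _ ht)
    (by rw [norm_pow]; exact pow_lt_one₀ (norm_nonneg _) ht1 (by norm_num))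
    (fun n => by
      have h := one_add_ofReal_ne_zero (r := (r ^ 4) ^ 2 * ((r ^ 4) ^ 2) ^ (2 * n)) (by positivity)
      push_cast at h
      simpa using h)
  obtain ⟨φ, hφ, -⟩ := hasSum_mock_one (t := (r : ℂ) ^ 4) (pow_ne_zero _ ht)
    (by rw [norm_pow]; exact pow_lt_one₀ (norm_nonneg _) ht1 (by norm_num))
    (fun n => by
      have h := one_add_ofReal_ne_zero (r := ((r ^ 4) ^ 2) ^ (2 * n)) (by positivity)
      push_cast at h
      exact h)
  rw [show ((r : ℂ) ^ 4) ^ 2 = r ^ 8 by ring] at hν hφ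
  simp only [mul_zero, sub_zero] at hν
  have key := durfee_identity hr0 hr1 hG hν hφ
  obtain ⟨X, hX, eX⟩ := mock_phi_identity hy0 hy hφ
  obtain ⟨Y, hY, eY⟩ := mock_nu_identity hy0 hy hν
  refine ⟨X, Y, hX, hY, ?_⟩
  have e1 := theta_dissect (w := 1) (pow_ne_zero 2 ht) hq one_ne_zero
  have e2 := theta_dissect_eight ht ht1 zeta8_sq
  have e3 := theta_self hy0 hy
  have e4 := theta_neg hy0 hy
  have e5 := theta_neg_one hy0 hy
  have e6 := theta_sq hy0 hy
  have e7 := qPochInf_even_mul_odd hy ((r : ℂ) ^ 8)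
  have hyq := norm_sq_lt_one hy
  have n1 := qPochInf_ne_zero_of_norm_lt_one hyq (a := -((r : ℂ) ^ 8) ^ 2) (by rwa [norm_neg])
  have n2 := qPochInf_ne_zero_of_norm_lt_one hyq hy
  have n3 := qPochInf_ne_zero_of_norm_lt_one hy hy
  rw [zeta8_mul, show (r : ℂ) ^ 16 = (r ^ 8) ^ 2 by ring] at e2
  rw [one_pow, one_mul, one_mul, show ((r : ℂ) ^ 2) ^ 4 = r ^ 8 by ring] at e1
  rw [← sq] at e7
  rw [e1, e2, e4] at key
  generalize (r : ℂ) ^ 8 = y at *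
  generalize qPochInf (-y ^ 2) (y ^ 2) = E at *
  generalize qPochInf y (y ^ 2) = O at *
  generalize qPochInf (y ^ 2) (y ^ 2) = W at *
  generalize qPochInf y y = R at *
  generalize theta 1 y = θ1 at *
  generalize theta y y = θ2 at *
  generalize theta (-1) (y ^ 2) = θ3 at *
  generalize theta y (y ^ 2) = ψ at *
  have h2 : ((√2 : ℝ) : ℂ) ^ 2 = 2 := sqrt_two_sq
  have n4 : ((√2 : ℝ) : ℂ) ≠ 0 := by
    intro h; rw [h] at h2; norm_num at h2
  generalize ((√2 : ℝ) : ℂ) = w at *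
  apply mul_left_cancel₀ n4
  -- Of the four products of the dissected thetas, θ1 θ3 / R equals 2φ + 2X, θ2 θ3 / R reduces to
  -- 2Eψ, and in the other two R cancels.
  have k : (θ1 + r ^ 2 * θ2) * (θ3 + w * r * (E * R)) / R =
      2 * φ + 2 * X + w * r * (E * θ1) + 2 * r ^ 2 * (E * ψ) + w * r ^ 3 * (E * θ2) := by
    rw [div_eq_iff n3]
    linear_combination -θ3 * eX + (2 * φ + 2 * X) * e5 + r ^ 2 * θ3 * e3 -
      2 * r ^ 2 * E ^ 2 * θ3 * e6 + 2 * r ^ 2 * E * ψ * e5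
  rw [k] at key
  linear_combination key - w * r ^ 3 * eY - (X + E * r ^ 2 * ψ) * h2

/-! ### Power series with nonnegative coefficients -/

/-- `f` is, on `(0, 1)`, the sum of a power series with nonnegative coefficients, and the
coefficients whose index lies in `S` are positive. -/
def HasNonnegExpansion (S : Set ℕ) (f : ℝ → ℂ) : Prop :=
  ∃ c : ℕ → ℝ, (∀ n, 0 ≤ c n) ∧ (∀ n ∈ S, 0 < c n) ∧
    ∀ r : ℝ, 0 < r → r < 1 → HasSum (fun n => (c n : ℂ) * (r : ℂ) ^ n) (f r)

namespace HasNonnegExpansion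

variable {S T : Set ℕ} {f g : ℝ → ℂ}

theorem mono (h : HasNonnegExpansion T f) (hST : S ⊆ T) : HasNonnegExpansion S f := by
  obtain ⟨c, h0, h1, h2⟩ := h
  exact ⟨c, h0, fun n hn => h1 n (hST hn), h2⟩

theorem congr (h : HasNonnegExpansion S f) (hfg : ∀ r : ℝ, 0 < r → r < 1 → g r = f r) :
    HasNonnegExpansion S g := by
  obtain ⟨c, h0, h1, h2⟩ := h
  exact ⟨c, h0, h1, fun r hr0 hr1 => (hfg r hr0 hr1).symm ▸ h2 r hr0 hr1⟩

theorem add (hf : HasNonnegExpansion S f) (hg : HasNonnegExpansion T g) :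
    HasNonnegExpansion (S ∪ T) (fun r => f r + g r) := by
  obtain ⟨c, c0, c1, c2⟩ := hf
  obtain ⟨d, d0, d1, d2⟩ := hg
  refine ⟨fun n => c n + d n, fun n => add_nonneg (c0 n) (d0 n), ?_, fun r hr0 hr1 => ?_⟩
  · rintro n (hn | hn)
    · exact add_pos_of_pos_of_nonneg (c1 n hn) (d0 n)
    · exact add_pos_of_nonneg_of_pos (c0 n) (d1 n hn)
  · refine ((c2 r hr0 hr1).add (d2 r hr0 hr1)).congr_fun fun n => ?_
    push_cast
    ring

theorem summable_norm {c : ℕ → ℝ} {r : ℝ} {s : ℂ} (c0 : ∀ n, 0 ≤ c n) (hr : 0 < r)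
    (h : HasSum (fun n => (c n : ℂ) * (r : ℂ) ^ n) s) :
    Summable fun n => ‖(c n : ℂ) * (r : ℂ) ^ n‖ := by
  have h1 : Summable fun n => c n * r ^ n := by
    rw [← Complex.summable_ofReal]
    simpa using h.summable
  refine h1.congr fun n => ?_
  rw [norm_mul, norm_pow, Complex.norm_real, Complex.norm_real, Real.norm_of_nonneg (c0 n),
    Real.norm_of_nonneg hr.le]

theorem mul (hf : HasNonnegExpansion S f) (hg : HasNonnegExpansion T g) :
    HasNonnegExpansion (Set.image2 (· + ·) S T) (fun r => f r * g r) := by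
  obtain ⟨c, c0, c1, c2⟩ := hf
  obtain ⟨d, d0, d1, d2⟩ := hg
  refine ⟨fun n => ∑ p ∈ antidiagonal n, c p.1 * d p.2,
    fun n => sum_nonneg fun p _ => mul_nonneg (c0 _) (d0 _), ?_, fun r hr0 hr1 => ?_⟩
  · rintro n ⟨k, hk, l, hl, rfl⟩
    exact sum_pos' (fun p _ => mul_nonneg (c0 _) (d0 _))
      ⟨(k, l), by simp, mul_pos (c1 k hk) (d1 l hl)⟩
  · have hc := summable_norm c0 hr0 (c2 r hr0 hr1)
    have hd := summable_norm d0 hr0 (d2 r hr0 hr1)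
    have h := (summable_norm_sum_mul_antidiagonal_of_summable_norm hc hd).of_norm.hasSum
    rw [← tsum_mul_tsum_eq_tsum_sum_antidiagonal_of_summable_norm hc hd, (c2 r hr0 hr1).tsum_eq,
      (d2 r hr0 hr1).tsum_eq] at h
    refine h.congr_fun fun n => ?_
    push_cast
    rw [sum_mul]
    refine sum_congr rfl fun p hp => ?_
    rw [← mem_antidiagonal.1 hp, pow_add]
    ring

theorem const_mul_pow {κ : ℝ} (hκ : 0 < κ) (k : ℕ) :
    HasNonnegExpansion {k} (fun r => (κ : ℂ) * (r : ℂ) ^ k) := by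
  refine ⟨fun n => if n = k then κ else 0, fun n => ?_, ?_, fun r _ _ => ?_⟩
  · dsimp only
    split_ifs
    exacts [hκ.le, le_rfl]
  · rintro n rfl
    simpa using hκ
  · convert hasSum_ite_eq k ((κ : ℂ) * (r : ℂ) ^ k) using 2 with n
    dsimp only
    split_ifs with h
    · rw [h]
    · simp

theorem pow (k : ℕ) : HasNonnegExpansion {k} (fun r => (r : ℂ) ^ k) :=
  (const_mul_pow one_pos k).congr fun r _ _ => by simp

theorem one : HasNonnegExpansion {0} (fun _ => 1) :=
  (pow 0).congr fun r _ _ => by simp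

/-- Nonnegativity makes the double series absolutely summable, so the order of summation may be
exchanged. -/
theorem tsum {S : ℕ → Set ℕ} {f : ℕ → ℝ → ℂ} (h : ∀ j, HasNonnegExpansion (S j) (f j))
    (hg : ∀ r : ℝ, 0 < r → r < 1 → HasSum (fun j => f j r) (g r)) :
    HasNonnegExpansion (⋃ j, S j) g := by
  choose c c0 c1 c2 using h
  have key : ∀ r : ℝ, 0 < r → r < 1 → Summable (fun p : ℕ × ℕ => c p.1 p.2 * r ^ p.2) := by
    intro r hr0 hr1
    have hre : ∀ j, HasSum (fun n => c j n * r ^ n) (f j r).re := by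
      intro j
      have h := Complex.hasSum_re (c2 j r hr0 hr1)
      refine h.congr_fun fun n => ?_
      rw [← Complex.ofReal_pow, ← Complex.ofReal_mul, Complex.ofReal_re]
    rw [summable_prod_of_nonneg fun p => mul_nonneg (c0 _ _) (by positivity)]
    refine ⟨fun j => (hre j).summable, ?_⟩
    exact (Complex.hasSum_re (hg r hr0 hr1)).summable.congr fun j => (hre j).tsum_eq.symm
  have hs : ∀ n, Summable fun j => c j n := by
    -- The radius 1/2 is arbitrary: a single nonzero radius gives summability of the n-th
    -- coefficients.
    intro n
    have h := (key (1 / 2) (by norm_num) (by norm_num)).comp_injective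
      (i := fun j : ℕ => (j, n)) (fun a b h => by simpa using h)
    refine (summable_mul_right_iff (pow_ne_zero n (by norm_num : (1 / 2 : ℝ) ≠ 0))).1 h
  refine ⟨fun n => ∑' j, c j n, fun n => tsum_nonneg fun j => c0 j n, ?_, fun r hr0 hr1 => ?_⟩
  · intro n hn
    obtain ⟨j, hj⟩ := Set.mem_iUnion.1 hn
    exact (hs n).tsum_pos (fun j => c0 j n) j (c1 j n hj)
  · have h1 : Summable (fun p : ℕ × ℕ => (c p.1 p.2 : ℂ) * (r : ℂ) ^ p.2) := by
      refine (Complex.summable_ofReal.2 (key r hr0 hr1)).congr fun p => by push_cast; rfl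
    have h2 := h1.hasSum
    have h3 := h2.prod_fiberwise fun j => c2 j r hr0 hr1
    rw [← h3.unique (hg r hr0 hr1)]
    have h4 := (Equiv.prodComm ℕ ℕ).hasSum_iff.2 h2
    refine h4.prod_fiberwise fun n => ?_
    have := (Complex.hasSum_ofReal.2 (hs n).hasSum).mul_right ((r : ℂ) ^ n)
    simpa [Function.comp_def] using this

theorem prod {f : ℕ → ℝ → ℂ} (h : ∀ j, HasNonnegExpansion {0} (f j)) (n : ℕ) :
    HasNonnegExpansion {0} (fun r => ∏ j ∈ range n, f j r) := by
  induction n with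
  | zero => simpa using one
  | succ n ih =>
    simp only [prod_range_succ]
    exact (ih.mul (h n)).mono (by simp)

/-- The difference has positive radius of convergence and vanishes on (0, 1), which accumulates at
0; the identity theorem applies. -/
theorem coeff_unique {c d : ℕ → ℝ}
    (h : ∀ r : ℝ, 0 < r → r < 1 → ∃ s : ℂ, HasSum (fun n => (c n : ℂ) * (r : ℂ) ^ n) s ∧
      HasSum (fun n => (d n : ℂ) * (r : ℂ) ^ n) s) : c = d := by
  let e : ℕ → ℝ := fun n => c n - d n
  have he : ∀ r : ℝ, 0 < r → r < 1 → HasSum (fun n => e n * r ^ n) 0 := by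
    intro r hr0 hr1
    obtain ⟨s, h1, h2⟩ := h r hr0 hr1
    have h3 := Complex.hasSum_re (h1.sub h2)
    rw [sub_self] at h3
    refine h3.congr_fun fun n => ?_
    simp only [e]
    norm_cast
    ring
  let p := FormalMultilinearSeries.ofScalars ℝ e
  have hp : 0 < p.radius := by
    have h1 := (he (1 / 2) (by norm_num) (by norm_num)).summable.tendsto_atTop_zero.norm
    have h2 : ((1 / 2 : NNReal) : ENNReal) ≤ p.radius := by
      refine p.le_radius_of_tendsto (l := ‖(0 : ℝ)‖) (h1.congr fun n => ?_)
      rw [norm_mul, FormalMultilinearSeries.ofScalars_norm]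
      simp
    exact lt_of_lt_of_le (by norm_num) h2
  have h1 := (p.hasFPowerSeriesOnBall hp).hasFPowerSeriesAt
  have h2 : ∀ᶠ x in 𝓝 (0 : ℝ), p.sum x = 0 := by
    refine h1.analyticAt.frequently_zero_iff_eventually_zero.1 ?_
    have h3 : ∀ᶠ x in 𝓝[>] (0 : ℝ), p.sum x = 0 := by
      filter_upwards [Ioo_mem_nhdsGT (zero_lt_one' ℝ)] with x hx
      rw [← (he x hx.1 hx.2).tsum_eq, FormalMultilinearSeries.sum]
      refine tsum_congr fun n => ?_
      simp [p, mul_comm]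
    exact h3.frequently.filter_mono (nhdsWithin_mono _ fun x hx => ne_of_gt hx)
  have h3 : p = 0 := h1.eq_zero_of_eventually h2
  have h4 : e = 0 := (FormalMultilinearSeries.ofScalars_series_eq_zero ℝ).1 h3
  funext n
  exact sub_eq_zero.1 (congrFun h4 n)

end HasNonnegExpansion

/-! ### Positivity in the residue classes 0, 1, 2, 3 modulo 8 -/

open HasNonnegExpansion

theorem hasNonnegExpansion_prod (b : ℕ) : ∀ m : ℕ, HasNonnegExpansion {0}
    (fun r => ∏ j ∈ range m, (1 + ((r : ℂ) ^ 8) ^ (2 * j + b))) :=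
  HasNonnegExpansion.prod fun j => (one.add (pow (8 * (2 * j + b)))).mono (by simp) |>.congr
    fun r _ _ => by rw [pow_mul]

theorem hasNonnegExpansion_mul_prod (a b : ℕ) (m : ℕ) : HasNonnegExpansion {a}
    (fun r => (r : ℂ) ^ a * ∏ j ∈ range m, (1 + ((r : ℂ) ^ 8) ^ (2 * j + b))) :=
  ((pow a).mul (hasNonnegExpansion_prod b m)).mono (by simp)

theorem HasNonnegExpansion.ofReal_mul {S : Set ℕ} {f : ℝ → ℂ} (hf : HasNonnegExpansion S f)
    {κ : ℝ} (hκ : 0 < κ) (k : ℕ) :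
    HasNonnegExpansion ((k + ·) '' S) (fun r => (κ : ℂ) * (r : ℂ) ^ k * f r) :=
  ((const_mul_pow hκ k).mul hf).mono (by simp)

/-- Sorts partitions into distinct even parts by the largest part; the partial sums telescope. In
this form the presence of every even power is visible. -/
theorem hasSum_qPochInf_neg {y : ℂ} (hy : ‖y‖ < 1) :
    HasSum (fun m : ℕ => y ^ (2 * m + 2) * ∏ j ∈ range m, (1 + y ^ (2 * j + 2)))
      (qPochInf (-y ^ 2) (y ^ 2) - 1) := by
  have hq := norm_sq_lt_one hy
  have e : ∀ m, ∏ j ∈ range m, (1 + y ^ (2 * j + 2)) = qPoch (-y ^ 2) (y ^ 2) m := by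
    intro m
    exact prod_congr rfl fun j _ => by ring
  simp only [e]
  have ht := tendsto_qPoch hq (-y ^ 2)
  obtain ⟨C, hC, h⟩ := exists_norm_le_of_tendsto ht
  have hs : Summable fun m => y ^ (2 * m + 2) * qPoch (-y ^ 2) (y ^ 2) m := by
    refine Summable.of_norm_bounded
      ((summable_geometric_of_lt_one (norm_nonneg _) hq).mul_right C) fun m => ?_
    rw [norm_mul, show y ^ (2 * m + 2) = (y ^ 2) ^ m * y ^ 2 by ring, norm_mul, norm_pow]
    gcongr
    · exact mul_le_of_le_one_right (by positivity) hq.le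
    · exact h m
  rw [hs.hasSum_iff_tendsto_nat]
  refine (ht.sub_const 1).congr fun n => ?_
  induction n with
  | zero => simp
  | succ n ih => rw [sum_range_succ, ← ih, qPoch_succ]; ring

theorem hasNonnegExpansion_qPochInf : HasNonnegExpansion {n | 16 ∣ n}
    (fun r => qPochInf (-((r : ℂ) ^ 8) ^ 2) (((r : ℂ) ^ 8) ^ 2)) := by
  have h : HasNonnegExpansion (⋃ m : ℕ, {8 * (2 * m + 2)})
      (fun r => qPochInf (-((r : ℂ) ^ 8) ^ 2) (((r : ℂ) ^ 8) ^ 2) - 1) := by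
    refine HasNonnegExpansion.tsum (fun m => hasNonnegExpansion_mul_prod _ 2 m)
      fun r hr0 hr1 => ?_
    have := hasSum_qPochInf_neg (y := (r : ℂ) ^ 8) (by
      rw [norm_pow]
      exact pow_lt_one₀ (norm_nonneg _) (norm_real_lt_one hr0 hr1) (by norm_num))
    simpa only [pow_mul] using this
  refine ((one.add h).congr fun r _ _ => by ring).mono ?_
  rintro n ⟨_ | m, rfl⟩
  · simp
  · refine Or.inr (Set.mem_iUnion.2 ⟨m, ?_⟩)
    simp
    ring

theorem hasNonnegExpansion_theta_one : HasNonnegExpansion {0, 8}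
    (fun r => theta 1 ((r : ℂ) ^ 8)) := by
  have h : HasNonnegExpansion (⋃ m : ℕ, {8 * (m + 1) ^ 2} ∪ {8 * (m + 1) ^ 2})
      (fun r => theta 1 ((r : ℂ) ^ 8) - 1) := by
    refine HasNonnegExpansion.tsum (fun m => (pow _).add (pow _)) fun r hr0 hr1 => ?_
    have h1 := hasSum_theta (t := (r : ℂ) ^ 8) (w := 1)
      (pow_ne_zero _ (by exact_mod_cast hr0.ne')) (by
        rw [norm_pow]
        exact pow_lt_one₀ (norm_nonneg _) (norm_real_lt_one hr0 hr1) (by norm_num)) one_ne_zero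
    have h2 := (hasSum_nat_add_iff' 1).2 h1.nat_add_neg
    simp only [range_one, sum_singleton] at h2
    rw [show theta 1 ((r : ℂ) ^ 8) - 1 = theta 1 ((r : ℂ) ^ 8) +
      1 ^ (0 : ℤ) * ((r : ℂ) ^ 8) ^ ((0 : ℤ) ^ 2) - (1 ^ ((0 : ℕ) : ℤ) *
        ((r : ℂ) ^ 8) ^ (((0 : ℕ) : ℤ) ^ 2) + 1 ^ (-((0 : ℕ) : ℤ)) *
          ((r : ℂ) ^ 8) ^ ((-((0 : ℕ) : ℤ)) ^ 2)) by simp]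
    refine h2.congr_fun fun n => ?_
    rw [one_zpow, one_zpow, neg_sq, one_mul, pow_mul]
    norm_cast
  refine ((one.add h).congr fun r _ _ => by ring).mono ?_
  rintro n (rfl | rfl)
  · simp
  · exact Or.inr (Set.mem_iUnion.2 ⟨0, by simp⟩)

theorem hasNonnegExpansion_theta_sq : HasNonnegExpansion {0, 8}
    (fun r => theta ((r : ℂ) ^ 8) (((r : ℂ) ^ 8) ^ 2)) := by
  have h : HasNonnegExpansion (⋃ m : ℕ, {8 * (2 * m ^ 2 + m)} ∪ {8 * (2 * m ^ 2 + 3 * m + 1)})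
      (fun r => theta ((r : ℂ) ^ 8) (((r : ℂ) ^ 8) ^ 2)) := by
    refine HasNonnegExpansion.tsum (fun m => (pow _).add (pow _)) fun r hr0 hr1 => ?_
    have hy : ‖(r : ℂ) ^ 8‖ < 1 := by
      rw [norm_pow]
      exact pow_lt_one₀ (norm_nonneg _) (norm_real_lt_one hr0 hr1) (by norm_num)
    have hy0 : (r : ℂ) ^ 8 ≠ 0 := pow_ne_zero _ (by exact_mod_cast hr0.ne')
    have h1 := (hasSum_theta (pow_ne_zero 2 hy0) (norm_sq_lt_one hy) hy0).nat_add_neg_add_one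
    simp only [pow_mul]
    generalize (r : ℂ) ^ 8 = y at *
    refine h1.congr_fun fun n => ?_
    have e : ∀ m : ℤ, y ^ m * (y ^ 2) ^ (m ^ 2) = y ^ (2 * m ^ 2 + m) := by
      intro m
      rw [← zpow_natCast y 2, ← zpow_mul, ← zpow_add₀ hy0]
      congr 1
      push_cast
      ring
    rw [e, e, ← zpow_natCast, ← zpow_natCast]
    congr 2
    push_cast
    ring
  refine h.mono ?_
  rintro n (rfl | rfl) <;> exact Set.mem_iUnion.2 ⟨0, by simp⟩

/-- The exponents at which the weighted generating function has a positive coefficient. -/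
theorem exists_positive_expansion {F : ℝ → ℂ}
    (hF : ∀ r : ℝ, 0 < r → r < 1 → HasSum (fun D : ℕ => r * (((r : ℂ) ^ 2) ^ (D ^ 2) *
      ((r : ℂ) ^ 2) ^ D * (∏ l ∈ range (D + 1), (1 + (r : ℂ) ^ 2 * ((r : ℂ) ^ 2) ^ (2 * l) -
        ((r : ℂ) ^ 2) ^ l * ((√2 : ℝ) * r)))⁻¹)) (F r)) :
    HasNonnegExpansion {n | n ≠ 0 ∧ n % 8 ≤ 3} F := by
  have h2 : 0 < √2 := by positivity
  have hX := fun m : ℕ => hasNonnegExpansion_mul_prod (8 * (m + 1)) 2 m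
  have hY := fun m : ℕ => hasNonnegExpansion_mul_prod (8 * m) 1 m
  have key : ∀ r : ℝ, 0 < r → r < 1 → ∃ X Y : ℂ,
      HasSum (fun m : ℕ => (r : ℂ) ^ (8 * (m + 1)) *
        ∏ j ∈ range m, (1 + ((r : ℂ) ^ 8) ^ (2 * j + 2))) X ∧
      HasSum (fun m : ℕ => (r : ℂ) ^ (8 * m) *
        ∏ j ∈ range m, (1 + ((r : ℂ) ^ 8) ^ (2 * j + 1))) Y ∧
      F r = (√2 : ℝ) * X + r ^ 3 * Y + qPochInf (-((r : ℂ) ^ 8) ^ 2) (((r : ℂ) ^ 8) ^ 2) *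
        (r * theta 1 ((r : ℂ) ^ 8) +
          (√2 : ℝ) * r ^ 2 * theta ((r : ℂ) ^ 8) (((r : ℂ) ^ 8) ^ 2)) := by
    intro r hr0 hr1
    have ht : (r : ℂ) ≠ 0 := by exact_mod_cast hr0.ne'
    have h := hF r hr0 hr1
    obtain ⟨G, hG⟩ := (summable_mul_left_iff ht).1 h.summable
    rw [h.unique (hG.mul_left _)]
    simpa only [pow_mul] using durfee_positive_form hr0 hr1 hG
  choose! X Y hX' hY' hE using key
  have eX := (HasNonnegExpansion.tsum hX hX').ofReal_mul h2 0
  have eY := (HasNonnegExpansion.tsum hY hY').ofReal_mul one_pos 3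
  have e1 := hasNonnegExpansion_theta_one.ofReal_mul one_pos 1
  have e2 := hasNonnegExpansion_theta_sq.ofReal_mul h2 2
  refine (((eX.add eY).add (hasNonnegExpansion_qPochInf.mul (e1.add e2))).congr
    (g := F) fun r hr0 hr1 => ?_).mono ?_
  · rw [hE r hr0 hr1]
    simp
  · rintro n ⟨hn0, hn⟩
    obtain ⟨k, a, ha, rfl⟩ : ∃ k a, a < 8 ∧ n = 8 * k + a :=
      ⟨n / 8, n % 8, Nat.mod_lt _ (by norm_num), by omega⟩
    have ha3 : a ≤ 3 := by omega
    simp only [Set.mem_union, Set.mem_image, Set.mem_iUnion, Set.mem_singleton_iff,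
      Set.mem_image2, Set.mem_insert_iff, Set.mem_ofPred_eq]
    -- Residue 0 comes from X, where n ≠ 0 is needed, and residue 3 from Y. For residues 1 and 2 the
    -- infinite product supplies a multiple of 16 and the theta function the remaining 0 or 8.
    rcases (by omega : a = 0 ∨ a = 3 ∨ a = 1 ∨ a = 2) with rfl | rfl | h
    · exact Or.inl (Or.inl ⟨8 * k, ⟨k - 1, by omega⟩, by omega⟩)
    · exact Or.inl (Or.inr ⟨8 * k, ⟨k, rfl⟩, by omega⟩)
    · have e : 8 * k + a = 16 * (k / 2) + (8 * (k % 2) + a) := by omega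
      have hk : 8 * (k % 2) = 0 ∨ 8 * (k % 2) = 8 := by omega
      refine Or.inr ⟨16 * (k / 2), dvd_mul_right _ _, 8 * (k % 2) + a, ?_, e.symm⟩
      rcases h with rfl | rfl
      · exact Or.inl ⟨8 * (k % 2), hk, by omega⟩
      · exact Or.inr ⟨8 * (k % 2), hk, by omega⟩

/-! ### The generating function of odd Durfee symbols -/

/-- Multisets with elements in `insert a A` are multisets with elements in `A` together with the
multiplicity of `a`. -/
def multisetInsertEquiv {a : ℕ} {A : Finset ℕ} (ha : a ∉ A) :
    ℕ × {m : Multiset ℕ // ∀ x ∈ m, x ∈ A} ≃ {m : Multiset ℕ // ∀ x ∈ m, x ∈ insert a A} where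
  toFun p := ⟨Multiset.replicate p.1 a + p.2.1, fun x hx => by
    rcases Multiset.mem_add.1 hx with h | h
    · exact mem_insert.2 (Or.inl (Multiset.eq_of_mem_replicate h))
    · exact mem_insert_of_mem (p.2.2 x h)⟩
  invFun m := ⟨m.1.count a, m.1.filter (· ≠ a), fun x hx => by
    obtain ⟨h1, h2⟩ := Multiset.mem_filter.1 hx
    exact (mem_insert.1 (m.2 x h1)).resolve_left h2⟩
  left_inv p := by
    obtain ⟨k, m, hm⟩ := p
    have h : ∀ x ∈ m, x ≠ a := fun x hx h => ha (h ▸ hm x hx)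
    refine Prod.ext ?_ (Subtype.ext ?_)
    · simp [Multiset.count_eq_zero_of_notMem fun h' => h a h' rfl]
    · have h1 : (Multiset.replicate k a).filter (· ≠ a) = 0 :=
        Multiset.filter_eq_nil.2 fun x hx => by simp [Multiset.eq_of_mem_replicate hx]
      simp only [Multiset.filter_add, h1, zero_add]
      exact Multiset.filter_eq_self.2 h
  right_inv m := by
    refine Subtype.ext ?_
    have := Multiset.filter_add_not (· = a) m.1
    rwa [Multiset.filter_eq'] at this

/-- Each admissible part contributes a geometric series over its multiplicity. Absolute summability
is carried along to multiply the series. -/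
theorem hasSum_multiset (A : Finset ℕ) {g : ℕ → ℂ} (hg : ∀ a ∈ A, ‖g a‖ < 1) :
    Summable (fun m : {m : Multiset ℕ // ∀ x ∈ m, x ∈ A} => ‖(m.1.map g).prod‖) ∧
    HasSum (fun m : {m : Multiset ℕ // ∀ x ∈ m, x ∈ A} => (m.1.map g).prod)
      (∏ a ∈ A, (1 - g a)⁻¹) := by
  induction A using Finset.induction_on with
  | empty =>
    have h0 : ∀ m : {m : Multiset ℕ // ∀ x ∈ m, x ∈ (∅ : Finset ℕ)}, m = ⟨0, by simp⟩ :=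
      fun m => Subtype.ext (Multiset.eq_zero_of_forall_notMem fun x hx => by simpa using m.2 x hx)
    let _ : Unique {m : Multiset ℕ // ∀ x ∈ m, x ∈ (∅ : Finset ℕ)} := ⟨⟨⟨0, by simp⟩⟩, h0⟩
    refine ⟨(hasSum_fintype _).summable, ?_⟩
    have := hasSum_unique (fun m : {m : Multiset ℕ // ∀ x ∈ m, x ∈ (∅ : Finset ℕ)} =>
      (m.1.map g).prod)
    rw [h0 default] at this
    simpa using this
  | insert a A ha ih =>
    have ih := ih fun b hb => hg b (mem_insert_of_mem hb)
    have hga := hg a (mem_insert_self a A)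
    have h1 : Summable fun k : ℕ => ‖g a ^ k‖ := by
      simpa only [norm_pow] using summable_geometric_of_lt_one (norm_nonneg _) hga
    have h2 := h1.mul_norm ih.1
    have h3 := (hasSum_geometric_of_norm_lt_one hga).mul ih.2 h2.of_norm
    rw [prod_insert ha]
    have e : ∀ p : ℕ × {m : Multiset ℕ // ∀ x ∈ m, x ∈ A},
        (((multisetInsertEquiv ha p).1).map g).prod = g a ^ p.1 * (p.2.1.map g).prod := by
      intro p
      simp [multisetInsertEquiv]
    refine ⟨(multisetInsertEquiv ha).summable_iff.1 (h2.congr fun p => ?_),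
      (multisetInsertEquiv ha).hasSum_iff.1 (h3.congr_fun fun p => ?_)⟩
    · simp [e]
    · simp [e]

/-- The odd numbers up to `2 * D + 1`. -/
def oddParts (D : ℕ) : Finset ℕ := (range (D + 1)).image fun k => 2 * k + 1

theorem mem_oddParts {D x : ℕ} : x ∈ oddParts D ↔ Odd x ∧ x ≤ 2 * D + 1 := by
  simp only [oddParts, mem_image, mem_range]
  constructor
  · rintro ⟨k, hk, rfl⟩
    exact ⟨⟨k, rfl⟩, by omega⟩
  · rintro ⟨⟨k, rfl⟩, h⟩
    exact ⟨k, by omega, rfl⟩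

theorem prod_oddParts (D : ℕ) (f : ℕ → ℂ) :
    ∏ a ∈ oddParts D, f a = ∏ k ∈ range (D + 1), f (2 * k + 1) :=
  prod_image fun a _ b _ h => by simpa using h

/-- A row of an odd Durfee symbol with subscript `D`. -/
abbrev OddRow (D : ℕ) : Type := {m : Multiset ℕ // ∀ x ∈ m, x ∈ oddParts D}

/-- Odd Durfee symbols are pairs of rows with the same bound. -/
def durfeeEquiv : (Σ D, OddRow D × OddRow D) ≃ Σ n, OddDurfeeSymbol n where
  toFun p := ⟨p.2.1.1.sum + p.2.2.1.sum + 2 * p.1 ^ 2 + 2 * p.1 + 1,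
    ⟨p.1, p.2.1.1, p.2.2.1, fun a ha => (mem_oddParts.1 (p.2.1.2 a ha)).1,
      fun a ha => (mem_oddParts.1 (p.2.2.2 a ha)).1, fun a ha => (mem_oddParts.1 (p.2.1.2 a ha)).2,
      fun a ha => (mem_oddParts.1 (p.2.2.2 a ha)).2, rfl⟩⟩
  invFun s := ⟨s.2.D, ⟨s.2.top, fun a ha => mem_oddParts.2 ⟨s.2.odd_top a ha, s.2.top_le a ha⟩⟩,
    ⟨s.2.bottom, fun a ha => mem_oddParts.2 ⟨s.2.odd_bottom a ha, s.2.bottom_le a ha⟩⟩⟩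
  left_inv _ := rfl
  right_inv s := by
    obtain ⟨n, D, u, v, h1, h2, h3, h4, h5⟩ := s
    subst h5
    rfl

theorem multiset_prod_map_mul_pow (z t : ℂ) (m : Multiset ℕ) :
    (m.map fun a => z * t ^ a).prod = z ^ m.card * t ^ m.sum := by
  induction m using Multiset.induction_on with
  | empty => simp
  | cons a m ih => simp [ih, pow_succ, pow_add]; ring

theorem hasSum_oddRow (D : ℕ) {z t : ℂ} (hz : ‖z‖ = 1) (ht : ‖t‖ < 1) :
    Summable (fun m : OddRow D => ‖z ^ m.1.card * t ^ m.1.sum‖) ∧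
    HasSum (fun m : OddRow D => z ^ m.1.card * t ^ m.1.sum)
      (∏ k ∈ range (D + 1), (1 - z * t ^ (2 * k + 1))⁻¹) := by
  have h := hasSum_multiset (oddParts D) (g := fun a => z * t ^ a) (fun a ha => by
    rw [norm_mul, hz, one_mul, norm_pow]
    exact pow_lt_one₀ (norm_nonneg _) ht (mem_oddParts.1 ha).1.pos.ne')
  rw [prod_oddParts] at h
  simpa only [multiset_prod_map_mul_pow] using h

/-- The weighted term of a pair of rows. -/
noncomputable def durfeeTerm (z t : ℂ) (D : ℕ) (p : OddRow D × OddRow D) : ℂ :=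
  z ^ ((p.1.1.card : ℤ) - (p.2.1.card : ℤ)) *
    t ^ (p.1.1.sum + p.2.1.sum + 2 * D ^ 2 + 2 * D + 1)

theorem hasSum_durfeeTerm (D : ℕ) {z t : ℂ} (hz : ‖z‖ = 1) (ht : ‖t‖ < 1) :
    HasSum (durfeeTerm z t D) (t ^ (2 * D ^ 2 + 2 * D + 1) *
      ((∏ k ∈ range (D + 1), (1 - z * t ^ (2 * k + 1))⁻¹) *
        ∏ k ∈ range (D + 1), (1 - z⁻¹ * t ^ (2 * k + 1))⁻¹)) := by
  have hz0 : z ≠ 0 := by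
    rintro rfl
    simp at hz
  have h1 := hasSum_oddRow D hz ht
  have h2 := hasSum_oddRow D (z := z⁻¹) (by rw [norm_inv, hz, inv_one]) ht
  have h3 := (h1.2.mul h2.2 (h1.1.mul_norm h2.1).of_norm).mul_left (t ^ (2 * D ^ 2 + 2 * D + 1))
  refine h3.congr_fun fun p => ?_
  rw [durfeeTerm, zpow_sub₀ hz0, zpow_natCast, zpow_natCast, inv_pow]
  field_simp
  ring

theorem exists_durfee_bound {t : ℂ} (ht : ‖t‖ < 1) : ∃ C : ℝ, 0 < C ∧ ∀ D : ℕ,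
    ‖∏ k ∈ range (D + 1), (1 - t ^ (2 * k + 1))⁻¹‖ ≤ C := by
  have hq := norm_sq_lt_one ht
  obtain ⟨C, hC, h⟩ := exists_norm_inv_qPoch_le hq (one_sub_mul_pow_ne_zero hq ht)
  refine ⟨C, hC, fun D => ?_⟩
  refine le_of_eq_of_le ?_ (h (D + 1))
  rw [qPoch, prod_inv_distrib]
  congr 2
  exact prod_congr rfl fun k _ => by ring

/-- The norm of a term is the term with z = 1, whose sum over each D is known and dominated by a
geometric series. -/
theorem summable_durfeeTerm {z : ℂ} (hz : ‖z‖ = 1) {r : ℝ} (hr0 : 0 < r) (hr1 : r < 1) :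
    Summable fun p : Σ D, OddRow D × OddRow D => durfeeTerm z r p.1 p.2 := by
  have ht := norm_real_lt_one hr0 hr1
  refine Summable.of_norm ?_
  have e : ∀ D (p : OddRow D × OddRow D), ‖durfeeTerm z r D p‖ = (durfeeTerm 1 r D p).re := by
    intro D p
    rw [durfeeTerm, durfeeTerm, norm_mul, norm_zpow, hz, one_zpow, one_zpow, one_mul, one_mul,
      norm_pow, Complex.norm_real, Real.norm_of_nonneg hr0.le, ← Complex.ofReal_pow,
      Complex.ofReal_re]
  have h := fun D => Complex.hasSum_re (hasSum_durfeeTerm D (norm_one (α := ℂ)) ht)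
  rw [summable_sigma_of_nonneg fun _ => norm_nonneg _]
  simp only [e]
  refine ⟨fun D => (h D).summable, ?_⟩
  simp only [(h _).tsum_eq]
  refine (Complex.hasSum_re (Summable.hasSum ?_)).summable
  obtain ⟨C, hC, hb⟩ := exists_durfee_bound ht
  refine Summable.of_norm_bounded
    ((summable_geometric_of_lt_one (norm_nonneg _) ht).mul_right (C * C)) fun D => ?_
  simp only [inv_one, one_mul]
  rw [norm_mul, norm_mul, norm_pow]
  refine mul_le_mul ?_ (mul_le_mul (hb D) (hb D) (norm_nonneg _) hC.le) (by positivity)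
    (by positivity)
  refine pow_le_pow_of_le_one (norm_nonneg _) ht.le ?_
  nlinarith [sq_nonneg D]

/-! ### Rank counts from the weighted sum, and the conclusion -/

theorem norm_zeta8 : ‖zeta8‖ = 1 := by
  have h : ‖zeta8‖ ^ 2 = 1 := by rw [← norm_pow, zeta8_sq, Complex.norm_I]
  exact (pow_eq_one_iff_of_nonneg (norm_nonneg _) two_ne_zero).1 h

/-- The sum of `zeta8 ^ rank` over the odd Durfee symbols of `n`. -/
noncomputable def rankSum (n : ℕ) : ℂ := ∑' s : OddDurfeeSymbol n, zeta8 ^ s.oddRank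

/-- One absolutely convergent sum over all symbols, grouped by n on one side and by D on the other.
-/
theorem hasSum_rankSum {r : ℝ} (hr0 : 0 < r) (hr1 : r < 1) : ∃ s : ℂ,
    HasSum (fun n : ℕ => rankSum n * (r : ℂ) ^ n) s ∧
    HasSum (fun D : ℕ => r * (((r : ℂ) ^ 2) ^ (D ^ 2) *
      ((r : ℂ) ^ 2) ^ D * (∏ l ∈ range (D + 1), (1 + (r : ℂ) ^ 2 * ((r : ℂ) ^ 2) ^ (2 * l) -
        ((r : ℂ) ^ 2) ^ l * ((√2 : ℝ) * r)))⁻¹)) s := by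
  have h := (summable_durfeeTerm norm_zeta8 hr0 hr1).hasSum
  refine ⟨_, ?_, (h.sigma fun D => hasSum_durfeeTerm D norm_zeta8
    (norm_real_lt_one hr0 hr1)).congr_fun fun D => ?_⟩
  · have h1 : HasSum ((fun s : Σ n, OddDurfeeSymbol n => zeta8 ^ s.2.oddRank * (r : ℂ) ^ s.1) ∘
        durfeeEquiv) (∑' p : Σ D, OddRow D × OddRow D, durfeeTerm zeta8 r p.1 p.2) :=
      h.congr_fun fun p => rfl
    have h2 : ∀ n, HasSum (fun s : OddDurfeeSymbol n => zeta8 ^ s.oddRank * (r : ℂ) ^ n)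
        (rankSum n * (r : ℂ) ^ n) := fun n =>
      (Summable.of_finite (f := fun s : OddDurfeeSymbol n => zeta8 ^ s.oddRank)).hasSum.mul_right _
    exact (durfeeEquiv.hasSum_iff.1 h1).sigma h2
  · rw [← prod_mul_distrib, ← prod_inv_distrib, ← mul_assoc,
      show (r : ℂ) ^ (2 * D ^ 2 + 2 * D + 1) = r * (((r : ℂ) ^ 2) ^ (D ^ 2) * ((r : ℂ) ^ 2) ^ D) by
        ring]
    congr 1
    refine prod_congr rfl fun l _ => ?_
    have h0 := zeta8_ne_zero
    rw [← mul_inv, ← zeta8_add_inv]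
    congr 1
    field_simp
    ring

theorem zeta8_zpow (k : ℤ) : zeta8 ^ k =
    ∑ a ∈ range 8, if k ≡ (a : ℤ) [ZMOD 8] then zeta8 ^ a else 0 := by
  have h8 : zeta8 ^ 8 = 1 := by
    rw [show zeta8 ^ 8 = (zeta8 ^ 2) ^ 4 by ring, zeta8_sq, Complex.I_pow_four]
  obtain ⟨b, hb⟩ : ∃ b : ℕ, (b : ℤ) = k % 8 := ⟨(k % 8).toNat, by omega⟩
  have hb8 : b ∈ range 8 := by
    rw [mem_range]; omega
  rw [sum_eq_single_of_mem b hb8 fun a ha hab => if_neg fun h => hab ?_, if_pos ?_]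
  · rw [show k = b + 8 * (k / 8) by omega, zpow_add₀ zeta8_ne_zero, zpow_mul, zpow_natCast,
      show zeta8 ^ (8 : ℤ) = 1 from h8, one_zpow, mul_one]
  · rw [Int.ModEq]; omega
  · rw [mem_range] at ha
    rw [Int.ModEq] at h
    omega

theorem oddRankCount_congr {a b M : ℤ} (h : a ≡ b [ZMOD M]) (n : ℕ) :
    oddRankCount a M n = oddRankCount b M n :=
  Nat.card_congr (Equiv.subtypeEquivRight fun _ => ⟨fun h' => h'.trans h, fun h' => h'.trans h.symm⟩)

/-- Interchanging the two rows. -/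
def OddDurfeeSymbol.swap (n : ℕ) : OddDurfeeSymbol n ≃ OddDurfeeSymbol n where
  toFun s := ⟨s.D, s.bottom, s.top, s.odd_bottom, s.odd_top, s.bottom_le, s.top_le, by
    have := s.weight_eq; omega⟩
  invFun s := ⟨s.D, s.bottom, s.top, s.odd_bottom, s.odd_top, s.bottom_le, s.top_le, by
    have := s.weight_eq; omega⟩
  left_inv _ := rfl
  right_inv _ := rfl

theorem oddRankCount_neg (a M : ℤ) (n : ℕ) : oddRankCount (-a) M n = oddRankCount a M n := by
  refine Nat.card_congr ((OddDurfeeSymbol.swap n).subtypeEquiv fun s => ?_)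
  have : (OddDurfeeSymbol.swap n s).oddRank = -s.oddRank := by
    simp [OddDurfeeSymbol.oddRank, OddDurfeeSymbol.swap]
  rw [this]
  exact ⟨fun h => by simpa using h.neg, fun h => by simpa using h.neg⟩

/-- Interchanging rows identifies the classes 5, 6, 7 with 3, 2, 1. Then ζ² + ζ⁶ = 0 removes class
2, while ζ + ζ⁷ = √2 and ζ³ + ζ⁵ = -√2. -/
theorem rankSum_eq (n : ℕ) : rankSum n =
    (((oddRankCount 0 8 n : ℝ) - oddRankCount 4 8 n +
      √2 * ((oddRankCount 1 8 n : ℝ) - oddRankCount 3 8 n) : ℝ) : ℂ) := by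
  classical
  have := Fintype.ofFinite (OddDurfeeSymbol n)
  have e : ∀ a : ℕ, ∑ s : OddDurfeeSymbol n,
      (if s.oddRank ≡ (a : ℤ) [ZMOD 8] then zeta8 ^ a else 0) =
        oddRankCount a 8 n * zeta8 ^ a := by
    intro a
    rw [← sum_filter, sum_const, nsmul_eq_mul, oddRankCount, Nat.card_eq_fintype_card,
      Fintype.card_subtype]
  have h : ∑ s : OddDurfeeSymbol n, zeta8 ^ s.oddRank =
      ∑ a ∈ range 8, (oddRankCount a 8 n : ℂ) * zeta8 ^ a := by
    simp only [zeta8_zpow]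
    rw [sum_comm]
    exact sum_congr rfl fun a _ => e a
  have h7 : oddRankCount 7 8 n = oddRankCount 1 8 n := by
    rw [← oddRankCount_neg 1, oddRankCount_congr (a := 7) (b := -1) (by decide)]
  have h6 : oddRankCount 6 8 n = oddRankCount 2 8 n := by
    rw [← oddRankCount_neg 2, oddRankCount_congr (a := 6) (b := -2) (by decide)]
  have h5 : oddRankCount 5 8 n = oddRankCount 3 8 n := by
    rw [← oddRankCount_neg 3, oddRankCount_congr (a := 5) (b := -3) (by decide)]
  have hz := zeta8_sq
  have hI := Complex.I_sq
  have hm := zeta8_mul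
  rw [rankSum, tsum_fintype, h]
  simp only [sum_range_succ, range_zero, sum_empty, zero_add, Nat.cast_ofNat, Nat.cast_zero,
    Nat.cast_one, h5, h6, h7, pow_zero, pow_one, mul_one]
  rw [show zeta8 ^ 3 = zeta8 * zeta8 ^ 2 by ring, show zeta8 ^ 4 = (zeta8 ^ 2) ^ 2 by ring,
    show zeta8 ^ 5 = zeta8 * (zeta8 ^ 2) ^ 2 by ring, show zeta8 ^ 6 = (zeta8 ^ 2) ^ 3 by ring,
    show zeta8 ^ 7 = zeta8 * (zeta8 ^ 2) ^ 3 by ring, hz]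
  push_cast
  rw [← hm]
  have hI3 : Complex.I ^ 3 = -Complex.I := by
    linear_combination Complex.I * hI
  rw [hI3, hI]
  ring

theorem card_add_sum_even {m : Multiset ℕ} (h : ∀ a ∈ m, Odd a) : Even (m.card + m.sum) := by
  induction m using Multiset.induction_on with
  | empty => simp
  | cons a m ih =>
    have h1 := ih fun b hb => h b (Multiset.mem_cons_of_mem hb)
    have h2 := h a (Multiset.mem_cons_self a m)
    rw [Multiset.card_cons, Multiset.sum_cons]
    obtain ⟨k, hk⟩ := h1
    obtain ⟨l, hl⟩ := h2
    exact ⟨k + l + 1, by omega⟩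

/-- A sum of odd numbers has the parity of their count, so the rank is congruent to n + 1 modulo 2.
-/
theorem oddRankCount_eq_zero {a : ℤ} {n : ℕ} (h : (a + n) % 2 = 0) : oddRankCount a 8 n = 0 := by
  rw [oddRankCount, Nat.card_eq_zero]
  refine Or.inl ⟨fun ⟨s, hs⟩ => ?_⟩
  obtain ⟨k, hk⟩ := card_add_sum_even s.odd_top
  obtain ⟨l, hl⟩ := card_add_sum_even s.odd_bottom
  have hw := s.weight_eq
  rw [OddDurfeeSymbol.oddRank, Int.ModEq] at hs
  generalize s.D ^ 2 = d at *
  omega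

/-- The weighted counts and the coefficients of the nonnegative expansion belong to the same
function on (0, 1), hence agree. -/
theorem rankSum_pos {n : ℕ} (h0 : n ≠ 0) (hn : n % 8 ≤ 3) :
    0 < (oddRankCount 0 8 n : ℝ) - oddRankCount 4 8 n +
      √2 * ((oddRankCount 1 8 n : ℝ) - oddRankCount 3 8 n) := by
  obtain ⟨c, -, c1, c2⟩ := exists_positive_expansion
    (F := fun r => ∑' n : ℕ, rankSum n * (r : ℂ) ^ n) fun r hr0 hr1 => by
      obtain ⟨s, h1, h2⟩ := hasSum_rankSum hr0 hr1
      simpa only [h1.tsum_eq] using h2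
  have key := HasNonnegExpansion.coeff_unique (c := c)
    (d := fun n => (oddRankCount 0 8 n : ℝ) - oddRankCount 4 8 n +
      √2 * ((oddRankCount 1 8 n : ℝ) - oddRankCount 3 8 n)) fun r hr0 hr1 => by
      obtain ⟨s, h1, h2⟩ := hasSum_rankSum hr0 hr1
      refine ⟨_, c2 r hr0 hr1, ?_⟩
      simp only [← rankSum_eq]
      exact h1.summable.hasSum
  have h := c1 n ⟨h0, hn⟩
  rwa [key] at h

/-- For odd n the classes 1 and 3 are empty, for even n the classes 0 and 4; `rankSum_pos` then
speaks of a single difference. The case r = 0, n = 0 is the excluded exponent 0. -/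
theorem mainTheorem9 :
    (∀ r ∈ ({1, 3} : Set ℕ), ∀ n : ℕ,
      oddRankCount 0 8 (8 * n + r) > oddRankCount 4 8 (8 * n + r)) ∧
    (∀ r ∈ ({0, 2} : Set ℕ), ∀ n : ℕ, (r = 0 → 1 ≤ n) →
      oddRankCount 1 8 (8 * n + r) > oddRankCount 3 8 (8 * n + r)) := by
  refine ⟨fun r hr n => ?_, fun r hr n hn => ?_⟩
  · have hr' : r = 1 ∨ r = 3 := hr
    have h := rankSum_pos (n := 8 * n + r) (by omega) (by omega)
    rw [oddRankCount_eq_zero (a := 1) (by omega), oddRankCount_eq_zero (a := 3) (by omega)] at h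
    simpa using h
  · have hr' : r = 0 ∨ r = 2 := hr
    have h := rankSum_pos (n := 8 * n + r) (by omega) (by omega)
    rw [oddRankCount_eq_zero (a := 0) (by omega), oddRankCount_eq_zero (a := 4) (by omega)] at h
    simp only [Nat.cast_zero, sub_self, zero_add] at h
    have h2 := (mul_pos_iff_of_pos_left (by positivity)).1 h
    exact_mod_cast sub_pos.1 h2
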